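/- Let $s\ge 0$ be an integer. For a finite simple graph $G=(V,E)$ and a set $T\subseteq V$, an odd $T$-cycle of $G$ is a (not necessarily induced) cycle of $G$ with an odd number of vertices that contains at least one vertex of $T$, and an odd $T$-cycle transversal is a set $S\subseteq V$ that contains at least one vertex of every odd $T$-cycle of $G$. A graph is $(sP_1+P_3)$-free if it has no induced subgraph isomorphic to the disjoint union $sP_1+P_3$ of $s$ isolated vertices and a path on three vertices. Theorem. For every integer $s\ge 0$, Subset Odd Cycle Transversal can be solved in polynomial time for $(sP_1+P_3)$-free graphs. That is, for every $s\ge0$ there are algorithms running in time polynomial in $n=|V|$ (with the polynomial depending only on $s$) such that, for every $(sP_1+P_3)$-free graph $G=(V,E)$ and every $T\subseteq V$, the first, on input $(G,T)$, outputs a minimum-size odd $T$-cycle transversal of $G$, and the second, on input $(G,T,k)$ with $k$ a positive integer, decides whether $G$ has an odd $T$-cycle transversal of size at most $k$. (Algorithms are random-access machine programs with addition, subtraction and zero tests under the uniform cost measure, without multiplication; graphs are given by adjacency matrices.) -/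

import Mathlib

/-! ### Odd `T`-cycle transversals -/

namespace SubsetOCT

/-- `S` is an odd `T`-cycle transversal of `G`: it contains a vertex of every cycle of `G` that has
odd length and passes through a vertex of `T`. -/
def IsOddTCycleTransversal {V : Type*} (G : SimpleGraph V) (T S : Finset V) : Prop :=
  ∀ (u : V) (C : G.Walk u u), C.IsCycle → Odd C.length → (∃ v ∈ T, v ∈ C.support) →
    ∃ v ∈ S, v ∈ C.support

/-- `S` is an odd `T`-cycle transversal of `G` of smallest possible size. -/
def IsMinimumOddTCycleTransversal {V : Type*} (G : SimpleGraph V) (T S : Finset V) : Prop :=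
  IsOddTCycleTransversal G T S ∧ ∀ S' : Finset V, IsOddTCycleTransversal G T S' → S.card ≤ S'.card

/-- The graph `sP₁ + P₃`: the disjoint union of `s` isolated vertices and a path on three vertices. -/
abbrev sP1P3 (s : ℕ) : SimpleGraph (Fin s ⊕ Fin 3) :=
  (⊥ : SimpleGraph (Fin s)) ⊕g SimpleGraph.pathGraph 3

/-- `G` is `H`-free: no induced subgraph of `G` is isomorphic to `H`. -/
def InducedFree {W V : Type*} (H : SimpleGraph W) (G : SimpleGraph V) : Prop :=
  ¬ H.IsIndContained G

/-! ### Random-access machine programs and their running time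

The machine has integer registers and random-access arrays, all holding natural numbers. The only
arithmetic is addition and truncated subtraction; there is no multiplication, so that the uniform
cost used here agrees with Turing machine time up to a polynomial. -/

/-- The memory: registers `reg x`, and arrays `arr a` with cells `arr a 0`, `arr a 1`, … -/
@[ext]
structure Memory where
  reg : ℕ → ℕ
  arr : ℕ → ℕ → ℕ

/-- Expressions: constants, registers, array cells `a[i]`, addition and truncated subtraction. -/
inductive Exp where
  | const (c : ℕ)
  | reg (x : ℕ)
  | cell (a : ℕ) (i : Exp)
  | add (e₁ e₂ : Exp)
  | sub (e₁ e₂ : Exp)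

/-- The value of an expression. -/
def Exp.eval (σ : Memory) : Exp → ℕ
  | .const c => c
  | .reg x => σ.reg x
  | .cell a i => σ.arr a (i.eval σ)
  | .add e₁ e₂ => e₁.eval σ + e₂.eval σ
  | .sub e₁ e₂ => e₁.eval σ - e₂.eval σ

/-- The number of steps needed to evaluate an expression: one for each operation in it. -/
def Exp.cost : Exp → ℕ
  | .const _ => 1
  | .reg _ => 1
  | .cell _ i => i.cost + 1
  | .add e₁ e₂ => e₁.cost + e₂.cost + 1
  | .sub e₁ e₂ => e₁.cost + e₂.cost + 1

/-- Programs. A test `e` succeeds when the value of `e` is nonzero. -/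
inductive Prog where
  | skip
  | assign (x : ℕ) (e : Exp)
  | store (a : ℕ) (i e : Exp)
  | seq (P Q : Prog)
  | cond (e : Exp) (P Q : Prog)
  | loop (e : Exp) (P : Prog)

/-- `x := v`. -/
def Memory.setReg (σ : Memory) (x v : ℕ) : Memory :=
  { σ with reg := Function.update σ.reg x v }

/-- `a[i] := v`. -/
def Memory.setCell (σ : Memory) (a i v : ℕ) : Memory :=
  { σ with arr := Function.update σ.arr a (Function.update (σ.arr a) i v) }

/-- `Run P σ σ' t`: started in memory `σ`, the program `P` halts in memory `σ'` after exactly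
`t` steps. -/
inductive Run : Prog → Memory → Memory → ℕ → Prop where
  | skip (σ : Memory) : Run .skip σ σ 1
  | assign (σ : Memory) (x : ℕ) (e : Exp) :
      Run (.assign x e) σ (σ.setReg x (e.eval σ)) (e.cost + 1)
  | store (σ : Memory) (a : ℕ) (i e : Exp) :
      Run (.store a i e) σ (σ.setCell a (i.eval σ) (e.eval σ)) (i.cost + e.cost + 1)
  | seq {P Q : Prog} {σ σ' σ'' : Memory} {t t' : ℕ} (hP : Run P σ σ' t) (hQ : Run Q σ' σ'' t') :
      Run (.seq P Q) σ σ'' (t + t')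
  | cond_true {e : Exp} {P Q : Prog} {σ σ' : Memory} {t : ℕ} (he : e.eval σ ≠ 0)
      (hP : Run P σ σ' t) : Run (.cond e P Q) σ σ' (e.cost + 1 + t)
  | cond_false {e : Exp} {P Q : Prog} {σ σ' : Memory} {t : ℕ} (he : e.eval σ = 0)
      (hQ : Run Q σ σ' t) : Run (.cond e P Q) σ σ' (e.cost + 1 + t)
  | loop_true {e : Exp} {P : Prog} {σ σ' σ'' : Memory} {t t' : ℕ} (he : e.eval σ ≠ 0)
      (hP : Run P σ σ' t) (hL : Run (.loop e P) σ' σ'' t') :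
      Run (.loop e P) σ σ'' (e.cost + 1 + t + t')
  | loop_false {e : Exp} {P : Prog} {σ : Memory} (he : e.eval σ = 0) :
      Run (.loop e P) σ σ (e.cost + 1)

/-! ### The computational problem -/

open Classical in
/-- The initial memory for an instance `(G, T, k)`, where `G` has vertices `0, …, n - 1`:
register `0` holds `n`, register `1` holds `k`, array `0` is the adjacency matrix of `G` (row by
row), array `1` is the characteristic vector of `T`, and everything else is `0`. -/
noncomputable def input {n : ℕ} (G : SimpleGraph (Fin n)) (T : Finset (Fin n)) (k : ℕ) : Memory where
  reg x := if x = 0 then n else if x = 1 then k else 0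
  arr a x :=
    if a = 0 then (if ∃ i j : Fin n, x = i.val * n + j.val ∧ G.Adj i j then 1 else 0)
    else if a = 1 then (if ∃ i : Fin n, x = i.val ∧ i ∈ T then 1 else 0)
    else 0

/-- For inputs `(G, T)` with `G` in the class `𝒢`, a minimum odd `T`-cycle transversal can be
computed in time polynomial in the number of vertices. Upon halting, array `2` is the
characteristic vector of the transversal. -/
def MinimumSolvableInPolyTime (𝒢 : ∀ n : ℕ, SimpleGraph (Fin n) → Prop) : Prop :=
  ∃ (P : Prog) (p : Polynomial ℕ), ∀ (n : ℕ) (G : SimpleGraph (Fin n)) (T : Finset (Fin n)),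
    𝒢 n G → ∃ (σ : Memory) (t : ℕ), Run P (input G T 0) σ t ∧ t ≤ p.eval n ∧
      ∃ S : Finset (Fin n), IsMinimumOddTCycleTransversal G T S ∧
        ∀ i : Fin n, σ.arr 2 i.val = if i ∈ S then 1 else 0

open Classical in
/-- For inputs `(G, T, k)` with `G` in the class `𝒢` and `k` a positive integer, it can be decided
in time polynomial in the number of vertices whether `G` has an odd `T`-cycle transversal of size
at most `k`. Upon halting, register `2` holds the answer. -/
def DecidableInPolyTime (𝒢 : ∀ n : ℕ, SimpleGraph (Fin n) → Prop) : Prop :=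
  ∃ (P : Prog) (p : Polynomial ℕ), ∀ (n : ℕ) (G : SimpleGraph (Fin n)) (T : Finset (Fin n))
    (k : ℕ), 0 < k → 𝒢 n G → ∃ (σ : Memory) (t : ℕ), Run P (input G T k) σ t ∧ t ≤ p.eval n ∧
      σ.reg 2 = if ∃ S : Finset (Fin n), IsOddTCycleTransversal G T S ∧ S.card ≤ k then 1 else 0

end SubsetOCT

/-! The complements of odd T-cycle transversals are the sets B that induce no odd T-cycle (`TBip`),
so a largest such B is sought. The crux is `exists_kernel`: there are sets K and F, of size bounded
in terms of s alone, such that every greedy extension of K is a maximum `TBip` set. Greedy means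
adding first vertices outside T and then arbitrary ones, as long as no odd T-cycle arises, and never
a vertex with two neighbours in F. Trying all pairs (K, F) and keeping the largest result solves
both problems. Each greedy test takes polynomial time because a set containing an odd T-cycle
contains one of bounded length (`exists_short_oddTCycle`).

Let B be optimal. If B has few vertices of T, then it misses few vertices outside T, since V \ T is
a competitor. In that case K consists of B ∩ T and, for each missed vertex, the rest of a short
cycle that its addition to B would close. Otherwise Ramsey's theorem gives a large independent set I
⊆ B ∩ T. Call a vertex low if it has at most one neighbour in I, and high otherwise. Freeness makes
every high vertex adjacent to all but fewer than s members of I, and it makes the low vertices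
induce a disjoint union of cliques. So two high vertices have many common neighbours in T, and the
absence of odd T-cycles becomes a condition on triangles and on 5-cycles u q q' v i with u, v high,
q, q' low and i in I (`tBip_iff_local`).

If B has at most one high vertex, it joins I in the kernel, F = I bars all other high vertices, and
sizes are compared clique by clique. If B has two high vertices, at most 2s cliques contain more
than one vertex of B. The kernel then records an edge of each of these cliques, together with a set
L₀ of high vertices that determines how the edge attaches to the high part of B (`Anchored`). If B
has few high vertices, all of them go into L₀ and F = I. Otherwise F is empty and L₀ is itself a
large independent set that takes over the role of I (`adj_of_anti`): each high vertex of B missing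
from the extension is charged to its own surplus vertex of the extension.

The algorithm is written in a language of bounded loops, `FProg`, in which a polynomial running time
follows from the syntax. -/

namespace SubsetOCT

open Finset

/-! ### Odd T-cycles as cyclic lists -/

section Cycles

variable {V : Type*}

/-- The vertices of an odd cycle meeting `T`, listed in cyclic order. -/
def OddTCycle (G : SimpleGraph V) (T : Finset V) (l : List V) : Prop :=
  l.Nodup ∧ Cycle.Chain G.Adj (l : Cycle V) ∧ Odd l.length ∧ ∃ t ∈ T, t ∈ l

/-- `B` induces a subgraph without odd cycles meeting `T`. -/
def TBip (G : SimpleGraph V) (T B : Finset V) : Prop :=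
  ∀ l, OddTCycle G T l → ∃ x ∈ l, x ∉ B

lemma OddTCycle.rotated {G : SimpleGraph V} {T : Finset V} {l l' : List V}
    (h : OddTCycle G T l) (hr : l ~r l') : OddTCycle G T l' := by
  obtain ⟨h1, h2, h3, t, ht, htl⟩ := h
  refine ⟨hr.nodup_iff.1 h1, ?_, hr.perm.length_eq ▸ h3, t, ht, hr.mem_iff.1 htl⟩
  rwa [← Cycle.coe_eq_coe.2 hr]

lemma TBip.mono {G : SimpleGraph V} {T B B' : Finset V} (h : TBip G T B') (hB : B ⊆ B') :
    TBip G T B := fun l hl => by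
  obtain ⟨x, hx, hxB⟩ := h l hl
  exact ⟨x, hx, fun h => hxB (hB h)⟩

lemma not_tBip_iff {G : SimpleGraph V} {T B : Finset V} :
    ¬ TBip G T B ↔ ∃ l, OddTCycle G T l ∧ ∀ x ∈ l, x ∈ B := by
  simp [TBip]

lemma tBip_of_disjoint {G : SimpleGraph V} {T B : Finset V} (h : ∀ x ∈ B, x ∉ T) :
    TBip G T B := fun _ ⟨_, _, _, t, ht, htl⟩ => ⟨t, htl, fun hB => h t hB ht⟩

/-- The support of a closed walk lists the base vertex at both ends; its tail is the cyclic list of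
vertices. -/
lemma oddTCycle_of_walk {G : SimpleGraph V} {T : Finset V} {u : V} (C : G.Walk u u)
    (hC : C.IsCycle) (hodd : Odd C.length) (hT : ∃ v ∈ T, v ∈ C.support) :
    ∃ l, OddTCycle G T l ∧ ∀ x, x ∈ l ↔ x ∈ C.support := by
  have hne : C.support.tail ≠ [] := by
    intro h
    have := C.length_support
    have h2 : C.support.length = 1 := by rw [← List.cons_head_tail C.support_ne_nil, h]; simp
    have := hC.three_le_length
    omega
  have hlast : C.support.tail.getLast hne = u := by
    rw [List.getLast_tail]; simp
  have hmem : ∀ x, x ∈ C.support.tail ↔ x ∈ C.support := by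
    intro x
    conv_rhs => rw [← C.cons_tail_support]
    rw [List.mem_cons]
    refine ⟨Or.inr, ?_⟩
    rintro (h | h)
    · have := List.getLast_mem hne
      rw [hlast] at this
      rwa [h]
    · exact h
  refine ⟨C.support.tail, ⟨hC.2, ?_, by simpa using hodd, ?_⟩, hmem⟩
  · have hch := C.isChain_adj_support
    rw [← C.cons_tail_support] at hch
    have hsplit := List.dropLast_append_getLast hne
    rw [hlast] at hsplit
    rw [← hsplit] at hch ⊢
    have : ((C.support.tail.dropLast ++ [u] : List V) : Cycle V) =
        ((u :: C.support.tail.dropLast : List V) : Cycle V) := by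
      rw [Cycle.coe_eq_coe]
      exact List.IsRotated.symm ⟨1, by simp⟩
    rw [this, Cycle.chain_coe_cons]
    exact hch
  · obtain ⟨v, hv, hvC⟩ := hT
    exact ⟨v, hv, (hmem v).2 hvC⟩

lemma OddTCycle.three_le {G : SimpleGraph V} {T : Finset V} {l : List V}
    (h : OddTCycle G T l) : 3 ≤ l.length := by
  obtain ⟨-, h2, h3, -⟩ := h
  match l with
  | [] => simp at h3
  | [a] => simp at h2
  | [a, b] => exact absurd h3 (by simp)
  | a :: b :: c :: l => simp

lemma OddTCycle.exists_walk {G : SimpleGraph V} {T : Finset V} {l : List V}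
    (h : OddTCycle G T l) : ∃ (u : V) (C : G.Walk u u), C.IsCycle ∧ Odd C.length ∧
      ∀ x, x ∈ C.support ↔ x ∈ l := by
  have h3 := h.three_le
  obtain ⟨h1, h2, hodd, -⟩ := h
  match l, h3 with
  | u :: p, h3 =>
    rw [Cycle.chain_coe_cons] at h2
    have hp : p ++ [u] ≠ [] := by simp
    have hch : List.IsChain G.Adj (p ++ [u]) := (List.isChain_cons.1 h2).2
    let W := SimpleGraph.Walk.ofSupport (p ++ [u]) hp hch
    have hhead : G.Adj u ((p ++ [u]).head hp) := by
      have := (List.isChain_cons.1 h2).1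
      exact this _ (List.head?_eq_some_head hp ▸ rfl)
    have hlast : (p ++ [u]).getLast hp = u := by simp
    have hsupp : W.support = p ++ [u] := SimpleGraph.Walk.support_ofSupport ..
    let W' : G.Walk ((p ++ [u]).head hp) u := W.copy rfl hlast
    have hsupp' : W'.support = p ++ [u] := by simp [W', hsupp]
    refine ⟨u, SimpleGraph.Walk.cons hhead W', ?_, ?_, ?_⟩
    · rw [SimpleGraph.Walk.cons_isCycle_iff]
      have hpath : W'.IsPath := by
        rw [SimpleGraph.Walk.isPath_def, hsupp']
        exact (List.perm_append_singleton u p).nodup_iff.2 h1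
      refine ⟨hpath, fun he => ?_⟩
      have hlen : W'.length = p.length := by
        have := W'.length_support
        rw [hsupp'] at this
        simp at this
        omega
      -- If the closing edge occurred in the path, the path would consist of that edge alone,
      -- whereas an odd cycle has at least three vertices.
      have hc : ¬ W'.length = 1 := by simp at h3; omega
      exact hc (hpath.length_eq_one_of_mem_edges (Sym2.eq_swap ▸ he))
    · have := W'.length_support
      rw [hsupp'] at this
      simp at this
      simp only [SimpleGraph.Walk.length_cons, ← this]
      simpa using hodd
    · intro x
      rw [SimpleGraph.Walk.support_cons, hsupp']
      simp only [List.mem_cons, List.mem_append, List.not_mem_nil, or_false]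
      tauto

/-- Passing to complements turns minimum transversals into maximum `TBip` sets, the form in which
optimality is proved. -/
lemma isOddTCycleTransversal_iff [Fintype V] [DecidableEq V] {G : SimpleGraph V} {T S : Finset V} :
    IsOddTCycleTransversal G T S ↔ TBip G T Sᶜ := by
  constructor
  · intro h l hl
    obtain ⟨u, C, hC, hodd, hmem⟩ := hl.exists_walk
    obtain ⟨t, ht, htl⟩ := hl.2.2.2
    obtain ⟨v, hv, hvC⟩ := h u C hC hodd ⟨t, ht, (hmem t).2 htl⟩
    exact ⟨v, (hmem v).1 hvC, by simpa using hv⟩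
  · intro h u C hC hodd hT
    obtain ⟨l, hl, hmem⟩ := oddTCycle_of_walk C hC hodd hT
    obtain ⟨x, hx, hxS⟩ := h l hl
    exact ⟨x, by simpa using hxS, (hmem x).1 hx⟩

end Cycles

/-! ### Forbidden induced subgraph and Ramsey's theorem -/

/-- Every independent set anticomplete to an induced path on three vertices has fewer than `s`
elements. -/
def SFree {V : Type*} (s : ℕ) (G : SimpleGraph V) : Prop :=
  ∀ x y z, G.Adj x y → G.Adj y z → ¬ G.Adj x z → x ≠ z → ∀ J : Finset V,
    (∀ a ∈ J, ∀ b ∈ J, ¬ G.Adj a b) →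
    (∀ a ∈ J, a ≠ x ∧ a ≠ y ∧ a ≠ z ∧ ¬ G.Adj x a ∧ ¬ G.Adj y a ∧ ¬ G.Adj z a) → J.card < s

/-- Any s members of `J` together with the path would be an induced copy of sP₁ + P₃. Only this
consequence of freeness is used in the graph theory. -/
lemma InducedFree.sFree {V : Type*} {s : ℕ} {G : SimpleGraph V} (h : InducedFree (sP1P3 s) G) :
    SFree s G := by
  intro x y z hxy hyz hxz hne J hJ hanti
  by_contra hcard
  obtain ⟨J', hJ', hs⟩ := Finset.exists_subset_card_eq (not_lt.1 hcard)
  let e := J'.equivFinOfCardEq hs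
  let f : Fin s ⊕ Fin 3 → V := Sum.elim (fun i => (e.symm i : V)) ![x, y, z]
  have hm : ∀ i, ((e.symm i : J') : V) ∈ J := fun i => hJ' (e.symm i).2
  have hA : ∀ {a b}, (sP1P3 s).Adj a b ↔ G.Adj (f a) (f b) := by
    rintro (i | i) (j | j)
    · simp [f, hJ _ (hm i) _ (hm j)]
    · have := hanti _ (hm i)
      simp only [G.adj_comm _ ((e.symm i : J') : V)] at this
      fin_cases j <;> simp [f, this]
    · have := hanti _ (hm j)
      fin_cases i <;> simp [f, this]
    · fin_cases i <;> fin_cases j <;>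
        simp [f, hxy, hyz, hxz, hxy.symm, hyz.symm, G.adj_comm z x, SimpleGraph.pathGraph_adj]
  have hinj : Function.Injective f := by
    rintro (i | i) (j | j) hij
    · simp only [f, Sum.elim_inl] at hij
      rw [e.symm.injective (Subtype.ext hij)]
    · exfalso
      have := hanti _ (hm i)
      revert hij
      fin_cases j <;> simp [f, this]
    · exfalso
      have := hanti _ (hm j)
      revert hij
      fin_cases i <;> simp [f, this, Ne.symm]
    · have h1 := hxy.ne
      have h2 := hyz.ne
      revert hij
      fin_cases i <;> fin_cases j <;> simp [f, hne, h1, h2, hne.symm, h1.symm, h2.symm]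
  exact h ⟨⟨⟨f, hinj⟩, by intro a b; exact (hA).symm⟩⟩

/-- Ramsey's theorem for cliques and independent sets. -/
lemma exists_ramsey (k m : ℕ) : ∃ N, ∀ {V : Type} [DecidableEq V] (G : SimpleGraph V) (A : Finset V),
    N ≤ A.card → (∃ K ⊆ A, K.card = k ∧ ∀ a ∈ K, ∀ b ∈ K, a ≠ b → G.Adj a b) ∨
      ∃ I ⊆ A, I.card = m ∧ ∀ a ∈ I, ∀ b ∈ I, ¬ G.Adj a b := by
  classical
  induction k generalizing m with
  | zero => exact ⟨0, fun G A _ => Or.inl ⟨∅, by simp⟩⟩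
  | succ k ihk =>
    induction m with
    | zero => exact ⟨0, fun G A _ => Or.inr ⟨∅, by simp⟩⟩
    | succ m ihm =>
      obtain ⟨N1, h1⟩ := ihk (m + 1)
      obtain ⟨N2, h2⟩ := ihm
      -- Besides one vertex v there remain either `N1` neighbours or `N2` non-neighbours of v.
      refine ⟨N1 + N2 + 1, fun {V} _ G A hA => ?_⟩
      obtain ⟨v, hv⟩ : A.Nonempty := Finset.card_pos.1 (by omega)
      have hsplit := Finset.card_filter_add_card_filter_not (s := A.erase v) (fun w => G.Adj v w)
      rw [Finset.card_erase_of_mem hv] at hsplit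
      by_cases hc : N1 ≤ ((A.erase v).filter (fun w => G.Adj v w)).card
      · rcases h1 G _ hc with ⟨K, hK, hcard, hcl⟩ | ⟨I, hI, h⟩
        · left
          have hvK : v ∉ K := fun h => by simpa using hK h
          have hK' : ∀ a ∈ K, a ∈ A ∧ G.Adj v a := fun a ha => by
            have := hK ha; simp at this; exact ⟨this.1.2, this.2⟩
          refine ⟨insert v K, ?_, by simp [hvK, hcard], ?_⟩
          · intro a ha
            rcases Finset.mem_insert.1 ha with rfl | ha
            exacts [hv, (hK' a ha).1]
          · intro a ha b hb hab
            rcases Finset.mem_insert.1 ha with ha' | ha' <;> rcases Finset.mem_insert.1 hb with hb' | hb'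
            exacts [absurd (ha'.trans hb'.symm) hab, ha' ▸ (hK' b hb').2, hb' ▸ (hK' a ha').2.symm,
              hcl a ha' b hb' hab]
        · exact Or.inr ⟨I, fun a ha => by have := hI ha; simp at this; exact this.1.2, h⟩
      · rcases h2 G ((A.erase v).filter (fun w => ¬ G.Adj v w)) (by omega) with
          ⟨K, hK, h⟩ | ⟨I, hI, hcard, hind⟩
        · exact Or.inl ⟨K, fun a ha => by have := hK ha; simp at this; exact this.1.2, h⟩
        · right
          have hvI : v ∉ I := fun h => by simpa using hI h
          have hI' : ∀ a ∈ I, a ∈ A ∧ ¬ G.Adj v a := fun a ha => by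
            have := hI ha; simp at this; exact ⟨this.1.2, this.2⟩
          refine ⟨insert v I, ?_, by simp [hvI, hcard], ?_⟩
          · intro a ha
            rcases Finset.mem_insert.1 ha with rfl | ha
            exacts [hv, (hI' a ha).1]
          · intro a ha b hb
            rcases Finset.mem_insert.1 ha with ha' | ha' <;> rcases Finset.mem_insert.1 hb with hb' | hb'
            exacts [ha' ▸ hb' ▸ G.irrefl, ha' ▸ (hI' b hb').2, hb' ▸ fun h => (hI' a ha').2 h.symm,
              hind a ha' b hb']

end SubsetOCT

namespace SubsetOCT

open Finset
open scoped Classical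

/-! ### Marked entries in lists and cyclic lists -/

section Gaps

variable {V : Type*}

lemma exists_first_mem {P : V → Prop} {l : List V} (h : ∃ x ∈ l, P x) :
    ∃ r y β, l = r ++ y :: β ∧ (∀ x ∈ r, ¬ P x) ∧ P y := by
  induction l with
  | nil => simp at h
  | cons a l ih =>
    by_cases ha : P a
    · exact ⟨[], a, l, by simp [ha]⟩
    · obtain ⟨r, y, β, rfl, h1, h2⟩ := ih (by simpa [ha] using h)
      exact ⟨a :: r, y, β, by simp, by simpa [ha] using h1, h2⟩

lemma exists_last_mem {P : V → Prop} {l : List V} (h : ∃ x ∈ l, P x) :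
    ∃ α x r, l = α ++ x :: r ∧ (∀ y ∈ r, ¬ P y) ∧ P x := by
  obtain ⟨r, y, β, h1, h2, h3⟩ := exists_first_mem (P := P) (l := l.reverse) (by simpa using h)
  refine ⟨β.reverse, y, r.reverse, ?_, by simpa using h2, h3⟩
  rw [← List.reverse_reverse l, h1]
  simp

/-- Since x and y satisfy `P`, the maximal run of entries around t that violate `P` is bounded on
both sides, possibly by x or y themselves. -/
lemma exists_run_around {P : V → Prop} {x y t : V} {w : List V} (hx : P x) (hy : P y) (ht : t ∈ w)
    (hPt : ¬ P t) : ∃ α x' r y' β, x :: w ++ [y] = α ++ x' :: r ++ y' :: β ∧ t ∈ r ∧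
      (∀ z ∈ r, ¬ P z) ∧ P x' ∧ P y' := by
  obtain ⟨w1, w2, rfl⟩ := List.append_of_mem ht
  obtain ⟨α, x', r1, h1, h1', hx'⟩ := exists_last_mem (P := P) (l := x :: w1) ⟨x, by simp, hx⟩
  obtain ⟨r2, y', β, h2, h2', hy'⟩ := exists_first_mem (P := P) (l := w2 ++ [y]) ⟨y, by simp, hy⟩
  refine ⟨α, x', r1 ++ t :: r2, y', β, ?_, by simp, ?_, hx', hy'⟩
  · have : x :: (w1 ++ t :: w2) ++ [y] = (x :: w1) ++ t :: (w2 ++ [y]) := by simp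
    rw [this, h1, h2]
    simp
  · intro z hz
    simp only [List.mem_append, List.mem_cons] at hz
    rcases hz with hz | rfl | hz
    exacts [h1' z hz, hPt, h2' z hz]

/-- A marked entry inside a list of even length splits it into two parts whose lengths have odd sum;
one part is even, and the induction continues there. -/
lemma exists_even_gap_aux {P : V → Prop} (n : ℕ) : ∀ (x y : V) (l : List V), l.length ≤ n →
    P x → P y → Even l.length → ∃ α u r v β, x :: l ++ [y] = α ++ u :: r ++ v :: β ∧ P u ∧ P v ∧
      (∀ z ∈ r, ¬ P z) ∧ Even r.length := by
  induction n with
  | zero =>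
    intro x y l hl hx hy _
    obtain rfl : l = [] := List.length_eq_zero_iff.1 (by omega)
    exact ⟨[], x, [], y, [], by simp, hx, hy, by simp, by simp⟩
  | succ n ih =>
    intro x y l hl hx hy he
    by_cases h : ∃ z ∈ l, P z
    · obtain ⟨z, hz, hPz⟩ := h
      obtain ⟨l1, l2, rfl⟩ := List.append_of_mem hz
      simp only [List.length_append, List.length_cons] at hl he
      by_cases h1 : Even l1.length
      · obtain ⟨α, u, r, v, β, h2, h3⟩ := ih x z l1 (by omega) hx hPz h1
        refine ⟨α, u, r, v, β ++ l2 ++ [y], ?_, h3⟩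
        have : x :: (l1 ++ z :: l2) ++ [y] = (x :: l1 ++ [z]) ++ (l2 ++ [y]) := by simp
        rw [this, h2]
        simp
      · obtain ⟨α, u, r, v, β, h2, h3⟩ := ih z y l2 (by omega) hPz hy (by grind)
        refine ⟨x :: l1 ++ α, u, r, v, β, ?_, h3⟩
        have : x :: (l1 ++ z :: l2) ++ [y] = (x :: l1) ++ (z :: l2 ++ [y]) := by simp
        rw [this, h2]
        simp
    · push Not at h
      exact ⟨[], x, l, y, [], by simp, hx, hy, h, he⟩

/-- An odd cyclic sequence with at least one marked entry has two cyclically consecutive marked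
entries with an even number of entries between them. -/
lemma exists_even_gap {P : V → Prop} {l : List V} (hodd : Odd l.length) (h : ∃ x ∈ l, P x) :
    ∃ u r, P u ∧ (∀ z ∈ r, ¬ P z) ∧ Even r.length ∧
      (l ~r u :: r ∨ ∃ v w, P v ∧ l ~r u :: r ++ v :: w) := by
  obtain ⟨x, hx, hPx⟩ := h
  obtain ⟨a, b, rfl⟩ := List.append_of_mem hx
  have hrot : a ++ x :: b ~r x :: (b ++ a) := List.isRotated_append
  -- The cycle is cut open at the marked vertex x, which is then repeated at both ends.
  have heven : Even (b ++ a).length := by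
    simp only [List.length_append, List.length_cons] at hodd ⊢
    grind
  obtain ⟨α, u, r, v, β, heq, hu, hv, hr, he⟩ := exists_even_gap_aux _ x x (b ++ a) le_rfl hPx hPx heven
  refine ⟨u, r, hu, hr, he, ?_⟩
  -- If β is empty, the right end of the gap is the second copy of x. If α is empty as well, x is
  -- the only marked vertex and the gap is the whole remaining cycle.
  rcases List.eq_nil_or_concat β with rfl | ⟨β', z, rfl⟩
  · obtain ⟨heq', hxv⟩ : x :: (b ++ a) = α ++ u :: r ∧ x = v := by
      have := List.append_inj' (s₁ := x :: (b ++ a)) (t₁ := [x]) (s₂ := α ++ u :: r) (t₂ := [v]) heq (by simp)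
      simpa using this
    subst hxv
    rcases α with _ | ⟨x', α'⟩
    · left
      rw [heq'] at hrot
      exact hrot
    · right
      obtain ⟨rfl, -⟩ : x = x' ∧ _ := by simpa using heq'
      refine ⟨x, α', hPx, hrot.trans ?_⟩
      rw [heq']
      exact List.isRotated_append (l := x :: α') (l' := u :: r)
  · right
    obtain ⟨heq', -⟩ : x :: (b ++ a) = α ++ u :: r ++ v :: β' ∧ x = z := by
      have := List.append_inj' (s₁ := x :: (b ++ a)) (t₁ := [x]) (s₂ := α ++ u :: r ++ v :: β')
        (t₂ := [z]) (by simpa using heq) (by simp)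
      simpa using this
    refine ⟨v, β' ++ α, hv, hrot.trans ?_⟩
    rw [heq']
    have := List.isRotated_append (l := α) (l' := u :: r ++ v :: β')
    simpa using this

end Gaps

/-! ### High and low vertices relative to an independent set -/

section Low

variable {V : Type*} {s : ℕ} {G : SimpleGraph V} {I : Finset V}

/-- `v` has at most one neighbour in `I`. -/
def Low (G : SimpleGraph V) (I : Finset V) (v : V) : Prop :=
  ∀ a ∈ I, ∀ b ∈ I, G.Adj v a → G.Adj v b → a = b

/-- No two vertices of `I` are adjacent. -/
def Indep (G : SimpleGraph V) (I : Finset V) : Prop := ∀ a ∈ I, ∀ b ∈ I, ¬ G.Adj a b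

lemma Indep.low (hI : Indep G I) {v : V} (hv : v ∈ I) : Low G I v :=
  fun a ha _ _ h _ => absurd h (hI v hv a ha)

lemma Indep.mono (hI : Indep G I) {J : Finset V} (h : J ⊆ I) : Indep G J :=
  fun a ha b hb => hI a (h ha) b (h hb)

/-- Two neighbours a, b of v in `I` give the induced path a v b, and the non-neighbours of v in `I`
are anticomplete to it. -/
lemma card_nonadj_lt_of_not_low (hG : SFree s G) (hI : Indep G I) {v : V} (hv : ¬ Low G I v) :
    (I.filter fun a => ¬ G.Adj v a).card < s := by
  simp only [Low, not_forall] at hv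
  obtain ⟨a, ha, b, hb, hva, hvb, hab⟩ := hv
  refine hG a v b hva.symm hvb (hI a ha b hb) hab _ ((hI.mono (filter_subset _ _))) ?_
  intro c hc
  rw [mem_filter] at hc
  refine ⟨?_, ?_, ?_, hI a ha c hc.1, hc.2, hI b hb c hc.1⟩
  · rintro rfl; exact hc.2 hva
  · rintro rfl; exact hI c hc.1 a ha hva
  · rintro rfl; exact hc.2 hvb

/-- Each high vertex misses fewer than s members of `I`, so the two of them together with `X` cannot
exhaust `I`. -/
lemma exists_common_neighbor (hG : SFree s G) (hI : Indep G I) {u v : V} (hu : ¬ Low G I u)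
    (hv : ¬ Low G I v) {X : Finset V} (hX : s + s + X.card ≤ I.card) :
    ∃ i ∈ I, i ∉ X ∧ G.Adj u i ∧ G.Adj v i := by
  by_contra! h
  have hsub : I ⊆ (I.filter fun a => ¬ G.Adj u a) ∪ (I.filter fun a => ¬ G.Adj v a) ∪ X := by
    intro i hi
    simp only [mem_union, mem_filter]
    by_contra! h'
    exact h i hi h'.2 (h'.1.1 hi) (h'.1.2 hi)
  have h1 := card_nonadj_lt_of_not_low hG hI hu
  have h2 := card_nonadj_lt_of_not_low hG hI hv
  have h3 := card_le_card hsub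
  have h4 := card_union_le ((I.filter fun a => ¬ G.Adj u a) ∪ (I.filter fun a => ¬ G.Adj v a)) X
  have h5 := card_union_le (I.filter fun a => ¬ G.Adj u a) (I.filter fun a => ¬ G.Adj v a)
  omega

lemma Low.card_adj_le {v : V} (hv : Low G I v) : (I.filter fun a => G.Adj v a).card ≤ 1 := by
  refine card_le_one.2 fun a ha b hb => ?_
  rw [mem_filter] at ha hb
  exact hv a ha.1 b hb.1 ha.2 hb.2

/-- An induced path of three low vertices meets or sees at most six members of `I`, namely its own
vertices and one neighbour of each. The other members, at least s of them, would be anticomplete to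
it. -/
lemma Low.adj_trans (hG : SFree s G) (hI : Indep G I) (hcard : s + 6 ≤ I.card) {x y z : V}
    (hx : Low G I x) (hy : Low G I y) (hz : Low G I z) (hxy : G.Adj x y) (hyz : G.Adj y z)
    (hne : x ≠ z) : G.Adj x z := by
  by_contra hxz
  let N := fun v => I.filter fun a => G.Adj v a
  have := hG x y z hxy hyz hxz hne (I \ ({x, y, z} ∪ N x ∪ N y ∪ N z)) (hI.mono sdiff_subset) ?_
  · have h1 := le_card_sdiff ({x, y, z} ∪ N x ∪ N y ∪ N z) I
    have h2 := card_union_le ({x, y, z} ∪ N x ∪ N y) (N z)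
    have h3 := card_union_le ({x, y, z} ∪ N x) (N y)
    have h4 := card_union_le ({x, y, z}) (N x)
    have h5 := card_le_three (a := x) (b := y) (c := z)
    have h6 : (N x).card ≤ 1 := hx.card_adj_le
    have h7 : (N y).card ≤ 1 := hy.card_adj_le
    have h8 : (N z).card ≤ 1 := hz.card_adj_le
    omega
  · intro a ha
    simp only [mem_sdiff, mem_union, mem_insert, mem_singleton, mem_filter, N] at ha
    tauto

/-- Being equal or adjacent is transitive on low vertices, so a path of low vertices spans a clique.
-/
lemma Low.pairwise_adj (hG : SFree s G) (hI : Indep G I) (hcard : s + 6 ≤ I.card) {r : List V}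
    (hr : ∀ x ∈ r, Low G I x) (hch : r.IsChain G.Adj) :
    ∀ x ∈ r, ∀ y ∈ r, x ≠ y → G.Adj x y := by
  let R : V → V → Prop := fun x y => Low G I x ∧ Low G I y ∧ (x ≠ y → G.Adj x y)
  have : IsTrans V R := ⟨fun x y z hxy hyz => ⟨hxy.1, hyz.2.1, fun hne => by
    by_cases h1 : x = y
    · subst h1; exact hyz.2.2 hne
    by_cases h2 : y = z
    · subst h2; exact hxy.2.2 hne
    exact hxy.1.adj_trans hG hI hcard hxy.2.1 hyz.2.1 (hxy.2.2 h1) (hyz.2.2 h2) hne⟩⟩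
  have hR : r.IsChain R := by
    clear this
    induction r with
    | nil => simp
    | cons a r ih =>
      rw [List.isChain_cons] at hch ⊢
      refine ⟨fun y hy => ⟨hr a (by simp), hr y ?_, fun _ => hch.1 y hy⟩,
        ih (fun x hx => hr x (by simp [hx])) hch.2⟩
      exact List.mem_cons_of_mem _ (List.mem_of_mem_head? hy)
  rw [List.isChain_iff_pairwise] at hR
  have h2 : r.Pairwise fun x y => x ≠ y → G.Adj x y := hR.imp fun h => h.2.2
  have : Std.Symm fun x y => x ≠ y → G.Adj x y := ⟨fun a b h hab => (h hab.symm).symm⟩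
  intro x hx y hy hxy
  exact h2.forall_of_forall (fun x _ h => absurd rfl h) hx hy hxy

end Low

end SubsetOCT

namespace SubsetOCT

open Finset
open scoped Classical

/-! ### Short odd T-cycles and a local criterion -/

section Short

variable {V : Type*} {s : ℕ} {G : SimpleGraph V} {I T : Finset V}

lemma oddTCycle_cons_iff {u : V} {p : List V} : OddTCycle G T (u :: p) ↔
    (u :: p).Nodup ∧ List.IsChain G.Adj (u :: p ++ [u]) ∧ Odd (u :: p).length ∧
      ∃ t ∈ T, t ∈ u :: p := by
  rw [OddTCycle, Cycle.chain_coe_cons, List.cons_append]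

/-- A chain of low vertices is a clique and hence contains at most one member of `I`, so the two
chains and i, j cover at most four. -/
lemma card_le_four_of_runs (hG : SFree s G) (hI : Indep G I) (hcard : s + 6 ≤ I.card)
    {r r' : List V} (hr : ∀ x ∈ r, Low G I x) (hch : r.IsChain G.Adj)
    (hr' : ∀ x ∈ r', Low G I x) (hch' : r'.IsChain G.Adj) (i j : V) :
    ∃ a ∈ I, a ∉ r ∧ a ∉ r' ∧ a ≠ i ∧ a ≠ j := by
  by_contra! h
  have hsub : I ⊆ (I.filter (· ∈ r)) ∪ (I.filter (· ∈ r')) ∪ {i, j} := by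
    intro a ha
    have := h a ha
    simp only [mem_union, mem_filter, mem_insert, mem_singleton]
    tauto
  have key : ∀ q : List V, (∀ x ∈ q, Low G I x) → q.IsChain G.Adj →
      (I.filter (· ∈ q)).card ≤ 1 := fun q hq hc => by
    refine card_le_one.2 fun a ha b hb => ?_
    rw [mem_filter] at ha hb
    by_contra hab
    exact hI a ha.1 b hb.1 (Low.pairwise_adj hG hI hcard hq hc a ha.2 b hb.2 hab)
  have h1 := key r hr hch
  have h2 := key r' hr' hch'
  have h3 := card_le_card hsub
  have h4 := card_union_le ((I.filter (· ∈ r)) ∪ (I.filter (· ∈ r'))) {i, j}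
  have h5 := card_union_le (I.filter (· ∈ r)) (I.filter (· ∈ r'))
  have h6 := card_le_two (a := i) (b := j)
  omega

lemma run_inter_card (hG : SFree s G) (hI : Indep G I) (hcard : s + 6 ≤ I.card)
    {r : List V} (hr : ∀ x ∈ r, Low G I x) (hch : r.IsChain G.Adj) :
    (I.filter (· ∈ r)).card ≤ 1 := by
  refine card_le_one.2 fun a ha b hb => ?_
  rw [mem_filter] at ha hb
  by_contra hab
  exact hI a ha.1 b hb.1 (Low.pairwise_adj hG hI hcard hr hch a ha.2 b hb.2 hab)

/-- A common neighbour in `I` of two high vertices that avoids two runs of low vertices and a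
further vertex. -/
lemma exists_connector (hG : SFree s G) (hI : Indep G I) (hcard : s + s + 6 ≤ I.card)
    {r r' : List V} (hr : ∀ x ∈ r, Low G I x) (hch : r.IsChain G.Adj)
    (hr' : ∀ x ∈ r', Low G I x) (hch' : r'.IsChain G.Adj) {u v : V} (hu : ¬ Low G I u)
    (hv : ¬ Low G I v) (j : V) :
    ∃ i ∈ I, i ∉ r ∧ i ∉ r' ∧ i ≠ j ∧ G.Adj u i ∧ G.Adj v i := by
  have h1 := run_inter_card hG hI (by omega) hr hch
  have h2 := run_inter_card hG hI (by omega) hr' hch'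
  have h4 := card_union_le ((I.filter (· ∈ r)) ∪ (I.filter (· ∈ r'))) {j}
  have h5 := card_union_le (I.filter (· ∈ r)) (I.filter (· ∈ r'))
  have h6 := card_singleton j
  obtain ⟨i, hi, hX, h⟩ := exists_common_neighbor hG hI hu hv
    (X := (I.filter (· ∈ r)) ∪ (I.filter (· ∈ r')) ∪ {j}) (by omega)
  simp only [mem_union, mem_filter, mem_singleton, hi, true_and] at hX
  exact ⟨i, hi, by tauto, by tauto, by tauto, h⟩

/-- In a graph without induced `sP₁ + P₃`, an odd `T`-cycle that contains a large independent set
is not minimal with respect to inclusion. -/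
lemma exists_smaller_oddTCycle (hG : SFree s G) (hI : Indep G I) (hcard : s + s + 6 ≤ I.card)
    {l : List V} (hl : OddTCycle G T l) (hIl : ∀ i ∈ I, i ∈ l) :
    ∃ l', OddTCycle G T l' ∧ (∀ x ∈ l', x ∈ l) ∧ ∃ x ∈ l, x ∉ l' := by
  have hIne : I.Nonempty := card_pos.1 (by omega)
  have hlowI : ∀ i ∈ I, Low G I i := fun i hi => hI.low hi
  -- the case in which the even gap contains a vertex of `T`
  have main1 : ∀ {u v : V} {r w : List V}, l ~r u :: r ++ v :: w → ¬ Low G I u → ¬ Low G I v →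
      (∀ z ∈ r, Low G I z) → Even r.length → (∃ t ∈ T, t ∈ u :: r ++ [v]) →
      ∃ l', OddTCycle G T l' ∧ (∀ x ∈ l', x ∈ l) ∧ ∃ x ∈ l, x ∉ l' := by
    intro u v r w hrot hu hv hr he ht
    have hl' := hl.rotated hrot
    rw [List.cons_append, oddTCycle_cons_iff] at hl'
    obtain ⟨hnd, hch, -, -⟩ := hl'
    have hch1 : List.IsChain G.Adj (u :: r ++ [v]) := by
      have : u :: (r ++ v :: w) ++ [u] = (u :: r) ++ v :: (w ++ [u]) := by simp
      rw [this, List.isChain_split] at hch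
      exact hch.1
    have hchr : r.IsChain G.Adj := by
      have := hch1.left_of_append
      rw [List.isChain_cons] at this
      exact this.2
    -- Closing up through i gives the cycle u r v i of odd length |r| + 3, and some member a of `I`
    -- is left out. With a single run to avoid, the same run is supplied twice.
    obtain ⟨i, hi, hir, -, -, hui, hvi⟩ := exists_connector hG hI hcard hr hchr hr hchr hu hv u
    have hilow := hlowI i hi
    obtain ⟨a, ha, har, -, hai, -⟩ :=
      card_le_four_of_runs hG hI (by omega) hr hchr hr hchr i i
    have halow := hlowI a ha
    refine ⟨u :: (r ++ [v, i]), oddTCycle_cons_iff.2 ⟨?_, ?_, ?_, ?_⟩, ?_, a, hIl a ha, ?_⟩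
    · grind
    · have : u :: (r ++ [v, i]) ++ [u] = (u :: r) ++ v :: [i, u] := by simp
      rw [this, List.isChain_split]
      exact ⟨hch1, by simp [hvi, hui.symm]⟩
    · simp only [List.length_cons, List.length_append, List.length_nil]
      grind
    · obtain ⟨t, ht, htl⟩ := ht
      exact ⟨t, ht, by simp at htl ⊢; tauto⟩
    · intro x hx
      simp only [List.mem_cons, List.mem_append, List.not_mem_nil, or_false] at hx
      rcases hx with rfl | hx | rfl | rfl
      · exact hrot.mem_iff.2 (by simp)
      · exact hrot.mem_iff.2 (by simp [hx])
      · exact hrot.mem_iff.2 (by simp)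
      · exact hIl _ hi
    · grind
  -- A cycle of low vertices spans a clique and cannot contain all of `I`.
  have hex : ∃ x ∈ l, ¬ Low G I x := by
    by_contra! hall
    obtain ⟨hnd, hch, -, -⟩ := hl
    have hch' : l.IsChain G.Adj := by
      cases l with
      | nil => simp
      | cons a l => rw [Cycle.chain_coe_cons] at hch; exact hch.left_of_append (l₁ := a :: l)
    obtain ⟨a, ha, h, -⟩ := card_le_four_of_runs hG hI (by omega) hall hch' hall hch'
      hIne.choose hIne.choose
    exact h (hIl a ha)
  obtain ⟨u, r, hu, hr, he, hrot | ⟨v, w, hv, hrot⟩⟩ := exists_even_gap hl.2.2.1 hex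
  -- With a single high vertex u, the rest of the cycle is a clique of low vertices; it cannot cover
  -- `I`, and u is not in `I`.
  · exfalso
    simp only [not_not] at hr
    have hl' := hl.rotated hrot
    rw [oddTCycle_cons_iff] at hl'
    obtain ⟨-, hch, -⟩ := hl'
    have hch := hch.left_of_append
    rw [List.isChain_cons] at hch
    obtain ⟨a, ha, h, -⟩ := card_le_four_of_runs hG hI (by omega) hr hch.2 hr hch.2
      hIne.choose hIne.choose
    have := hrot.mem_iff.1 (hIl a ha)
    simp only [List.mem_cons, h, or_false] at this
    exact hu (this ▸ hlowI a ha)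
  simp only [not_not] at hr
  have hl' := hl.rotated hrot
  by_cases ht1 : ∃ t ∈ T, t ∈ u :: r ++ [v]
  · exact main1 hrot hu hv hr he ht1
  rw [List.cons_append, oddTCycle_cons_iff] at hl'
  obtain ⟨hnd, hch, -, t, htT, htl⟩ := hl'
  have htw : t ∈ w := by
    by_contra h
    exact ht1 ⟨t, htT, by simp at htl ⊢; tauto⟩
  have hch0 : u :: (r ++ v :: w) ++ [u] = (u :: r) ++ v :: (w ++ [u]) := by simp
  rw [hch0, List.isChain_split] at hch
  obtain ⟨hch1, hch2⟩ := hch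
  have hchr : r.IsChain G.Adj := by
    have := hch1.left_of_append
    rw [List.isChain_cons] at this
    exact this.2
  have hmem : ∀ x, x ∈ u :: (r ++ v :: w) → x ∈ l := fun x hx => hrot.mem_iff.2 (by simpa using hx)
  -- The terminal t lies on the other arc. If t is low, the run r2 of low vertices around it ends at
  -- high vertices x and y, where x = v or y = u may occur. An even r2 is settled by `main1`. For an
  -- odd r2 the cycle is u r v i x r2 y j, of length |r| + |r2| + 6; the pair i, x is dropped if x =
  -- v, and the pair y, j if y = u.
  by_cases htlow : Low G I t
  · obtain ⟨α, x, r2, y, β, heq, htr2, hr2, hx, hy⟩ :=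
      exists_run_around (P := fun z => ¬ Low G I z) hv hu htw (by simpa using htlow)
    simp only [not_not] at hr2
    rw [← List.cons_append, heq, List.append_assoc, List.isChain_append] at hch2
    have hch3 : List.IsChain G.Adj (x :: r2 ++ [y]) := by
      have := hch2.2.1
      rw [List.isChain_split] at this
      exact this.1
    have hchr2 : r2.IsChain G.Adj := by
      have := hch3.left_of_append
      rw [List.isChain_cons] at this
      exact this.2
    obtain ⟨i, hi, hir, hir2, -, hvi, hxi⟩ :=
      exists_connector hG hI hcard hr hchr hr2 hchr2 hv hx u
    obtain ⟨j, hj, hjr, hjr2, hji, hyj, huj⟩ :=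
      exists_connector hG hI hcard hr hchr hr2 hchr2 hy hu i
    obtain ⟨a, ha, har, har2, hai, haj⟩ :=
      card_le_four_of_runs hG hI (by omega) hr hchr hr2 hchr2 i j
    have hilow := hlowI i hi
    have hjlow := hlowI j hj
    have halow := hlowI a ha
    have htt : ∃ t ∈ T, t ∈ x :: r2 ++ [y] := ⟨t, htT, by simp [htr2]⟩
    rcases α with _ | ⟨v', α'⟩ <;> rcases List.eq_nil_or_concat β with rfl | ⟨β', z, rfl⟩
    · -- the whole cycle is `u :: r ++ v :: r2`
      exfalso
      have h := List.append_inj' (s₁ := v :: w) (t₁ := [u]) (s₂ := x :: r2) (t₂ := [y])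
        (by simpa using heq) (by simp)
      simp only [List.cons.injEq, and_true] at h
      obtain ⟨⟨rfl, rfl⟩, rfl⟩ := h
      have := hrot.mem_iff.1 (hIl a ha)
      clear * - this hu hv halow har har2
      grind
    · have h := List.append_inj' (s₁ := v :: w) (t₁ := [u]) (s₂ := x :: r2 ++ y :: β') (t₂ := [z])
        (by simpa using heq) (by simp)
      simp only [List.cons_append, List.cons.injEq, and_true] at h
      obtain ⟨⟨rfl, rfl⟩, rfl⟩ := h
      by_cases he2 : Even r2.length
      · refine main1 (u := v) (v := y) (r := r2) (w := β' ++ (u :: r)) (hrot.trans ?_)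
          hv hy hr2 he2 htt
        have := List.isRotated_append (l := u :: r) (l' := v :: (r2 ++ y :: β'))
        simpa using this
      · refine ⟨u :: (r ++ v :: r2 ++ [y, j]), oddTCycle_cons_iff.2 ⟨?_, ?_, ?_, ?_⟩, ?_, a, hIl a ha, ?_⟩
        · clear * - hnd hu hv hx hy hilow hjlow hir hir2 hjr hjr2 hji
          simp only [List.nodup_cons, List.nodup_append, List.mem_append, List.mem_cons,
            List.not_mem_nil, or_false, List.nodup_nil] at hnd ⊢
          grind
        · have : u :: (r ++ v :: r2 ++ [y, j]) ++ [u] = (u :: r) ++ v :: (r2 ++ [y, j, u]) := by simp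
          rw [this, List.isChain_split]
          refine ⟨hch1, ?_⟩
          rw [← List.cons_append, List.isChain_split]
          exact ⟨hch3, by simp [hyj, huj.symm]⟩
        · simp only [List.length_cons, List.length_append, List.length_nil]
          clear * - he he2
          grind
        · exact ⟨t, htT, by simp [htr2]⟩
        · clear * - hmem hIl hi hj
          grind
        · clear * - hu hv hx hy halow har har2 hai haj
          grind
    · have h := List.append_inj' (s₁ := v :: w) (t₁ := [u]) (s₂ := v' :: α' ++ x :: r2) (t₂ := [y])
        (by simpa using heq) (by simp)
      simp only [List.cons_append, List.cons.injEq, and_true] at h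
      obtain ⟨⟨rfl, rfl⟩, rfl⟩ := h
      by_cases he2 : Even r2.length
      · refine main1 (u := x) (v := u) (r := r2) (w := r ++ v :: α') (hrot.trans ?_)
          hx hu hr2 he2 htt
        have := List.isRotated_append (l := u :: (r ++ v :: α')) (l' := x :: r2)
        simpa using this
      · refine ⟨u :: (r ++ [v, i, x] ++ r2), oddTCycle_cons_iff.2 ⟨?_, ?_, ?_, ?_⟩, ?_, a, hIl a ha, ?_⟩
        · clear * - hnd hu hv hx hy hilow hjlow hir hir2 hjr hjr2 hji
          simp only [List.nodup_cons, List.nodup_append, List.mem_append, List.mem_cons,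
            List.not_mem_nil, or_false, List.nodup_nil] at hnd ⊢
          grind
        · have : u :: (r ++ [v, i, x] ++ r2) ++ [u] = (u :: r) ++ v :: ([i] ++ x :: (r2 ++ [u])) := by simp
          rw [this]
          exact List.isChain_split.2 ⟨hch1, (List.isChain_split (l₁ := [v, i])).2
            ⟨by simp [hvi, hxi.symm], hch3⟩⟩
        · simp only [List.length_cons, List.length_append, List.length_nil]
          clear * - he he2
          grind
        · exact ⟨t, htT, by simp [htr2]⟩
        · clear * - hmem hIl hi hj
          grind
        · clear * - hu hv hx hy halow har har2 hai haj
          grind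
    · have h := List.append_inj' (s₁ := v :: w) (t₁ := [u]) (s₂ := v' :: α' ++ x :: r2 ++ y :: β')
        (t₂ := [z]) (by simpa using heq) (by simp)
      simp only [List.cons_append, List.cons.injEq, and_true] at h
      obtain ⟨⟨rfl, rfl⟩, rfl⟩ := h
      by_cases he2 : Even r2.length
      · refine main1 (u := x) (v := y) (r := r2) (w := β' ++ u :: (r ++ v :: α')) (hrot.trans ?_)
          hx hy hr2 he2 htt
        have := List.isRotated_append (l := u :: (r ++ v :: α')) (l' := x :: (r2 ++ y :: β'))
        simpa using this
      · refine ⟨u :: (r ++ [v, i, x] ++ r2 ++ [y, j]),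
          oddTCycle_cons_iff.2 ⟨?_, ?_, ?_, ?_⟩, ?_, a, hIl a ha, ?_⟩
        · clear * - hnd hu hv hx hy hilow hjlow hir hir2 hjr hjr2 hji
          simp only [List.nodup_cons, List.nodup_append, List.mem_append, List.mem_cons,
            List.not_mem_nil, or_false, List.nodup_nil] at hnd ⊢
          grind
        · have : u :: (r ++ [v, i, x] ++ r2 ++ [y, j]) ++ [u] =
              (u :: r) ++ v :: ([i] ++ x :: (r2 ++ [y, j, u])) := by simp
          rw [this]
          exact List.isChain_split.2 ⟨hch1, (List.isChain_split (l₁ := [v, i])).2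
            ⟨by simp [hvi, hxi.symm], (List.isChain_split (l₁ := x :: r2)).2
              ⟨hch3, by simp [hyj, huj.symm]⟩⟩⟩
        · simp only [List.length_cons, List.length_append, List.length_nil]
          clear * - he he2
          grind
        · exact ⟨t, htT, by simp [htr2]⟩
        · clear * - hmem hIl hi hj
          grind
        · clear * - hu hv hx hy halow har har2 hai haj
          grind
  -- A high t is linked to v and u directly: the cycle u r v i t j has odd length |r| + 5.
  · obtain ⟨i, hi, hir, -, -, hvi, hti⟩ := exists_connector hG hI hcard hr hchr hr hchr hv htlow u
    obtain ⟨j, hj, hjr, -, hji, htj, huj⟩ := exists_connector hG hI hcard hr hchr hr hchr htlow hu i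
    obtain ⟨a, ha, har, -, hai, haj⟩ :=
      card_le_four_of_runs hG hI (by omega) hr hchr hr hchr i j
    have hilow := hlowI i hi
    have hjlow := hlowI j hj
    have halow := hlowI a ha
    refine ⟨u :: (r ++ [v, i, t, j]), oddTCycle_cons_iff.2 ⟨?_, ?_, ?_, ?_⟩, ?_, a, hIl a ha, ?_⟩
    · clear * - hnd hu hv htlow htw hilow hjlow hir hjr hji
      simp only [List.nodup_cons, List.nodup_append, List.mem_append, List.mem_cons,
        List.not_mem_nil, or_false, List.nodup_nil] at hnd ⊢
      grind
    · have : u :: (r ++ [v, i, t, j]) ++ [u] = (u :: r) ++ v :: [i, t, j, u] := by simp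
      rw [this, List.isChain_split]
      exact ⟨hch1, by simp [hvi, hti.symm, htj, huj.symm]⟩
    · simp only [List.length_cons, List.length_append, List.length_nil]
      clear * - he
      grind
    · exact ⟨t, htT, by simp⟩
    · clear * - hmem hIl hi hj htw
      grind
    · clear * - hu hv htlow halow har hai haj
      grind

lemma exists_split_of_cons_sublist {a : V} {l p : List V} (h : (a :: l).Sublist p) :
    ∃ p1 p2, p = p1 ++ a :: p2 ∧ l.Sublist p2 := by
  obtain ⟨r1, r2, rfl, ha, hl⟩ := List.cons_sublist_iff.1 h
  obtain ⟨b, c, rfl⟩ := List.append_of_mem ha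
  exact ⟨b, c ++ r2, by simp, hl.trans (List.sublist_append_right _ _)⟩

lemma length_lt_of_missing {l l' : List V} (hl' : l'.Nodup) (hsub : ∀ x ∈ l', x ∈ l)
    (hx : ∃ x ∈ l, x ∉ l') : l'.length < l.length := by
  by_contra h
  obtain ⟨x, hx, hx'⟩ := hx
  exact hx' (((hl'.subperm hsub).perm_of_length_le (not_lt.1 h)).mem_iff.2 hx)

/-- In a graph without induced `sP₁ + P₃`, odd `T`-cycles can be shortened to bounded length. -/
lemma exists_short_oddTCycle (s : ℕ) : ∃ f, ∀ {V : Type} {G : SimpleGraph V} {T B : Finset V},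
    SFree s G → ¬ TBip G T B → ∃ l, OddTCycle G T l ∧ (∀ x ∈ l, x ∈ B) ∧ l.length ≤ f := by
  obtain ⟨N, hN⟩ := exists_ramsey 4 (s + s + 6)
  refine ⟨N, fun {V G T B} hG hB => ?_⟩
  rw [not_tBip_iff] at hB
  have hex : ∃ k, ∃ l, OddTCycle G T l ∧ (∀ x ∈ l, x ∈ B) ∧ l.length = k := by
    obtain ⟨l, hl, hlB⟩ := hB
    exact ⟨_, l, hl, hlB, rfl⟩
  obtain ⟨l, hl, hlB, hlen⟩ := Nat.find_spec hex
  have hmin : ∀ l', OddTCycle G T l' → (∀ x ∈ l', x ∈ l) → ¬ ∃ x ∈ l, x ∉ l' := by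
    intro l' hl' hsub hx
    have := length_lt_of_missing hl'.1 hsub hx
    rw [hlen] at this
    exact Nat.find_min hex this ⟨l', hl', fun x hx => hlB x (hsub x hx), rfl⟩
  refine ⟨l, hl, hlB, ?_⟩
  by_contra! hlt
  obtain ⟨t, ht, htl⟩ := hl.2.2.2
  obtain ⟨a, b, hab⟩ := List.append_of_mem htl
  -- The terminal is moved to the front, so that shortcuts taken inside p keep it.
  have hrot : l ~r t :: (b ++ a) := hab ▸ List.isRotated_append
  generalize b ++ a = p at hrot
  have hl2 := hl.rotated hrot
  have hmem : ∀ x, x ∈ t :: p → x ∈ l := fun x hx => hrot.mem_iff.2 hx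
  rw [oddTCycle_cons_iff] at hl2
  obtain ⟨hnd, hch, -⟩ := hl2
  have hcard : N ≤ p.toFinset.card := by
    rw [List.toFinset_card_of_nodup (List.nodup_cons.1 hnd).2]
    have := hrot.perm.length_eq
    simp at this
    omega
  rcases hN G p.toFinset hcard with ⟨K, hK, hK4, hcl⟩ | ⟨I, hIp, hI, hind⟩
  · have hfl : (p.filter (· ∈ K)).length = 4 := by
      rw [← hK4, ← List.toFinset_card_of_nodup ((List.nodup_cons.1 hnd).2.filter _)]
      congr 1
      ext x
      have := @hK x
      simp only [List.mem_toFinset] at this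
      simpa using this
    have hsl : (p.filter (· ∈ K)).Sublist p := List.filter_sublist
    have hKm : ∀ x ∈ p.filter (· ∈ K), x ∈ K := by simp
    generalize p.filter (· ∈ K) = q at hfl hsl hKm
    match q, hfl with
    | [a, b, c, d], _ =>
      obtain ⟨p1, p', rfl, hsl1⟩ := exists_split_of_cons_sublist hsl
      obtain ⟨p2, p', rfl, hsl2⟩ := exists_split_of_cons_sublist hsl1
      obtain ⟨p3, p', rfl, hsl3⟩ := exists_split_of_cons_sublist hsl2
      obtain ⟨p4, p5, rfl, -⟩ := exists_split_of_cons_sublist hsl3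
      have hab : G.Adj a b := hcl a (hKm a (by simp)) b (hKm b (by simp)) (by
        clear * - hnd
        simp only [List.nodup_cons, List.nodup_append, List.mem_append, List.mem_cons] at hnd
        grind)
      have had : G.Adj a d := hcl a (hKm a (by simp)) d (hKm d (by simp)) (by
        clear * - hnd
        simp only [List.nodup_cons, List.nodup_append, List.mem_append, List.mem_cons] at hnd
        grind)
      have hbd : G.Adj b d := hcl b (hKm b (by simp)) d (hKm d (by simp)) (by
        clear * - hnd
        simp only [List.nodup_cons, List.nodup_append, List.mem_append, List.mem_cons] at hnd
        grind)
      have hcha : List.IsChain G.Adj (t :: p1 ++ [a]) := by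
        have h : t :: (p1 ++ a :: (p2 ++ b :: (p3 ++ c :: (p4 ++ d :: p5)))) ++ [t] =
          (t :: p1) ++ a :: (p2 ++ b :: (p3 ++ c :: (p4 ++ d :: (p5 ++ [t])))) := by simp
        rw [h, List.isChain_split] at hch
        exact hch.1
      have hchd : List.IsChain G.Adj (d :: (p5 ++ [t])) := by
        have h : t :: (p1 ++ a :: (p2 ++ b :: (p3 ++ c :: (p4 ++ d :: p5)))) ++ [t] =
          (t :: p1 ++ a :: p2 ++ b :: p3 ++ c :: p4) ++ d :: (p5 ++ [t]) := by simp
        rw [h, List.isChain_split] at hch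
        exact hch.2
      have hcl' : c ∈ l := hmem c (by simp)
      -- Four pairwise adjacent vertices a, b, c, d occur in this order after t. The shortcuts a d
      -- and a b d both omit c and differ by one in length, so one of them gives an odd cycle.
      by_cases hodd : Even (p1.length + p5.length)
      · refine hmin (t :: (p1 ++ a :: d :: p5)) (oddTCycle_cons_iff.2 ⟨?_, ?_, ?_, t, ht, by simp⟩)
          ?_ ⟨c, hcl', ?_⟩
        · clear * - hnd
          simp only [List.nodup_cons, List.nodup_append, List.mem_append, List.mem_cons] at hnd ⊢
          grind
        · have h : t :: (p1 ++ a :: d :: p5) ++ [t] = (t :: p1) ++ a :: (d :: (p5 ++ [t])) := by simp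
          rw [h]
          exact List.isChain_split.2 ⟨hcha, by simpa [had] using hchd⟩
        · simp only [List.length_cons, List.length_append]
          clear * - hodd
          grind
        · clear * - hmem
          grind
        · clear * - hnd
          simp only [List.nodup_cons, List.nodup_append, List.mem_append, List.mem_cons] at hnd ⊢
          grind
      · refine hmin (t :: (p1 ++ a :: b :: d :: p5))
          (oddTCycle_cons_iff.2 ⟨?_, ?_, ?_, t, ht, by simp⟩) ?_ ⟨c, hcl', ?_⟩
        · clear * - hnd
          simp only [List.nodup_cons, List.nodup_append, List.mem_append, List.mem_cons] at hnd ⊢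
          grind
        · have h : t :: (p1 ++ a :: b :: d :: p5) ++ [t] =
            (t :: p1) ++ a :: (b :: d :: (p5 ++ [t])) := by simp
          rw [h]
          exact List.isChain_split.2 ⟨hcha, by simpa [hab, hbd] using hchd⟩
        · simp only [List.length_cons, List.length_append]
          clear * - hodd
          grind
        · clear * - hmem
          grind
        · clear * - hnd
          simp only [List.nodup_cons, List.nodup_append, List.mem_append, List.mem_cons] at hnd ⊢
          grind
  · obtain ⟨l', hl', hsub, hx⟩ := exists_smaller_oddTCycle hG hind hI.ge hl
      (fun i hi => hmem i (List.mem_cons_of_mem _ (by simpa using hIp hi)))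
    exact hmin l' hl' hsub hx

/-- High vertices are independent, no triangle meets `T`, and the two ends of an edge between low
vertices do not attach to different high vertices. -/
def LocalTBip (G : SimpleGraph V) (I T B : Finset V) : Prop :=
  (∀ u ∈ B, ∀ v ∈ B, ¬ Low G I u → ¬ Low G I v → ¬ G.Adj u v) ∧
  (∀ x ∈ B, ∀ y ∈ B, ∀ z ∈ B, x ∈ T → G.Adj x y → G.Adj y z → ¬ G.Adj z x) ∧
  (∀ q ∈ B, ∀ q' ∈ B, ∀ u ∈ B, ∀ v ∈ B, Low G I q → Low G I q' → ¬ Low G I u → ¬ Low G I v →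
    G.Adj q q' → G.Adj u q → G.Adj v q' → u = v)

/-- For a set that contains a large independent subset of `T`, the absence of odd `T`-cycles is a
condition on triangles and on edges between high vertices and the cliques of low vertices. -/
lemma tBip_iff_local (hG : SFree s G) (hI : Indep G I) (hcard : s + s + 6 ≤ I.card) (hIT : I ⊆ T)
    {B : Finset V} (hIB : I ⊆ B) : TBip G T B ↔ LocalTBip G I T B := by
  constructor
  · intro h
    have htri : ∀ x ∈ B, ∀ y ∈ B, ∀ z ∈ B, x ∈ T → G.Adj x y → G.Adj y z → ¬ G.Adj z x := by
      intro x hx y hy z hz hxT hxy hyz hzx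
      obtain ⟨w, hw, hwB⟩ := h [x, y, z] (oddTCycle_cons_iff.2
        ⟨by simp [hxy.ne, hyz.ne, hzx.ne'], by simp [hxy, hyz, hzx], by simp; decide, x, hxT, by simp⟩)
      simp only [List.mem_cons, List.not_mem_nil, or_false] at hw
      rcases hw with rfl | rfl | rfl <;> contradiction
    refine ⟨?_, htri, ?_⟩
    · intro u hu v hv hul hvl huv
      obtain ⟨i, hi, -, hui, hvi⟩ := exists_common_neighbor hG hI hul hvl (X := ∅) (by simp; omega)
      exact htri i (hIB hi) u hu v hv (hIT hi) hui.symm huv hvi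
    · intro q hq q' hq' u hu v hv hql hql' hul hvl hqq huq hvq
      by_contra huv
      -- A common neighbour i of u and v in `I` closes the 5-cycle u q q' v i, which passes through
      -- the terminal i.
      obtain ⟨i, hi, hiX, hui, hvi⟩ := exists_common_neighbor hG hI hul hvl (X := {q, q'})
        (by have := card_le_two (a := q) (b := q'); omega)
      simp only [mem_insert, mem_singleton, not_or] at hiX
      have hil := hI.low hi
      obtain ⟨w, hw, hwB⟩ := h [u, q, q', v, i] (oddTCycle_cons_iff.2
        ⟨by
          have : q ≠ v := by rintro rfl; exact hvl hql
          have : q' ≠ u := by rintro rfl; exact hul hql'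
          simp [huq.ne, this.symm, hui.ne, hqq.ne, hvq.ne', hvi.ne, *, Ne.symm hiX.1,
            Ne.symm hiX.2], by simp [huq, hqq, hvq.symm, hvi, hui.symm], by simp; decide, i, hIT hi, by simp⟩)
      simp only [List.mem_cons, List.not_mem_nil, or_false] at hw
      have := hIB hi
      rcases hw with rfl | rfl | rfl | rfl | rfl <;> contradiction
  · rintro ⟨h1, h2, h3⟩
    by_contra hB
    obtain ⟨l, hl, hlB⟩ := not_tBip_iff.1 hB
    have hcard' : s + 6 ≤ I.card := by omega
    -- Runs of low vertices are cliques. An even gap between two high vertices is empty, or its end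
    -- vertices q, q' contradict the last local condition. If there is at most one high vertex, the
    -- clique of the remaining vertices supplies a triangle through the terminal.
    by_cases hex : ∃ x ∈ l, ¬ Low G I x
    · obtain ⟨u, r, hu, hr, he, hrot | ⟨v, w, hv, hrot⟩⟩ := exists_even_gap hl.2.2.1 hex
      · simp only [not_not] at hr
        have hl' := hl.rotated hrot
        have h3 := hl'.three_le
        rw [oddTCycle_cons_iff] at hl'
        obtain ⟨hnd, hch, -, t, htT, ht⟩ := hl'
        have hmem : ∀ x, x ∈ u :: r → x ∈ B := fun x hx => hlB x (hrot.mem_iff.2 hx)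
        rcases r with _ | ⟨q, r⟩
        · simp at h3
        rcases List.eq_nil_or_concat r with rfl | ⟨r', q', rfl⟩
        · simp at h3
        have hchr : List.IsChain G.Adj (q :: r'.concat q') := by
          have := hch.left_of_append
          rw [List.isChain_cons] at this
          exact this.2
        have hpw := Low.pairwise_adj hG hI hcard' hr hchr
        have huq : G.Adj u q := by
          have := List.isChain_cons.1 hch
          exact this.1 q (by simp)
        have hq'u : G.Adj q' u := by
          have h : u :: (q :: r'.concat q') ++ [u] = (u :: q :: r') ++ q' :: [u] := by simp
          rw [h, List.isChain_split] at hch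
          simpa using hch.2
        have hqq : G.Adj q q' := hpw q (by simp) q' (by simp) (by
          rintro rfl
          simp at hnd)
        have hqB := hmem q (by simp)
        have hqB' := hmem q' (by simp)
        have huB := hmem u (by simp)
        by_cases htu : t = u
        · subst htu
          exact h2 t huB q hqB q' hqB' htT huq hqq hq'u
        have htr : t ∈ q :: r'.concat q' := by simpa [htu] using ht
        by_cases htq : t = q
        · subst htq
          exact h2 t hqB q' hqB' u huB htT hqq hq'u huq
        by_cases htq' : t = q'
        · subst htq'
          exact h2 t hqB' u huB q hqB htT hq'u huq hqq
        exact h2 t (hmem t ht) q hqB q' hqB' htT (hpw t htr q (by simp) htq) hqq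
          (hpw q' (by simp) t htr (Ne.symm htq'))
      · simp only [not_not] at hr
        have hl' := hl.rotated hrot
        rw [List.cons_append, oddTCycle_cons_iff] at hl'
        obtain ⟨hnd, hch, -, -⟩ := hl'
        have hmem : ∀ x, x ∈ u :: (r ++ v :: w) → x ∈ B := fun x hx => hlB x (hrot.mem_iff.2 hx)
        have h : u :: (r ++ v :: w) ++ [u] = (u :: r) ++ v :: (w ++ [u]) := by simp
        rw [h, List.isChain_split] at hch
        have hch := hch.1
        have huB := hmem u (by simp)
        have hvB := hmem v (by simp)
        rcases r with _ | ⟨q, r⟩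
        · exact h1 u huB v hvB hu hv (by simpa using hch)
        rcases List.eq_nil_or_concat r with rfl | ⟨r', q', rfl⟩
        · simp at he
        have hchr : List.IsChain G.Adj (q :: r'.concat q') := by
          have := hch.left_of_append
          rw [List.isChain_cons] at this
          exact this.2
        have hpw := Low.pairwise_adj hG hI hcard' hr hchr
        have huq : G.Adj u q := by
          have := List.isChain_cons.1 hch
          exact this.1 q (by simp)
        have hq'v : G.Adj q' v := by
          have h : u :: (q :: r'.concat q') ++ [v] = (u :: q :: r') ++ q' :: [v] := by simp
          rw [h, List.isChain_split] at hch
          simpa using hch.2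
        have hqq : G.Adj q q' := hpw q (by simp) q' (by simp) (by
          rintro rfl
          simp at hnd)
        have := h3 q (hmem q (by simp)) q' (hmem q' (by simp)) u huB v hvB (hr q (by simp))
          (hr q' (by simp)) hu hv hqq huq hq'v.symm
        subst this
        simp at hnd
    · push Not at hex
      have h3 := hl.three_le
      obtain ⟨hnd, hch, hodd, t, htT, ht⟩ := hl
      have hch' : l.IsChain G.Adj := by
        cases l with
        | nil => simp
        | cons a l => rw [Cycle.chain_coe_cons] at hch; exact hch.left_of_append (l₁ := a :: l)
      have hpw := Low.pairwise_adj hG hI hcard' hex hch'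
      obtain ⟨y, hy, hyt⟩ : ∃ y ∈ l, y ≠ t := by
        by_contra! h
        have := List.toFinset_card_of_nodup hnd
        have h4 : l.toFinset ⊆ {t} := fun x hx => by simpa using h x (by simpa using hx)
        have := card_le_card h4
        simp at this
        omega
      obtain ⟨z, hz, hzt, hzy⟩ : ∃ z ∈ l, z ≠ t ∧ z ≠ y := by
        by_contra! h
        have := List.toFinset_card_of_nodup hnd
        have h4 : l.toFinset ⊆ {t, y} := fun x hx => by
          have := h x (by simpa using hx)
          simp only [mem_insert, mem_singleton]
          tauto
        have := card_le_card h4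
        have := card_le_two (a := t) (b := y)
        omega
      exact h2 t (hlB t ht) y (hlB y hy) z (hlB z hz) htT (hpw t ht y hy hyt.symm)
        (hpw y hy z hz hzy.symm) (hpw z hz t ht hzt)

end Short

end SubsetOCT

namespace SubsetOCT

open Finset
open scoped Classical

lemma low_empty {V : Type} {G : SimpleGraph V} (v : V) : Low G ∅ v := fun a ha => by simp at ha

/-! ### Greedy extensions, the few-terminals case, and counting by cliques -/

section Kernel

variable {V : Type} [DecidableEq V] {s : ℕ} {G : SimpleGraph V} {I T : Finset V}

/-- `Gr` is a maximal set without odd `T`-cycles obtained from `K` by first adding vertices outside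
`T` and then arbitrary vertices, using only vertices with at most one neighbour in `F`. -/
structure GreedyExt (G : SimpleGraph V) (T K F Gr : Finset V) : Prop where
  sub : K ⊆ Gr
  low : ∀ v ∈ Gr, v ∉ K → Low G F v
  tBip : TBip G T Gr
  max : ∀ v, Low G F v → v ∉ Gr → ¬ TBip G T (insert v Gr)
  max_off : ∀ v, Low G F v → v ∉ T → v ∉ Gr → ¬ TBip G T (insert v (K ∪ Gr.filter (· ∉ T)))

/-- If an optimal set contains few vertices of `T`, then a bounded kernel determines it. -/
lemma exists_kernel_of_few [Fintype V] {f k : ℕ}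
    (hf : ∀ B : Finset V, ¬ TBip G T B → ∃ l, OddTCycle G T l ∧ (∀ x ∈ l, x ∈ B) ∧ l.length ≤ f)
    {B : Finset V} (hB : TBip G T B) (hmax : ∀ B', TBip G T B' → B'.card ≤ B.card)
    (hk : (B.filter (· ∈ T)).card ≤ k) :
    ∃ K : Finset V, K.card ≤ k + k * f ∧ K ⊆ B ∧ ∀ Gr, GreedyExt G T K ∅ Gr → B ⊆ Gr := by
  -- These are the vertices outside `T` that B misses. The complement of `T` contains no odd
  -- T-cycle, so optimality of B bounds their number by |B ∩ T|.
  let X := (univ : Finset V).filter fun x => x ∉ T ∧ x ∉ B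
  have hX : X.card ≤ k := by
    have h1 := hmax (univ.filter (· ∉ T)) (tBip_of_disjoint (by simp))
    have h2 := card_filter_add_card_filter_not (s := univ.filter (· ∉ T)) (· ∈ B)
    have h3 := card_filter_add_card_filter_not (s := B) (· ∈ T)
    have h4 : (univ.filter (· ∉ T)).filter (· ∈ B) = B.filter (· ∉ T) := by ext; simp [and_comm]
    have h5 : (univ.filter (· ∉ T)).filter (· ∉ B) = X := by ext; simp [X]
    rw [h4, h5] at h2
    omega
  have hwit : ∀ x : V, ∃ l : List V, x ∈ X → OddTCycle G T l ∧ (∀ y ∈ l, y ∈ insert x B) ∧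
      l.length ≤ f := by
    intro x
    by_cases hx : x ∈ X
    · obtain ⟨l, hl⟩ := hf (insert x B) (fun h => by
        have := hmax _ h
        rw [card_insert_of_notMem (mem_filter.1 hx).2.2] at this
        omega)
      exact ⟨l, fun _ => hl⟩
    · exact ⟨[], fun h => absurd h hx⟩
  choose w hw using hwit
  refine ⟨B.filter (· ∈ T) ∪ X.biUnion fun x => (w x).toFinset.erase x, ?_, ?_, ?_⟩
  · refine (card_union_le _ _).trans (add_le_add hk ?_)
    refine (card_biUnion_le_card_mul X _ f fun x hx => ?_).trans (Nat.mul_le_mul_right f hX)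
    exact (card_erase_le.trans (List.toFinset_card_le _)).trans (hw x hx).2.2
  · intro y hy
    simp only [mem_union, mem_filter, mem_biUnion, mem_erase, List.mem_toFinset] at hy
    rcases hy with hy | ⟨x, hx, hyx, hy⟩
    · exact hy.1
    · exact (mem_insert.1 ((hw x hx).2.1 y hy)).resolve_left hyx
  · intro Gr hGr b hb
    by_cases hbT : b ∈ T
    · exact hGr.sub (by simp [hb, hbT])
    by_contra hbGr
    -- It suffices that b, the kernel and the part of `Gr` outside `T` lie in B. A vertex y of `Gr`
    -- outside both `T` and B would complete its cycle `w y` inside `Gr`.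
    refine hGr.max_off b (low_empty b) hbT hbGr (hB.mono ?_)
    intro y hy
    simp only [mem_insert, mem_union, mem_filter, mem_biUnion, mem_erase, List.mem_toFinset] at hy
    rcases hy with rfl | (hy | ⟨x, hx, hyx, hy⟩) | ⟨hy, hyT⟩
    · exact hb
    · exact hy.1
    · exact (mem_insert.1 ((hw x hx).2.1 y hy)).resolve_left hyx
    · by_contra hyB
      have hyX : y ∈ X := by simp [X, hyT, hyB]
      obtain ⟨h1, h2, -⟩ := hw y hyX
      obtain ⟨z, hz, hzGr⟩ := hGr.tBip _ h1
      by_cases hzy : z = y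
      · exact hzGr (hzy ▸ hy)
      · refine hzGr (hGr.sub (mem_union_right _ (mem_biUnion.2 ⟨y, hyX, ?_⟩)))
        simp [hzy, hz]

/-- The low vertices of the clique of low vertices around `x`. -/
noncomputable def lowClass [Fintype V] (G : SimpleGraph V) (I : Finset V) (x : V) : Finset V :=
  univ.filter fun y => Low G I y ∧ (y = x ∨ G.Adj x y)

lemma mem_lowClass [Fintype V] {x y : V} :
    y ∈ lowClass G I x ↔ Low G I y ∧ (y = x ∨ G.Adj x y) := by simp [lowClass]

/-- Being equal or adjacent is an equivalence relation on the low vertices. -/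
lemma lowClass_eq [Fintype V] (hG : SFree s G) (hI : Indep G I) (hcard : s + 6 ≤ I.card) {x y : V}
    (hx : Low G I x) (hy : Low G I y) : lowClass G I y = lowClass G I x ↔ y ∈ lowClass G I x := by
  constructor
  · intro h
    rw [← h, mem_lowClass]
    exact ⟨hy, Or.inl rfl⟩
  · intro h
    rcases (mem_lowClass.1 h).2 with rfl | hxy
    · rfl
    ext z
    simp only [mem_lowClass]
    refine and_congr_right fun hz => ⟨?_, ?_⟩
    · rintro (rfl | h)
      · exact Or.inr hxy
      · by_cases hzx : z = x
        · exact Or.inl hzx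
        · exact Or.inr (hx.adj_trans hG hI hcard hy hz hxy h (Ne.symm hzx))
    · rintro (rfl | h)
      · exact Or.inr hxy.symm
      · by_cases hzx : z = y
        · exact Or.inl hzx
        · exact Or.inr (hy.adj_trans hG hI hcard hx hz hxy.symm h (Ne.symm hzx))

lemma card_low_eq_sum [Fintype V] (hG : SFree s G) (hI : Indep G I) (hcard : s + 6 ≤ I.card)
    (B : Finset V) : (B.filter (Low G I)).card =
      ∑ Q ∈ (univ.filter (Low G I)).image (lowClass G I), (B ∩ Q).card := by
  rw [card_eq_sum_card_fiberwise (f := lowClass G I)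
    (t := (univ.filter (Low G I)).image (lowClass G I))]
  · refine sum_congr rfl fun Q hQ => ?_
    obtain ⟨x, hx, rfl⟩ := mem_image.1 hQ
    simp only [mem_filter, mem_univ, true_and] at hx
    congr 1
    ext y
    simp only [mem_filter, mem_inter]
    constructor
    · rintro ⟨⟨hy, hyl⟩, h⟩
      exact ⟨hy, (lowClass_eq hG hI hcard hx hyl).1 h⟩
    · rintro ⟨hy, h⟩
      have hyl := (mem_lowClass.1 h).1
      exact ⟨⟨hy, hyl⟩, (lowClass_eq hG hI hcard hx hyl).2 h⟩
  · intro y hy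
    simp only [coe_filter, Set.mem_ofPred_eq] at hy
    simp only [coe_image, Set.mem_image, coe_filter, mem_univ, true_and, Set.mem_ofPred_eq]
    exact ⟨y, hy.2, rfl⟩

/-- Comparing two sets class by class, where the members of `D` are charged to distinct classes. -/
lemma card_low_add_le [Fintype V] (hG : SFree s G) (hI : Indep G I) (hcard : s + 6 ≤ I.card)
    {B Gr D : Finset V} {q : V → V} (hq : ∀ d ∈ D, Low G I (q d))
    (hinj : ∀ d ∈ D, ∀ d' ∈ D, (q d' = q d ∨ G.Adj (q d) (q d')) → d' = d)
    (h : ∀ x, Low G I x → (∃ d ∈ D, q d ∈ lowClass G I x) →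
      (B ∩ lowClass G I x).card + 1 ≤ (Gr ∩ lowClass G I x).card)
    (h' : ∀ x, Low G I x → (B ∩ lowClass G I x).card ≤ (Gr ∩ lowClass G I x).card) :
    (B.filter (Low G I)).card + D.card ≤ (Gr.filter (Low G I)).card := by
  rw [card_low_eq_sum hG hI hcard, card_low_eq_sum hG hI hcard]
  have hD : D.card = (D.image fun d => lowClass G I (q d)).card := by
    rw [card_image_of_injOn]
    intro d hd d' hd' hdd
    have := (lowClass_eq hG hI hcard (hq d' hd') (hq d hd)).1 hdd
    exact hinj d' hd' d hd (mem_lowClass.1 this).2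
  have hsub : (D.image fun d => lowClass G I (q d)) ⊆
      (univ.filter (Low G I)).image (lowClass G I) := by
    intro Q hQ
    obtain ⟨d, hd, rfl⟩ := mem_image.1 hQ
    exact mem_image_of_mem _ (by simp [hq d hd])
  -- The size of `D` is spread over the sum as the indicator of the classes that are charged.
  rw [hD, ← inter_eq_right.2 hsub, ← filter_mem_eq_inter, card_filter, ← sum_add_distrib]
  refine sum_le_sum fun Q hQ => ?_
  obtain ⟨x, hx, rfl⟩ := mem_image.1 hQ
  simp only [mem_filter, mem_univ, true_and] at hx
  split_ifs with hc
  · obtain ⟨d, hd, hdx⟩ := mem_image.1 hc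
    exact h x hx ⟨d, hd, (lowClass_eq hG hI hcard hx (hq d hd)).1 hdx⟩
  · exact h' x hx

/-- A high vertex is complete to all but fewer than `s` of the edges in a family of mutually
anticomplete edges between low vertices. -/
lemma card_incomplete_lt (hG : SFree s G) (hI : Indep G I) (hcard : 4 * s + 8 ≤ I.card) {ι : Type}
    [DecidableEq ι] {Z : Finset ι} {p q : ι → V} (hlp : ∀ z ∈ Z, Low G I (p z))
    (hlq : ∀ z ∈ Z, Low G I (q z))
    (hZ : ∀ z ∈ Z, ∀ z' ∈ Z, z ≠ z' → ∀ a, (a = p z ∨ a = q z) → ∀ b, (b = p z' ∨ b = q z') →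
      a ≠ b ∧ ¬ G.Adj a b) {u : V} (hu : ¬ Low G I u) :
    (Z.filter fun z => ¬ (G.Adj u (p z) ∧ G.Adj u (q z))).card < s := by
  by_contra! hs
  obtain ⟨Z', hZ', hs⟩ := exists_subset_card_eq hs
  have hZm : ∀ z ∈ Z', z ∈ Z ∧ ¬ (G.Adj u (p z) ∧ G.Adj u (q z)) := fun z hz => by
    simpa using hZ' hz
  -- Each incomplete edge has an end not adjacent to u. These ends are pairwise nonadjacent because
  -- the edges are mutually anticomplete.
  let x : ι → V := fun z => if G.Adj u (p z) then q z else p z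
  have hxz : ∀ z, x z = p z ∨ x z = q z := fun z => by simp only [x]; split_ifs <;> simp
  have hux : ∀ z ∈ Z', ¬ G.Adj u (x z) := by
    intro z hz
    have := (hZm z hz).2
    simp only [x]
    split_ifs with h
    · exact fun h' => this ⟨h, h'⟩
    · exact h
  have hxl : ∀ z ∈ Z', Low G I (x z) := by
    intro z hz
    rcases hxz z with h | h <;> rw [h]
    exacts [hlp z (hZm z hz).1, hlq z (hZm z hz).1]
  let J := Z'.image x
  have hJ : J.card = s := by
    rw [card_image_of_injOn, hs]
    intro z hz z' hz' h
    by_contra hne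
    exact (hZ z (hZm z hz).1 z' (hZm z' hz').1 hne _ (hxz z) _ (hxz z')).1 h
  -- Each member of `J` contributes itself and at most one neighbour in `I`. Two neighbours i, j of
  -- u in `I` outside `X` give an induced path i u j anticomplete to `J`; the 4s + 8 members of `I`
  -- leave room for both.
  let X := J.biUnion fun x => insert x (I.filter fun a => G.Adj x a)
  have hX : X.card ≤ s * 2 := by
    rw [← hJ]
    refine card_biUnion_le_card_mul _ _ _ fun y hy => ?_
    obtain ⟨z, hz, rfl⟩ := mem_image.1 hy
    have := (hxl z hz).card_adj_le
    have := card_insert_le (x z) (I.filter fun a => G.Adj (x z) a)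
    omega
  obtain ⟨i, hi, hiX, hui, -⟩ := exists_common_neighbor hG hI hu hu (X := X) (by omega)
  obtain ⟨j, hj, hjX, huj, -⟩ := exists_common_neighbor hG hI hu hu (X := insert i X) (by
    have := card_insert_le i X
    omega)
  have hij : i ≠ j := by rintro rfl; simp at hjX
  have hXm : ∀ k ∈ I, k ∉ X → ∀ y ∈ J, y ≠ k ∧ ¬ G.Adj k y := by
    intro k hk hkX y hy
    refine ⟨?_, fun h => hkX (mem_biUnion.2 ⟨y, hy, by simp [hk, h.symm]⟩)⟩
    rintro rfl
    exact hkX (mem_biUnion.2 ⟨y, hy, by simp⟩)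
  have hjX' : j ∉ X := fun h => hjX (by simp [h])
  refine absurd (hG i u j hui.symm huj (hI i hi j hj) hij J ?_ ?_) (by omega)
  · intro a ha b hb
    obtain ⟨z, hz, rfl⟩ := mem_image.1 ha
    obtain ⟨z', hz', rfl⟩ := mem_image.1 hb
    by_cases hzz : z = z'
    · subst hzz; exact G.irrefl
    · exact (hZ z (hZm z hz).1 z' (hZm z' hz').1 hzz _ (hxz z) _ (hxz z')).2
  · intro a ha
    have h1 := hXm i hi hiX a ha
    have h2 := hXm j hj hjX' a ha
    obtain ⟨z, hz, rfl⟩ := mem_image.1 ha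
    refine ⟨h1.1, ?_, h2.1, h1.2, hux z hz, h2.2⟩
    intro h
    exact hu (h ▸ hxl z hz)

/-- Two high vertices in a set without odd `T`-cycles leave room for few edges between low
vertices. -/
lemma card_low_edges_le (hG : SFree s G) (hI : Indep G I) (hcard : 4 * s + 8 ≤ I.card) (hIT : I ⊆ T)
    {B : Finset V} (hIB : I ⊆ B) (hB : TBip G T B) {ι : Type} [DecidableEq ι] {Z : Finset ι}
    {p q : ι → V} (hp : ∀ z ∈ Z, p z ∈ B ∧ Low G I (p z))
    (hq : ∀ z ∈ Z, q z ∈ B ∧ Low G I (q z)) (hpq : ∀ z ∈ Z, G.Adj (p z) (q z))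
    (hZ : ∀ z ∈ Z, ∀ z' ∈ Z, z ≠ z' → ∀ a, (a = p z ∨ a = q z) → ∀ b, (b = p z' ∨ b = q z') →
      a ≠ b ∧ ¬ G.Adj a b) {u v : V} (huB : u ∈ B) (hvB : v ∈ B) (hu : ¬ Low G I u)
    (hv : ¬ Low G I v) (huv : u ≠ v) : Z.card ≤ 2 * s := by
  have h1 := card_incomplete_lt hG hI hcard (fun z hz => (hp z hz).2) (fun z hz => (hq z hz).2) hZ hu
  have h2 := card_incomplete_lt hG hI hcard (fun z hz => (hp z hz).2) (fun z hz => (hq z hz).2) hZ hv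
  have h3 := card_union_le (Z.filter fun z => ¬ (G.Adj u (p z) ∧ G.Adj u (q z)))
    (Z.filter fun z => ¬ (G.Adj v (p z) ∧ G.Adj v (q z)))
  have h4 : Z ⊆ (Z.filter fun z => ¬ (G.Adj u (p z) ∧ G.Adj u (q z))) ∪
      (Z.filter fun z => ¬ (G.Adj v (p z) ∧ G.Adj v (q z))) := by
    intro z hz
    by_contra h
    simp only [mem_union, mem_filter, hz, true_and, not_or, not_not] at h
    -- An edge complete to both u and v falls under the last local condition, with u at one end and
    -- v at the other.
    exact huv (((tBip_iff_local hG hI (by omega) hIT hIB).1 hB).2.2 (p z) (hp z hz).1 (q z)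
      (hq z hz).1 u huB v hvB (hp z hz).2 (hq z hz).2 hu hv (hpq z hz) h.1.1 h.2.2)
  have h5 := card_le_card h4
  omega

end Kernel

end SubsetOCT

namespace SubsetOCT

open Finset
open scoped Classical

/-! ### Anchored edges and the structure of the greedy extension -/

section Setting

variable {V : Type} {G : SimpleGraph V} {I B L₀ : Finset V}

/-- The attachment of the edge `q₁q₂` of low vertices to the high vertices of `B` is recorded
in `L₀`. -/
def Anchored (G : SimpleGraph V) (I B L₀ : Finset V) (q₁ q₂ : V) : Prop :=
  (∃ w ∈ L₀, G.Adj w q₁ ∧ G.Adj w q₂) ∨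
  (∃ w ∈ L₀, G.Adj w q₁ ∧ ∀ x ∈ B, Low G I x → G.Adj q₁ x → ∀ u ∈ B, ¬ Low G I u → ¬ G.Adj u x) ∨
  (∀ x ∈ B, Low G I x → (x = q₁ ∨ G.Adj q₁ x) → ∀ u ∈ B, ¬ Low G I u → ¬ G.Adj u x)

lemma Anchored.mono {q₁ q₂ : V} {L₁ : Finset V} (h : Anchored G I B L₀ q₁ q₂) (hL : L₀ ⊆ L₁) :
    Anchored G I B L₁ q₁ q₂ := by
  rcases h with ⟨w, hw, h⟩ | ⟨w, hw, h⟩ | h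
  exacts [Or.inl ⟨w, hL hw, h⟩, Or.inr (Or.inl ⟨w, hL hw, h⟩), Or.inr (Or.inr h)]

end Setting

section Setting

variable {V : Type} [DecidableEq V] {s : ℕ} {G : SimpleGraph V} {I T B Gr K F L₀ : Finset V}

/-- A set `B` without odd `T`-cycles containing a large independent subset `I` of `T`, together with
a greedy extension `Gr` of a kernel `K ⊆ B` that contains `I` and a set `L₀` of high vertices. -/
structure KernelSetting (s : ℕ) (G : SimpleGraph V) (I T B Gr K F L₀ : Finset V) : Prop where
  sFree : SFree s G
  indep : Indep G I
  card_le : 4 * s + 8 ≤ I.card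
  subT : I ⊆ T
  subK : I ⊆ K
  subB : K ⊆ B
  tBip : TBip G T B
  greedy : GreedyExt G T K F Gr
  low_of_low : ∀ v, Low G I v → Low G F v
  anchorK : L₀ ⊆ K
  anchor_high : ∀ w ∈ L₀, ¬ Low G I w
  high_mem : (∀ v ∈ Gr, ¬ Low G I v → v ∈ L₀) ∨ s + 3 ≤ L₀.card

namespace KernelSetting

lemma card_le' (c : KernelSetting s G I T B Gr K F L₀) : s + 6 ≤ I.card := by
  have := c.card_le
  omega

lemma localB (c : KernelSetting s G I T B Gr K F L₀) : LocalTBip G I T B :=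
  (tBip_iff_local c.sFree c.indep (by have := c.card_le; omega) c.subT
    (c.subK.trans c.subB)).1 c.tBip

lemma localGr (c : KernelSetting s G I T B Gr K F L₀) : LocalTBip G I T Gr :=
  (tBip_iff_local c.sFree c.indep (by have := c.card_le; omega) c.subT
    (c.subK.trans c.greedy.sub)).1 c.greedy.tBip

lemma adj_trans (c : KernelSetting s G I T B Gr K F L₀) {x y z : V} (hx : Low G I x)
    (hy : Low G I y) (hz : Low G I z) (hxy : G.Adj x y) (hyz : G.Adj y z) (hne : x ≠ z) :
    G.Adj x z := hx.adj_trans c.sFree c.indep c.card_le' hy hz hxy hyz hne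

/-- Vertices without neighbours in a large anchor set induce a disjoint union of cliques. -/
lemma adj_of_anti (c : KernelSetting s G I T B Gr K F L₀) (hL : s + 3 ≤ L₀.card) {x y z : V}
    (hxy : G.Adj x y) (hyz : G.Adj y z) (hne : x ≠ z)
    (hanti : ∀ a ∈ L₀, a ≠ x → a ≠ y → a ≠ z → ¬ G.Adj x a ∧ ¬ G.Adj y a ∧ ¬ G.Adj z a) :
    G.Adj x z := by
  by_contra hxz
  have := c.sFree x y z hxy hyz hxz hne (L₀ \ {x, y, z}) ?_ ?_
  · have h1 := le_card_sdiff {x, y, z} L₀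
    have h2 := card_le_three (a := x) (b := y) (c := z)
    omega
  · intro a ha b hb
    exact c.localB.1 a (c.subB (c.anchorK (mem_sdiff.1 ha).1)) b
      (c.subB (c.anchorK (mem_sdiff.1 hb).1)) (c.anchor_high a (mem_sdiff.1 ha).1)
      (c.anchor_high b (mem_sdiff.1 hb).1)
  · intro a ha
    simp only [mem_sdiff, mem_insert, mem_singleton, not_or] at ha
    obtain ⟨ha, h1, h2, h3⟩ := ha
    exact ⟨h1, h2, h3, hanti a ha h1 h2 h3⟩

lemma anchorB (c : KernelSetting s G I T B Gr K F L₀) {w : V} (hw : w ∈ L₀) : w ∈ B :=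
  c.subB (c.anchorK hw)

lemma anchorGr (c : KernelSetting s G I T B Gr K F L₀) {w : V} (hw : w ∈ L₀) : w ∈ Gr :=
  c.greedy.sub (c.anchorK hw)

/-- A high vertex of `Gr` either lies in B, where the local conditions of B apply to it, or L₀ is
large enough for `adj_of_anti`. -/
lemma mem_or_card (c : KernelSetting s G I T B Gr K F L₀) {u : V} (hu : u ∈ Gr)
    (hh : ¬ Low G I u) : u ∈ L₀ ∨ (u ∉ L₀ ∧ s + 3 ≤ L₀.card) := by
  by_cases h : u ∈ L₀
  · exact Or.inl h
  · exact Or.inr ⟨h, c.high_mem.resolve_left fun h' => h (h' u hu hh)⟩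

/-- High vertices of the greedy extension attach to the clique of an anchored edge in a
controlled way. -/
lemma attach (c : KernelSetting s G I T B Gr K F L₀) {q₁ q₂ r : V} (h₁K : q₁ ∈ K) (h₂K : q₂ ∈ K)
    (h₁ : Low G I q₁) (h₂ : Low G I q₂) (h₁₂ : G.Adj q₁ q₂) (hanc : Anchored G I B L₀ q₁ q₂)
    (hr : r ∈ B) (hrl : Low G I r) (hr₁ : G.Adj q₁ r) (hr₂ : G.Adj q₂ r) {u : V} (hu : u ∈ Gr)
    (huh : ¬ Low G I u) (hur : G.Adj u r) :
    u ∉ T ∧ ∀ v ∈ Gr, ¬ Low G I v → ∀ q ∈ Gr, Low G I q → G.Adj q r → G.Adj v q → v = u := by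
  obtain ⟨b1, b2, b3⟩ := c.localB
  obtain ⟨g1, g2, g3⟩ := c.localGr
  have h₁B := c.subB h₁K
  have h₂B := c.subB h₂K
  have h₁G := c.greedy.sub h₁K
  have h₂G := c.greedy.sub h₂K
  have hq₁ : ∀ q, Low G I q → G.Adj q r → q ≠ q₁ → G.Adj q q₁ := fun q hq hqr hne =>
    c.adj_trans hq hrl h₁ hqr hr₁.symm hne
  rcases hanc with ⟨w, hw, hw1, hw2⟩ | ⟨w, hw, hw1, hun⟩ | hun
  · have hwh := c.anchor_high w hw
    have hwB := c.anchorB hw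
    have hwG := c.anchorGr hw
    -- For u in L₀ this is the last local condition in B. Otherwise w q₁ r has no neighbour in L₀
    -- other than w, so w is adjacent to r; then u r w has none either, so u is adjacent to w,
    -- although the high vertices of `Gr` are independent.
    have huw : u = w := by
      rcases c.mem_or_card hu huh with huL | ⟨huL, hL⟩
      · exact b3 r hr q₁ h₁B u (c.anchorB huL) w hwB hrl h₁ huh hwh hr₁.symm hur hw1
      by_contra huw
      have hr' : ∀ a ∈ L₀, a ≠ w → ¬ G.Adj r a := fun a ha haw h => haw
        (b3 r hr q₁ h₁B a (c.anchorB ha) w hwB hrl h₁ (c.anchor_high a ha) hwh hr₁.symm h.symm hw1)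
      have hq' : ∀ a ∈ L₀, a ≠ w → ¬ G.Adj q₁ a := fun a ha haw h => haw
        (b3 q₁ h₁B q₂ h₂B a (c.anchorB ha) w hwB h₁ h₂ (c.anchor_high a ha) hwh h₁₂ h.symm hw2)
      have hw' : ∀ a ∈ L₀, ¬ G.Adj w a := fun a ha =>
        b1 w hwB a (c.anchorB ha) hwh (c.anchor_high a ha)
      have hu' : ∀ a ∈ L₀, ¬ G.Adj u a := fun a ha =>
        g1 u hu a (c.anchorGr ha) huh (c.anchor_high a ha)
      have hwr : G.Adj w r := c.adj_of_anti hL hw1 hr₁ (by rintro rfl; exact hwh hrl)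
        fun a ha h1 _ _ => ⟨hw' a ha, hq' a ha h1, hr' a ha h1⟩
      exact hu' w hw (c.adj_of_anti hL hur hwr.symm huw
        fun a ha _ _ h => ⟨hu' a ha, hr' a ha h, hw' a ha⟩)
    subst huw
    refine ⟨fun huT => b2 u hwB q₁ h₁B q₂ h₂B huT hw1 h₁₂ hw2.symm, ?_⟩
    intro v hv hvh q hq hql hqr hvq
    by_cases hqq : q = q₁
    · subst hqq
      exact g3 q h₁G q₂ h₂G v hv u hu h₁ h₂ hvh huh h₁₂ hvq hw2
    · exact g3 q hq q₁ h₁G v hv u hu hql h₁ hvh huh (hq₁ q hql hqr hqq) hvq hw1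
  -- A member u of L₀ contradicts the anchoring directly. Otherwise r and q₂ see nothing of L₀, so
  -- the path u r q₂ makes u adjacent to q₂, and the edge q₂q₁ then forces u = w.
  · exfalso
    have hwh := c.anchor_high w hw
    have hwG := c.anchorGr hw
    rcases c.mem_or_card hu huh with huL | ⟨huL, hL⟩
    · exact hun r hr hrl hr₁ u (c.anchorB huL) huh hur
    have hun' : ∀ x ∈ B, Low G I x → G.Adj q₁ x → ∀ a ∈ L₀, ¬ G.Adj x a := fun x hx hxl hqx a ha h =>
      hun x hx hxl hqx a (c.anchorB ha) (c.anchor_high a ha) h.symm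
    have huq : G.Adj u q₂ := c.adj_of_anti hL hur hr₂.symm (by rintro rfl; exact huh h₂)
      fun a ha _ _ _ => ⟨g1 u hu a (c.anchorGr ha) huh (c.anchor_high a ha),
        hun' r hr hrl hr₁ a ha, hun' q₂ h₂B h₂ h₁₂ a ha⟩
    have := g3 q₂ h₂G q₁ h₁G u hu w hwG h₂ h₁ huh hwh h₁₂.symm huq hw1
    exact huL (this ▸ hw)
  · rcases c.mem_or_card hu huh with huL | ⟨huL, hL⟩
    · exact absurd hur (hun r hr hrl (Or.inr hr₁) u (c.anchorB huL) huh)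
    have hun' : ∀ x ∈ B, Low G I x → (x = q₁ ∨ G.Adj q₁ x) → ∀ a ∈ L₀, ¬ G.Adj x a :=
      fun x hx hxl hqx a ha h => hun x hx hxl hqx a (c.anchorB ha) (c.anchor_high a ha) h.symm
    -- No vertex of B in this clique sees L₀, and u does not either; hence u is adjacent to q₁ and
    -- q₂, each reached through r.
    have huq : ∀ x ∈ B, Low G I x → (x = q₁ ∨ G.Adj q₁ x) → G.Adj r x → G.Adj u x :=
      fun x hx hxl hqx hrx => c.adj_of_anti hL hur hrx (by rintro rfl; exact huh hxl)
        fun a ha _ _ _ => ⟨g1 u hu a (c.anchorGr ha) huh (c.anchor_high a ha),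
          hun' r hr hrl (Or.inr hr₁) a ha, hun' x hx hxl hqx a ha⟩
    have huq₁ := huq q₁ h₁B h₁ (Or.inl rfl) hr₁.symm
    have huq₂ := huq q₂ h₂B h₂ (Or.inr h₁₂) hr₂.symm
    refine ⟨fun huT => g2 u hu q₁ h₁G q₂ h₂G huT huq₁ h₁₂ huq₂.symm, ?_⟩
    intro v hv hvh q hq hql hqr hvq
    by_cases hqq : q = q₁
    · subst hqq
      exact g3 q h₁G q₂ h₂G v hv u hu h₁ h₂ hvh huh h₁₂ hvq huq₂
    · exact g3 q hq q₁ h₁G v hv u hu hql h₁ hvh huh (hq₁ q hql hqr hqq) hvq huq₁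

/-- The greedy extension contains the part of `B` in the clique of an anchored edge. -/
lemma mem_of_anchored (c : KernelSetting s G I T B Gr K F L₀) {q₁ q₂ r : V} (h₁K : q₁ ∈ K)
    (h₂K : q₂ ∈ K) (h₁ : Low G I q₁) (h₂ : Low G I q₂) (h₁₂ : G.Adj q₁ q₂)
    (hanc : Anchored G I B L₀ q₁ q₂) (hr : r ∈ B) (hrl : Low G I r) (hr₁ : G.Adj q₁ r)
    (hr₂ : G.Adj q₂ r) : r ∈ Gr := by
  by_contra hrG
  obtain ⟨b1, b2, b3⟩ := c.localB
  obtain ⟨g1, g2, g3⟩ := c.localGr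
  have h₁B := c.subB h₁K
  have h₂B := c.subB h₂K
  have hrT : r ∉ T := fun hrT => b2 r hr q₁ h₁B q₂ h₂B hrT hr₁.symm h₁₂ hr₂
  have key := fun {u} => c.attach (u := u) h₁K h₂K h₁ h₂ h₁₂ hanc hr hrl hr₁ hr₂
  refine c.greedy.max_off r (c.low_of_low r hrl) hrT hrG ?_
  have hmem : ∀ x ∈ insert r (K ∪ Gr.filter (· ∉ T)), x ≠ r → x ∈ Gr := by
    intro x hx hxr
    simp only [mem_insert, mem_union, mem_filter, hxr, false_or] at hx
    rcases hx with hx | hx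
    exacts [c.greedy.sub hx, hx.1]
  have hmem' : ∀ x ∈ insert r (K ∪ Gr.filter (· ∉ T)), ¬ Low G I x → x ∈ Gr :=
    fun x hx hxl => hmem x hx (by rintro rfl; exact hxl hrl)
  -- No terminal of the enlarged set sees r. A low one would lie in `K`, hence in B, and form a
  -- triangle with r and a further vertex of the clique; a high one is excluded by `attach`.
  have hadj : ∀ x ∈ insert r (K ∪ Gr.filter (· ∉ T)), G.Adj x r → x ∉ T := by
    intro a ha har haT
    have hne : a ≠ r := har.ne
    by_cases hal : Low G I a
    · have haB : a ∈ B := by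
        simp only [mem_insert, mem_union, mem_filter, hne, false_or, haT, not_true, and_false,
          or_false] at ha
        exact c.subB ha
      by_cases haq : a = q₁
      · subst haq
        exact b2 a h₁B q₂ h₂B r hr haT h₁₂ hr₂ har.symm
      · exact b2 a haB r hr q₁ h₁B haT har hr₁.symm
          (c.adj_trans hal hrl h₁ har hr₁.symm haq).symm
    · exact (key (hmem a ha hne) hal har).1 haT
  refine (tBip_iff_local c.sFree c.indep (by have := c.card_le; omega) c.subT
    (fun i hi => by simp [c.subK hi])).2 ⟨?_, ?_, ?_⟩
  · exact fun u hu v hv huh hvh => g1 u (hmem' u hu huh) v (hmem' v hv hvh) huh hvh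
  · intro x hx y hy z hz hxT hxy hyz hzx
    by_cases hyr : y = r
    · subst hyr
      exact hadj x hx hxy hxT
    by_cases hzr : z = r
    · subst hzr
      exact hadj x hx hzx.symm hxT
    have hxr : x ≠ r := by rintro rfl; exact hrT hxT
    exact g2 x (hmem x hx hxr) y (hmem y hy hyr) z (hmem z hz hzr) hxT hxy hyz hzx
  · intro q hq q' hq' u hu v hv hql hql' huh hvh hqq huq hvq
    have huG := hmem' u hu huh
    have hvG := hmem' v hv hvh
    by_cases hqr : q = r
    · subst hqr
      exact ((key huG huh huq).2 v hvG hvh q' (hmem q' hq' hqq.ne') hql' hqq.symm hvq).symm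
    by_cases hqr' : q' = r
    · subst hqr'
      exact (key hvG hvh hvq).2 u huG huh q (hmem q hq hqr) hql hqq huq
    exact g3 q (hmem q hq hqr) q' (hmem q' hq' hqr') u huG v hvG hql hql' huh hvh hqq huq hvq

/-- The greedy extension meets every clique of low vertices. -/
lemma exists_mem_class (c : KernelSetting s G I T B Gr K F L₀) {x : V} (hx : Low G I x) :
    ∃ y ∈ Gr, Low G I y ∧ (y = x ∨ G.Adj x y) := by
  by_contra! h
  obtain ⟨g1, g2, g3⟩ := c.localGr
  have hxG : x ∉ Gr := fun hxG => (h x hxG hx).1 rfl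
  -- All neighbours of x in `Gr` are now high, hence pairwise nonadjacent. Adding x creates neither
  -- a triangle through x nor an edge between low vertices at x.
  refine c.greedy.max x (c.low_of_low x hx) hxG ?_
  have hmem : ∀ y ∈ insert x Gr, y ≠ x → y ∈ Gr := fun y hy hne => (mem_insert.1 hy).resolve_left hne
  have hmem' : ∀ y ∈ insert x Gr, ¬ Low G I y → y ∈ Gr :=
    fun y hy hyl => hmem y hy (by rintro rfl; exact hyl hx)
  have hadj : ∀ y ∈ insert x Gr, G.Adj x y → y ∈ Gr ∧ ¬ Low G I y := by
    intro y hy hxy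
    have hyG := hmem y hy hxy.ne'
    exact ⟨hyG, fun hyl => (h y hyG hyl).2 hxy⟩
  have htri : ∀ y ∈ insert x Gr, ∀ z ∈ insert x Gr, G.Adj x y → G.Adj x z → ¬ G.Adj y z := by
    intro y hy z hz hxy hxz
    exact g1 y (hadj y hy hxy).1 z (hadj z hz hxz).1 (hadj y hy hxy).2 (hadj z hz hxz).2
  refine (tBip_iff_local c.sFree c.indep (by have := c.card_le; omega) c.subT
    ((c.subK.trans c.greedy.sub).trans (subset_insert _ _))).2 ⟨?_, ?_, ?_⟩
  · exact fun u hu v hv huh hvh => g1 u (hmem' u hu huh) v (hmem' v hv hvh) huh hvh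
  · intro a ha b hb d hd haT hab hbd hda
    by_cases h1 : a = x
    · subst h1; exact htri b hb d hd hab hda.symm hbd
    by_cases h2 : b = x
    · subst h2; exact htri d hd a ha hbd hab.symm hda
    by_cases h3 : d = x
    · subst h3; exact htri a ha b hb hda hbd.symm hab
    exact g2 a (hmem a ha h1) b (hmem b hb h2) d (hmem d hd h3) haT hab hbd hda
  · intro q hq q' hq' u hu v hv hql hql' huh hvh hqq huq hvq
    by_cases h1 : q = x
    · subst h1; exact absurd hql' (hadj q' hq' hqq).2
    by_cases h2 : q' = x
    · subst h2; exact absurd hql (hadj q hq hqq.symm).2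
    exact g3 q (hmem q hq h1) q' (hmem q' hq' h2) u (hmem' u hu huh) v (hmem' v hv hvh) hql hql'
      huh hvh hqq huq hvq

/-- A high vertex of `B` missing from the greedy extension is blocked by a high vertex or by a low
vertex without neighbours in the anchor set. -/
lemma exists_blocker (c : KernelSetting s G I T B Gr K F L₀) {l : V} (hl : l ∈ B)
    (hlh : ¬ Low G I l) (hlG : l ∉ Gr) (hlF : Low G F l) (hL : s + 3 ≤ L₀.card) :
    (∃ l' ∈ Gr, ¬ Low G I l' ∧ G.Adj l l') ∨
      ∃ q ∈ Gr, Low G I q ∧ G.Adj l q ∧ (∀ a ∈ L₀, ¬ G.Adj q a) ∧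
        ∃ q' ∈ Gr, Low G I q' ∧ G.Adj q q' := by
  by_contra! hno
  obtain ⟨hno1, hno2⟩ := hno
  obtain ⟨b1, b2, b3⟩ := c.localB
  obtain ⟨g1, g2, g3⟩ := c.localGr
  have hno2 : ∀ q ∈ Gr, Low G I q → G.Adj l q → ∀ q' ∈ Gr, Low G I q' → G.Adj q q' →
      ∃ a ∈ L₀, G.Adj q a := by
    intro q hq hql hlq q' hq' hql' hqq
    by_contra! h
    exact hno2 q hq hql hlq h q' hq' hql' hqq
  have hlL : ∀ a ∈ L₀, ¬ G.Adj l a := fun a ha =>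
    b1 l hl a (c.anchorB ha) hlh (c.anchor_high a ha)
  have haL : ∀ a ∈ L₀, ∀ b ∈ L₀, ¬ G.Adj a b := fun a ha b hb =>
    b1 a (c.anchorB ha) b (c.anchorB hb) (c.anchor_high a ha) (c.anchor_high b hb)
  have hlL' : l ∉ L₀ := fun h => hlG (c.anchorGr h)
  -- a low neighbour of `l` cannot have exactly one neighbour in the anchor set
  have huniq : ∀ q, ∀ a ∈ L₀, G.Adj l q → G.Adj q a → (∀ b ∈ L₀, G.Adj q b → b = a) → False := by
    intro q a ha hlq hqa hb
    refine hlL a ha (c.adj_of_anti hL hlq hqa (by rintro rfl; exact hlL' ha) ?_)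
    intro b hbL _ _ hba
    exact ⟨hlL b hbL, fun h => hba (hb b hbL h), haL a ha b hbL⟩
  -- The last local condition for the edge x y identifies every neighbour of x in L₀ with a
  -- neighbour b of y; so x has exactly one such neighbour, contrary to `huniq`. In `hpent` the
  -- vertex v plays the part of b.
  have htri : ∀ x ∈ Gr, ∀ y ∈ Gr, G.Adj l x → G.Adj l y → ¬ G.Adj x y := by
    intro x hx y hy hlx hly hxy
    have hxl : Low G I x := by by_contra h; exact hno1 x hx h hlx
    have hyl : Low G I y := by by_contra h; exact hno1 y hy h hly
    obtain ⟨a, ha, hxa⟩ := hno2 x hx hxl hlx y hy hyl hxy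
    obtain ⟨b, hb, hyb⟩ := hno2 y hy hyl hly x hx hxl hxy.symm
    have hab : ∀ a ∈ L₀, G.Adj x a → a = b := fun a ha hxa =>
      g3 x hx y hy a (c.anchorGr ha) b (c.anchorGr hb) hxl hyl (c.anchor_high a ha)
      (c.anchor_high b hb) hxy hxa.symm hyb.symm
    have := hab a ha hxa
    subst this
    exact huniq x a ha hlx hxa hab
  have hpent : ∀ q ∈ Gr, ∀ q' ∈ Gr, ∀ v ∈ Gr, Low G I q → Low G I q' → ¬ Low G I v → G.Adj q q' →
      G.Adj l q → ¬ G.Adj v q' := by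
    intro q hq q' hq' v hv hql hql' hvh hqq hlq hvq
    obtain ⟨a, ha, hqa⟩ := hno2 q hq hql hlq q' hq' hql' hqq
    have hav : ∀ a ∈ L₀, G.Adj q a → a = v := fun a ha hqa =>
      g3 q hq q' hq' a (c.anchorGr ha) v hv hql hql' (c.anchor_high a ha) hvh hqq hqa.symm hvq
    have := hav a ha hqa
    subst this
    exact huniq q a ha hlq hqa hav
  refine c.greedy.max l hlF hlG ?_
  have hmem : ∀ y ∈ insert l Gr, y ≠ l → y ∈ Gr := fun y hy hne => (mem_insert.1 hy).resolve_left hne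
  have hmem' : ∀ y ∈ insert l Gr, Low G I y → y ∈ Gr :=
    fun y hy hyl => hmem y hy (by rintro rfl; exact hlh hyl)
  refine (tBip_iff_local c.sFree c.indep (by have := c.card_le; omega) c.subT
    ((c.subK.trans c.greedy.sub).trans (subset_insert _ _))).2 ⟨?_, ?_, ?_⟩
  · intro u hu v hv huh hvh huv
    by_cases h1 : u = l
    · subst h1; exact hno1 v (hmem v hv huv.ne') hvh huv
    by_cases h2 : v = l
    · subst h2; exact hno1 u (hmem u hu h1) huh huv.symm
    exact g1 u (hmem u hu h1) v (hmem v hv h2) huh hvh huv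
  · intro x hx y hy z hz hxT hxy hyz hzx
    by_cases h1 : x = l
    · subst h1
      exact htri y (hmem y hy hxy.ne') z (hmem z hz hzx.ne) hxy hzx.symm hyz
    by_cases h2 : y = l
    · subst h2
      exact htri z (hmem z hz hyz.ne') x (hmem x hx h1) hyz hxy.symm hzx
    by_cases h3 : z = l
    · subst h3
      exact htri x (hmem x hx h1) y (hmem y hy h2) hzx hyz.symm hxy
    exact g2 x (hmem x hx h1) y (hmem y hy h2) z (hmem z hz h3) hxT hxy hyz hzx
  · intro q hq q' hq' u hu v hv hql hql' huh hvh hqq huq hvq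
    have hqG := hmem' q hq hql
    have hqG' := hmem' q' hq' hql'
    by_contra huv
    by_cases h1 : u = l
    · subst h1
      exact hpent q hqG q' hqG' v (hmem v hv (Ne.symm huv)) hql hql' hvh hqq huq hvq
    by_cases h2 : v = l
    · subst h2
      exact hpent q' hqG' q hqG u (hmem u hu huv) hql' hql huh hqq.symm hvq huq
    exact huv (g3 q hqG q' hqG' u (hmem u hu h1) v (hmem v hv h2) hql hql' huh hvh hqq huq hvq)

/-- Otherwise l q l₂ is a path without neighbours in L₀, so l and l₂ are adjacent, although the high
vertices of B are independent. This makes charging to blockers injective. -/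
lemma eq_of_common_blocker (c : KernelSetting s G I T B Gr K F L₀) (hL : s + 3 ≤ L₀.card) {l l₂ q : V}
    (hl : l ∈ B) (hlh : ¬ Low G I l) (hl₂ : l₂ ∈ B) (hl₂h : ¬ Low G I l₂) (hlq : G.Adj l q)
    (hlq₂ : G.Adj l₂ q) (hq : ∀ a ∈ L₀, ¬ G.Adj q a) : l = l₂ := by
  obtain ⟨b1, b2, b3⟩ := c.localB
  by_contra hne
  exact b1 l hl l₂ hl₂ hlh hl₂h (c.adj_of_anti hL hlq hlq₂.symm hne fun a ha _ _ _ =>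
    ⟨b1 l hl a (c.anchorB ha) hlh (c.anchor_high a ha), hq a ha,
      b1 l₂ hl₂ a (c.anchorB ha) hl₂h (c.anchor_high a ha)⟩)

/-- Low blockers of distinct vertices lie in distinct cliques: the path l q q₂ has no neighbours in
L₀, so l is adjacent to q₂, which is then a common blocker. -/
lemma eq_of_adj_blockers (c : KernelSetting s G I T B Gr K F L₀) (hL : s + 3 ≤ L₀.card)
    {l l₂ q q₂ : V} (hl : l ∈ B) (hlh : ¬ Low G I l) (hl₂ : l₂ ∈ B) (hl₂h : ¬ Low G I l₂)
    (hlq : G.Adj l q) (hlq₂ : G.Adj l₂ q₂) (hq : ∀ a ∈ L₀, ¬ G.Adj q a)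
    (hq₂ : ∀ a ∈ L₀, ¬ G.Adj q₂ a) (hq₂l : Low G I q₂) (h : q₂ = q ∨ G.Adj q q₂) : l₂ = l := by
  obtain ⟨b1, b2, b3⟩ := c.localB
  rcases h with rfl | h
  · exact c.eq_of_common_blocker hL hl₂ hl₂h hl hlh hlq₂ hlq hq
  · refine c.eq_of_common_blocker hL hl₂ hl₂h hl hlh hlq₂ ?_ hq₂
    exact c.adj_of_anti hL hlq h (by rintro rfl; exact hlh hq₂l) fun a ha _ _ _ =>
      ⟨b1 l hl a (c.anchorB ha) hlh (c.anchor_high a ha), hq a ha, hq₂ a ha⟩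

/-- The clique of an anchored edge does not contain a low blocker. -/
lemma not_blocker_of_anchored (c : KernelSetting s G I T B Gr K F L₀) (hL : s + 3 ≤ L₀.card)
    {l q q₁ q₂ : V} (hl : l ∈ B) (hlh : ¬ Low G I l) (hql : Low G I q)
    (hlq : G.Adj l q) (hq : ∀ a ∈ L₀, ¬ G.Adj q a) (h₁K : q₁ ∈ K) (h₂K : q₂ ∈ K) (h₁ : Low G I q₁)
    (h₂ : Low G I q₂) (h₁₂ : G.Adj q₁ q₂) (hanc : Anchored G I B L₀ q₁ q₂)
    (h : q = q₁ ∨ G.Adj q₁ q) : False := by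
  obtain ⟨b1, b2, b3⟩ := c.localB
  have h₁B := c.subB h₁K
  have h₂B := c.subB h₂K
  have hll : ∀ a ∈ L₀, ¬ G.Adj l a := fun a ha =>
    b1 l hl a (c.anchorB ha) hlh (c.anchor_high a ha)
  rcases hanc with ⟨w, hw, hw1, hw2⟩ | ⟨w, hw, hw1, hun⟩ | hun
  · have hqq : G.Adj q₁ q := h.resolve_left (by rintro rfl; exact hq w hw hw1.symm)
    have hwh := c.anchor_high w hw
    refine hq w hw (c.adj_of_anti hL hw1 hqq (by rintro rfl; exact hwh hql) ?_).symm
    intro a ha haw _ _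
    refine ⟨b1 w (c.anchorB hw) a (c.anchorB ha) hwh (c.anchor_high a ha), fun h => haw ?_, hq a ha⟩
    exact b3 q₁ h₁B q₂ h₂B a (c.anchorB ha) w (c.anchorB hw) h₁ h₂ (c.anchor_high a ha) hwh h₁₂
      h.symm hw2
  · have hqq : G.Adj q₁ q := h.resolve_left (by rintro rfl; exact hq w hw hw1.symm)
    refine hun q₂ h₂B h₂ h₁₂ l hl hlh ?_
    by_cases hqq₂ : q = q₂
    · exact hqq₂ ▸ hlq
    have hqq' := c.adj_trans hql h₁ h₂ hqq.symm h₁₂ hqq₂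
    refine c.adj_of_anti hL hlq hqq' (by rintro rfl; exact hlh h₂) ?_
    intro a ha _ _ _
    exact ⟨hll a ha, hq a ha, fun h =>
      hun q₂ h₂B h₂ h₁₂ a (c.anchorB ha) (c.anchor_high a ha) h.symm⟩
  · refine hun q₁ h₁B h₁ (Or.inl rfl) l hl hlh ?_
    rcases h with rfl | hqq
    · exact hlq
    refine c.adj_of_anti hL hlq hqq.symm (by rintro rfl; exact hlh h₁) ?_
    intro a ha _ _ _
    exact ⟨hll a ha, hq a ha, fun h =>
      hun q₁ h₁B h₁ (Or.inl rfl) a (c.anchorB ha) (c.anchor_high a ha) h.symm⟩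

end KernelSetting

/-- Every edge of low vertices in `B` can be replaced by an edge anchored by at most one vertex. -/
lemma exists_anchored (hG : SFree s G) (hI : Indep G I) (hcard : 4 * s + 8 ≤ I.card) (hIT : I ⊆ T)
    (hIB : I ⊆ B) (hB : TBip G T B) {x y : V} (hx : x ∈ B) (hy : y ∈ B) (hxl : Low G I x)
    (hyl : Low G I y) (hxy : G.Adj x y) : ∃ q₁ ∈ B, ∃ q₂ ∈ B, ∃ W ⊆ B, W.card ≤ 1 ∧
      (∀ w ∈ W, ¬ Low G I w) ∧ Low G I q₁ ∧ Low G I q₂ ∧ G.Adj q₁ q₂ ∧ (q₁ = x ∨ G.Adj x q₁) ∧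
      Anchored G I B W q₁ q₂ := by
  obtain ⟨b1, b2, b3⟩ := (tBip_iff_local hG hI (by omega) hIT hIB).1 hB
  have htr := fun {a b d : V} (ha : Low G I a) (hb : Low G I b) (hd : Low G I d) =>
    ha.adj_trans hG hI (by omega) hb hd
  -- An end with a high neighbour in B is preferred, and then a second one. When both exist, the
  -- last local condition makes their high neighbours coincide. The outcomes match the three clauses
  -- of `Anchored`.
  by_cases h : ∃ q ∈ B, Low G I q ∧ (q = x ∨ G.Adj x q) ∧ ∃ w ∈ B, ¬ Low G I w ∧ G.Adj w q
  · obtain ⟨q₁, h₁B, h₁, hq₁x, w, hw, hwh, hwq⟩ := h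
    by_cases h' : ∃ q ∈ B, Low G I q ∧ G.Adj q₁ q ∧ ∃ w ∈ B, ¬ Low G I w ∧ G.Adj w q
    · obtain ⟨q₂, h₂B, h₂, h₁₂, w', hw', hwh', hwq'⟩ := h'
      have := b3 q₁ h₁B q₂ h₂B w hw w' hw' h₁ h₂ hwh hwh' h₁₂ hwq hwq'
      subst this
      exact ⟨q₁, h₁B, q₂, h₂B, {w}, by simpa using hw, by simp, by simpa using hwh, h₁, h₂, h₁₂,
        hq₁x, Or.inl ⟨w, by simp, hwq, hwq'⟩⟩
    · push Not at h'
      obtain ⟨q₂, h₂B, h₂, h₁₂⟩ : ∃ q₂ ∈ B, Low G I q₂ ∧ G.Adj q₁ q₂ := by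
        by_cases hqx : q₁ = x
        · exact ⟨y, hy, hyl, hqx ▸ hxy⟩
        · exact ⟨x, hx, hxl, (hq₁x.resolve_left hqx).symm⟩
      exact ⟨q₁, h₁B, q₂, h₂B, {w}, by simpa using hw, by simp, by simpa using hwh, h₁, h₂, h₁₂,
        hq₁x, Or.inr (Or.inl ⟨w, by simp, hwq, h'⟩)⟩
  · push Not at h
    exact ⟨x, hx, y, hy, ∅, by simp, by simp, by simp, hxl, hyl, hxy, Or.inl rfl, Or.inr (Or.inr h)⟩

end Setting

end SubsetOCT

/-! ### Optimality of greedy extensions and existence of the kernel -/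

namespace SubsetOCT

open Finset
open scoped Classical

/-- A surplus of low vertices pays for the high vertices that the greedy extension lacks. -/
lemma card_le_of_low_high {V : Type} {G : SimpleGraph V} {I B Gr D : Finset V}
    (hlow : (B.filter (Low G I)).card + D.card ≤ (Gr.filter (Low G I)).card)
    (hhigh : (B.filter fun v => ¬ Low G I v).card ≤ (Gr.filter fun v => ¬ Low G I v).card + D.card) :
    B.card ≤ Gr.card := by
  have h1 := card_filter_add_card_filter_not (s := B) (Low G I)
  have h2 := card_filter_add_card_filter_not (s := Gr) (Low G I)
  omega

section Optimal

variable {V : Type} [Fintype V] [DecidableEq V] {s : ℕ} {G : SimpleGraph V} {I T B : Finset V}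

lemma adj_of_mem_lowClass (hG : SFree s G) (hI : Indep G I) (hcard : s + 6 ≤ I.card) {x a b : V}
    (hx : Low G I x) (ha : a ∈ lowClass G I x) (hb : b ∈ lowClass G I x) (hab : a ≠ b) :
    G.Adj a b := by
  obtain ⟨hal, ha⟩ := mem_lowClass.1 ha
  obtain ⟨hbl, hb⟩ := mem_lowClass.1 hb
  rcases ha with rfl | ha
  · exact hb.resolve_left hab.symm
  rcases hb with rfl | hb
  · exact ha.symm
  exact hal.adj_trans hG hI hcard hx hbl ha.symm hb hab

lemma mem_lowClass_of_adj (hG : SFree s G) (hI : Indep G I) (hcard : s + 6 ≤ I.card) {x a b : V}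
    (hx : Low G I x) (ha : a ∈ lowClass G I x) (hb : Low G I b) (hab : G.Adj a b) :
    b ∈ lowClass G I x := by
  have hal := (mem_lowClass.1 ha).1
  rw [← (lowClass_eq hG hI hcard hx hal).2 ha, mem_lowClass]
  exact ⟨hb, Or.inr hab⟩

/-- Optimality of the greedy extension if `B` contains at most one high vertex. -/
lemma card_le_of_high_le_one (hG : SFree s G) (hI : Indep G I) (hcard : 4 * s + 8 ≤ I.card)
    (hIT : I ⊆ T) (hIB : I ⊆ B) (hB : TBip G T B) (hL : (B.filter fun v => ¬ Low G I v).card ≤ 1)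
    {Gr : Finset V} (hGr : GreedyExt G T (I ∪ B.filter fun v => ¬ Low G I v) I Gr) :
    B.card ≤ Gr.card := by
  set L := B.filter fun v => ¬ Low G I v with hLdef
  have hLm : ∀ {v}, v ∈ L ↔ v ∈ B ∧ ¬ Low G I v := by simp [hLdef]
  -- With F = `I`, only low vertices are added to the kernel.
  have hGL : ∀ v ∈ Gr, ¬ Low G I v → v ∈ L := by
    intro v hv hvh
    by_contra hvL
    refine hvh (hGr.low v hv fun h => ?_)
    rcases mem_union.1 h with h | h
    exacts [hvh (hI.low h), hvL h]
  have c : KernelSetting s G I T B Gr (I ∪ L) I L :=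
    ⟨hG, hI, hcard, hIT, subset_union_left, union_subset hIB (filter_subset _ _), hB, hGr,
      fun _ h => h, subset_union_right, fun w hw => (hLm.1 hw).2, Or.inl hGL⟩
  have hcard' := c.card_le'
  have hLeq : ∀ u ∈ L, ∀ v ∈ L, u = v := fun u hu v hv => card_le_one.1 hL u hu v hv
  obtain ⟨b1, b2, b3⟩ := c.localB
  obtain ⟨g1, g2, g3⟩ := c.localGr
  refine card_le_of_low_high (I := I) (D := ∅) (G := G)
    (card_low_add_le hG hI hcard' (q := id) (by simp) (by simp) (by simp) ?_) ?_
  swap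
  · refine (card_le_card (fun v hv => ?_)).trans (Nat.le_add_right _ _)
    exact mem_filter.2 ⟨c.anchorGr hv, (hLm.1 hv).2⟩
  intro x hx
  have hadj := fun {a b} => adj_of_mem_lowClass (a := a) (b := b) hG hI hcard' hx
  have hcls := fun {a b} => mem_lowClass_of_adj (a := a) (b := b) hG hI hcard' hx
  have hlow : ∀ {a}, a ∈ lowClass G I x → Low G I a := fun h => (mem_lowClass.1 h).1
  -- In a clique containing a terminal of B, three vertices of B would give a triangle through it,
  -- so B has at most two there.
  by_cases hT : ∃ t ∈ B ∩ lowClass G I x, t ∈ T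
  · obtain ⟨t, htm, htT⟩ := hT
    have htm' := mem_inter.1 htm
    have hnot : ∀ y ∈ B ∩ lowClass G I x, ∀ z ∈ B ∩ lowClass G I x, y ≠ t → z ≠ t → y = z := by
      intro y hy z hz hyt hzt
      by_contra hyz
      rw [mem_inter] at hy hz
      exact b2 t htm'.1 y hy.1 z hz.1 htT (hadj htm'.2 hy.2 hyt.symm) (hadj hy.2 hz.2 hyz)
        (hadj hz.2 htm'.2 hzt)
    have h2 : (B ∩ lowClass G I x).card ≤ 2 := by
      have h3 : ((B ∩ lowClass G I x).erase t).card ≤ 1 :=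
        card_le_one.2 fun y hy z hz => hnot y (mem_of_mem_erase hy) z (mem_of_mem_erase hz)
          (ne_of_mem_erase hy) (ne_of_mem_erase hz)
      rw [card_erase_of_mem htm] at h3
      omega
    by_contra! hlt
    obtain ⟨z, hzG, hzl, hzx⟩ := c.exists_mem_class hx
    have hzm : z ∈ Gr ∩ lowClass G I x := mem_inter.2 ⟨hzG, mem_lowClass.2 ⟨hzl, hzx⟩⟩
    have hGz : ∀ y ∈ Gr, y ∈ lowClass G I x → y = z := fun y hy hyx =>
      card_le_one.1 (by omega : (Gr ∩ lowClass G I x).card ≤ 1) y (mem_inter.2 ⟨hy, hyx⟩) z hzm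
    -- Adding p can only fail through a triangle p z u with u high. Among the two vertices a, b of B
    -- in this class, one being t, the only high vertex sees at most one, so a suitable p can be
    -- chosen from them.
    obtain ⟨p, hpx, hpz, hpu⟩ : ∃ p ∈ lowClass G I x, p ≠ z ∧ ∀ u ∈ L, G.Adj u p → ¬ G.Adj u z := by
      have hpos := card_pos.2 ⟨z, hzm⟩
      obtain ⟨a, ha, b, hb, hab⟩ := one_lt_card.1 (by omega : 1 < (B ∩ lowClass G I x).card)
      have htab : t = a ∨ t = b := by
        by_contra! h
        exact hab (hnot a ha b hb h.1.symm h.2.symm)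
      rw [mem_inter] at ha hb
      have hadj' := hadj ha.2 hb.2 hab
      have hu : ∀ u ∈ L, G.Adj u a → ¬ G.Adj u b := by
        intro u hu hua hub
        have huB := (hLm.1 hu).1
        rcases htab with rfl | rfl
        · exact b2 t ha.1 b hb.1 u huB htT hadj' hub.symm hua
        · exact b2 t hb.1 a ha.1 u huB htT hadj'.symm hua.symm hub
      by_cases hza : z = a
      · subst hza
        exact ⟨b, hb.2, hab.symm, fun u hu1 h h' => hu u hu1 h' h⟩
      by_cases hzb : z = b
      · subst hzb
        exact ⟨a, ha.2, hab, hu⟩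
      by_cases h : ∃ u ∈ L, G.Adj u a
      · obtain ⟨u, huL, hua⟩ := h
        exact ⟨b, hb.2, Ne.symm hzb, fun v hv hvb => absurd hvb (hLeq u huL v hv ▸ hu u huL hua)⟩
      · exact ⟨a, ha.2, Ne.symm hza, fun u hu1 h' => absurd ⟨u, hu1, h'⟩ h⟩
    have hpl := hlow hpx
    have hpG : p ∉ Gr := fun h => hpz (hGz p h hpx)
    refine hGr.max p hpl hpG ?_
    have hmem : ∀ y ∈ insert p Gr, y ≠ p → y ∈ Gr := fun y hy hne => (mem_insert.1 hy).resolve_left hne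
    have hmemL : ∀ y ∈ insert p Gr, ¬ Low G I y → y ∈ L := fun y hy hyh =>
      hGL y (hmem y hy (by rintro rfl; exact hyh hpl)) hyh
    have htri : ∀ y ∈ insert p Gr, ∀ w ∈ insert p Gr, G.Adj p y → G.Adj p w → ¬ G.Adj y w := by
      intro y hy w hw hpy hpw hyw
      have hyG := hmem y hy hpy.ne'
      have hwG := hmem w hw hpw.ne'
      have hz : ∀ y ∈ Gr, G.Adj p y → Low G I y → y = z := fun y hy hpy hyl =>
        hGz y hy (hcls hpx hyl hpy)
      by_cases hyl : Low G I y
      · have := hz y hyG hpy hyl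
        subst this
        by_cases hwl : Low G I w
        · exact hyw.ne (hz w hwG hpw hwl).symm
        · exact hpu w (hGL w hwG hwl) hpw.symm hyw.symm
      · by_cases hwl : Low G I w
        · have := hz w hwG hpw hwl
          subst this
          exact hpu y (hGL y hyG hyl) hpy.symm hyw
        · exact g1 y hyG w hwG hyl hwl hyw
    refine (tBip_iff_local hG hI (by omega) hIT
      ((c.subK.trans hGr.sub).trans (subset_insert _ _))).2 ⟨?_, ?_, ?_⟩
    · intro u hu v hv huh hvh
      rw [hLeq u (hmemL u hu huh) v (hmemL v hv hvh)]
      exact G.irrefl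
    · intro a ha b hb d hd haT hab hbd hda
      by_cases h1 : a = p
      · subst h1; exact htri b hb d hd hab hda.symm hbd
      by_cases h2 : b = p
      · subst h2; exact htri d hd a ha hbd hab.symm hda
      by_cases h3 : d = p
      · subst h3; exact htri a ha b hb hda hbd.symm hab
      exact g2 a (hmem a ha h1) b (hmem b hb h2) d (hmem d hd h3) haT hab hbd hda
    · intro q _ q' _ u hu v hv _ _ huh hvh _ _ _
      exact hLeq u (hmemL u hu huh) v (hmemL v hv hvh)
  · push Not at hT
    -- A vertex r of B is rejected only because of a triangle r u y in which the high vertex u is a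
    -- terminal and y is a low vertex of the same class.
    have key : ∀ r ∈ B ∩ lowClass G I x, r ∉ Gr → ∃ u ∈ L, u ∈ T ∧ G.Adj u r ∧
        ∃ y ∈ Gr ∩ lowClass G I x, G.Adj u y := by
      intro r hr hrG
      by_contra! hno
      have hrT := hT r hr
      rw [mem_inter] at hr
      have hrl := hlow hr.2
      refine hGr.max_off r hrl hrT hrG ?_
      have hmem : ∀ y ∈ insert r (I ∪ L ∪ Gr.filter (· ∉ T)), y ≠ r → y ∈ Gr := by
        intro y hy hyr
        simp only [mem_insert, hyr, false_or, mem_union (s := I ∪ L), mem_filter] at hy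
        rcases hy with hy | hy
        exacts [hGr.sub hy, hy.1]
      have hmemL : ∀ y ∈ insert r (I ∪ L ∪ Gr.filter (· ∉ T)), ¬ Low G I y → y ∈ L :=
        fun y hy hyh => hGL y (hmem y hy (by rintro rfl; exact hyh hrl)) hyh
      have hmemT : ∀ y ∈ insert r (I ∪ L ∪ Gr.filter (· ∉ T)), G.Adj r y → Low G I y → y ∉ T := by
        intro y hy hry hyl hyT
        simp only [mem_insert, hry.ne', false_or, mem_union, mem_filter, hyT, not_true, and_false,
          or_false] at hy
        rcases hy with hy | hy
        · exact hT y (mem_inter.2 ⟨hIB hy, hcls hr.2 hyl hry⟩) hyT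
        · exact (hLm.1 hy).2 hyl
      have htri : ∀ a ∈ insert r (I ∪ L ∪ Gr.filter (· ∉ T)),
          ∀ y ∈ insert r (I ∪ L ∪ Gr.filter (· ∉ T)), a ∈ T → G.Adj r a → G.Adj r y →
          ¬ G.Adj a y := by
        intro a ha y hy haT hra hry hay
        have hah : ¬ Low G I a := fun h => hmemT a ha hra h haT
        have haL := hmemL a ha hah
        have hyl : Low G I y := by
          by_contra h
          exact hay.ne (hLeq a haL y (hmemL y hy h))
        exact hno a haL haT hra.symm y (mem_inter.2 ⟨hmem y hy hry.ne', hcls hr.2 hyl hry⟩) hay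
      refine (tBip_iff_local hG hI (by omega) hIT (fun i hi => by simp [hi])).2 ⟨?_, ?_, ?_⟩
      · intro u hu v hv huh hvh
        rw [hLeq u (hmemL u hu huh) v (hmemL v hv hvh)]
        exact G.irrefl
      · intro a ha b hb d hd haT hab hbd hda
        have h1 : a ≠ r := by rintro rfl; exact hrT haT
        by_cases h2 : b = r
        · subst h2; exact htri a ha d hd haT hab.symm hbd hda.symm
        by_cases h3 : d = r
        · subst h3; exact htri a ha b hb haT hda hbd.symm hab
        exact g2 a (hmem a ha h1) b (hmem b hb h2) d (hmem d hd h3) haT hab hbd hda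
      · intro q _ q' _ u hu v hv _ _ huh hvh _ _ _
        exact hLeq u (hmemL u hu huh) v (hmemL v hv hvh)
    by_cases hsub : B ∩ lowClass G I x ⊆ Gr
    · exact card_le_card fun y hy => mem_inter.2 ⟨hsub hy, (mem_inter.1 hy).2⟩
    obtain ⟨r, hr, hrG⟩ := not_subset.1 hsub
    obtain ⟨u, huL, huT, hur, y, hy, huy⟩ := key r hr hrG
    have hr' := mem_inter.1 hr
    have hy' := mem_inter.1 hy
    have hyr : y ≠ r := by rintro rfl; exact hrG hy'.1
    have huB := (hLm.1 huL).1
    have hyB : y ∉ B := fun h => b2 u huB r hr'.1 y h huT hur (hadj hr'.2 hy'.2 hyr.symm) huy.symm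
    -- Exchange r for y. The triangle u r y puts y outside B, and a second vertex of B missing from
    -- `Gr` in this class would form a triangle with u and r.
    have hle : (insert y ((B ∩ lowClass G I x).erase r)).card ≤ (Gr ∩ lowClass G I x).card := by
      refine card_le_card fun w hw => ?_
      rcases mem_insert.1 hw with rfl | hw
      · exact hy
      have hwr := ne_of_mem_erase hw
      have hwm := mem_of_mem_erase hw
      have hw' := mem_inter.1 hwm
      refine mem_inter.2 ⟨?_, hw'.2⟩
      by_contra hwG
      obtain ⟨v, hvL, -, hvw, -⟩ := key w hwm hwG
      have := hLeq v hvL u huL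
      subst this
      exact b2 v huB r hr'.1 w hw'.1 huT hur (hadj hr'.2 hw'.2 hwr.symm) hvw.symm
    rw [card_insert_of_notMem (fun h => hyB (mem_inter.1 (mem_of_mem_erase h)).1),
      card_erase_of_mem hr] at hle
    have := card_pos.2 ⟨r, hr⟩
    omega

/-- Optimality of the greedy extension of a kernel that anchors all edges of low vertices. -/
lemma KernelSetting.card_le_card {Gr K F L₀ : Finset V} (c : KernelSetting s G I T B Gr K F L₀)
    (hanc : ∀ x, Low G I x → 1 < (B ∩ lowClass G I x).card → ∃ q₁ ∈ K, ∃ q₂ ∈ K,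
      q₁ ∈ lowClass G I x ∧ q₂ ∈ lowClass G I x ∧ G.Adj q₁ q₂ ∧ Anchored G I B L₀ q₁ q₂)
    (hF : (∀ v ∈ B, ¬ Low G I v → v ∈ L₀) ∨ (F = ∅ ∧ s + 3 ≤ L₀.card)) : B.card ≤ Gr.card := by
  obtain ⟨b1, b2, b3⟩ := c.localB
  obtain ⟨g1, g2, g3⟩ := c.localGr
  have hG := c.sFree
  have hI := c.indep
  have hcard' := c.card_le'
  let D := B.filter fun l => ¬ Low G I l ∧ l ∉ Gr
  have hDm : ∀ l ∈ D, l ∈ B ∧ ¬ Low G I l ∧ l ∉ Gr := fun l hl => by simpa [D] using hl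
  -- If all high vertices of B are in L₀, then none is missing; so a missing one puts the argument
  -- in the case of a large L₀.
  have hDL : ∀ l ∈ D, F = ∅ ∧ s + 3 ≤ L₀.card := fun l hl =>
    hF.resolve_left fun h => (hDm l hl).2.2 (c.anchorGr (h l (hDm l hl).1 (hDm l hl).2.1))
  -- Members of `D₁` are paid for by high blockers, which lie outside B. Members of `D₂` are paid
  -- for by low blockers in distinct classes, where `Gr` has at least two vertices and B at most
  -- one.
  let D₁ := D.filter fun l => ∃ l' ∈ Gr, ¬ Low G I l' ∧ G.Adj l l'
  let D₂ := D.filter fun l => ¬ ∃ l' ∈ Gr, ¬ Low G I l' ∧ G.Adj l l'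
  have hD12 : D₁.card + D₂.card = D.card := card_filter_add_card_filter_not _
  have h₁ : ∀ l : V, ∃ l', l ∈ D₁ → l' ∈ Gr ∧ ¬ Low G I l' ∧ G.Adj l l' := by
    intro l
    by_cases h : l ∈ D₁
    · obtain ⟨l', hl'⟩ := (mem_filter.1 h).2
      exact ⟨l', fun _ => hl'⟩
    · exact ⟨l, fun h' => absurd h' h⟩
  choose l' hl' using h₁
  have h₂ : ∀ l : V, ∃ q, l ∈ D₂ → q ∈ Gr ∧ Low G I q ∧ G.Adj l q ∧ (∀ a ∈ L₀, ¬ G.Adj q a) ∧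
        ∃ q' ∈ Gr, Low G I q' ∧ G.Adj q q' := by
    intro l
    by_cases h : l ∈ D₂
    · obtain ⟨hlD, hno⟩ := mem_filter.1 h
      obtain ⟨hlB, hlh, hlG⟩ := hDm l hlD
      obtain ⟨q, hq⟩ := (c.exists_blocker hlB hlh hlG ((hDL l hlD).1 ▸ low_empty l)
        (hDL l hlD).2).resolve_left hno
      exact ⟨q, fun _ => hq⟩
    · exact ⟨l, fun h' => absurd h' h⟩
  choose q hq using h₂
  have hD₁ : ∀ l ∈ D₁, l ∈ D := fun l hl => (mem_filter.1 hl).1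
  have hD₂ : ∀ l ∈ D₂, l ∈ D := fun l hl => (mem_filter.1 hl).1
  have hcls := fun {x a b} (hx : Low G I x) => mem_lowClass_of_adj (a := a) (b := b) hG hI hcard' hx
  have hadj := fun {x a b} (hx : Low G I x) => adj_of_mem_lowClass (a := a) (b := b) hG hI hcard' hx
  refine card_le_of_low_high (I := I) (D := D₂) (G := G)
    (card_low_add_le hG hI hcard' (q := q) (fun d hd => (hq d hd).2.1) ?_ ?_ ?_) ?_
  · intro d hd d' hd' hdd
    obtain ⟨-, hql, hdq, hqL, -⟩ := hq d hd
    obtain ⟨-, hql', hdq', hqL', -⟩ := hq d' hd'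
    obtain ⟨hdB, hdh, -⟩ := hDm d (hD₂ d hd)
    obtain ⟨hdB', hdh', -⟩ := hDm d' (hD₂ d' hd')
    exact c.eq_of_adj_blockers (hDL d (hD₂ d hd)).2 hdB hdh hdB' hdh' hdq hdq' hqL hqL' hql' hdd
  · rintro x hx ⟨d, hd, hdx⟩
    obtain ⟨hqG, hql, hdq, hqL, q', hqG', hql', hqq⟩ := hq d hd
    obtain ⟨hdB, hdh, -⟩ := hDm d (hD₂ d hd)
    by_cases h1 : 1 < (B ∩ lowClass G I x).card
    · exfalso
      obtain ⟨q₁, h₁K, q₂, h₂K, h₁x, h₂x, h₁₂, ha⟩ := hanc x hx h1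
      refine c.not_blocker_of_anchored (hDL d (hD₂ d hd)).2 hdB hdh hql hdq hqL h₁K h₂K
        (mem_lowClass.1 h₁x).1 (mem_lowClass.1 h₂x).1 h₁₂ ha ?_
      by_cases hqq₁ : q d = q₁
      · exact Or.inl hqq₁
      · exact Or.inr (hadj hx h₁x hdx (Ne.symm hqq₁))
    · have : 1 < (Gr ∩ lowClass G I x).card := one_lt_card.2 ⟨q d, mem_inter.2 ⟨hqG, hdx⟩, q',
        mem_inter.2 ⟨hqG', hcls hx hdx hql' hqq⟩, hqq.ne⟩
      omega
  · intro x hx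
    by_cases h1 : 1 < (B ∩ lowClass G I x).card
    · obtain ⟨q₁, h₁K, q₂, h₂K, h₁x, h₂x, h₁₂, ha⟩ := hanc x hx h1
      refine Finset.card_le_card fun r hr => ?_
      obtain ⟨hrB, hrx⟩ := mem_inter.1 hr
      refine mem_inter.2 ⟨?_, hrx⟩
      by_cases hr1 : r = q₁
      · exact hr1 ▸ c.greedy.sub h₁K
      by_cases hr2 : r = q₂
      · exact hr2 ▸ c.greedy.sub h₂K
      exact c.mem_of_anchored h₁K h₂K (mem_lowClass.1 h₁x).1 (mem_lowClass.1 h₂x).1 h₁₂ ha hrB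
        (mem_lowClass.1 hrx).1 (hadj hx h₁x hrx (Ne.symm hr1)) (hadj hx h₂x hrx (Ne.symm hr2))
    · obtain ⟨y, hyG, hyl, hyx⟩ := c.exists_mem_class hx
      have := card_pos.2 ⟨y, mem_inter.2 ⟨hyG, mem_lowClass.2 ⟨hyl, hyx⟩⟩⟩
      omega
  · have hsplit : (B.filter fun v => ¬ Low G I v) ⊆
        (B.filter fun v => ¬ Low G I v ∧ v ∈ Gr) ∪ D := by
      intro v hv
      simp only [mem_filter, mem_union, D] at hv ⊢
      tauto
    have h3 := Finset.card_le_card hsplit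
    have h4 := card_union_le (B.filter fun v => ¬ Low G I v ∧ v ∈ Gr) D
    have h5 : (D₁.image l').card = D₁.card := by
      refine card_image_of_injOn fun d hd d' hd' hdd => ?_
      obtain ⟨hlG, hlh, hdl⟩ := hl' d hd
      obtain ⟨-, -, hdl'⟩ := hl' d' hd'
      obtain ⟨hdB, hdh, -⟩ := hDm d (hD₁ d hd)
      obtain ⟨hdB', hdh', -⟩ := hDm d' (hD₁ d' hd')
      refine c.eq_of_common_blocker (hDL d (hD₁ d hd)).2 hdB hdh hdB' hdh' hdl
        (by rwa [hdd]) ?_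
      exact fun a ha => g1 _ hlG a (c.anchorGr ha) hlh (c.anchor_high a ha)
    have h6 : Disjoint (B.filter fun v => ¬ Low G I v ∧ v ∈ Gr) (D₁.image l') := by
      rw [disjoint_left]
      intro v hv hv'
      obtain ⟨d, hd, rfl⟩ := mem_image.1 hv'
      obtain ⟨hlG, hlh, hdl⟩ := hl' d hd
      obtain ⟨hdB, hdh, -⟩ := hDm d (hD₁ d hd)
      exact b1 d hdB _ (mem_filter.1 hv).1 hdh hlh hdl
    have h7 : (B.filter fun v => ¬ Low G I v ∧ v ∈ Gr) ∪ D₁.image l' ⊆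
        Gr.filter fun v => ¬ Low G I v := by
      intro v hv
      rcases mem_union.1 hv with hv | hv
      · simp only [mem_filter] at hv ⊢
        tauto
      · obtain ⟨d, hd, rfl⟩ := mem_image.1 hv
        exact mem_filter.2 ⟨(hl' d hd).1, (hl' d hd).2.1⟩
    have h8 := Finset.card_le_card h7
    rw [card_union_of_disjoint h6] at h8
    omega

/-- A bounded kernel for sets with at least two high vertices. -/
lemma exists_kernel_of_two_high (hG : SFree s G) (hI : Indep G I) (hcard : I.card = 4 * s + 8)
    (hIT : I ⊆ T) (hIB : I ⊆ B) (hB : TBip G T B)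
    (hL : 1 < (B.filter fun v => ¬ Low G I v).card) :
    ∃ K F : Finset V, K.card ≤ 10 * s + 11 ∧ F.card ≤ 4 * s + 8 ∧ K ⊆ B ∧
      ∀ Gr, GreedyExt G T K F Gr → B.card ≤ Gr.card := by
  obtain ⟨u, hu, v, hv, huv⟩ := one_lt_card.1 hL
  set L := B.filter fun v => ¬ Low G I v with hLdef
  have hLm : ∀ {v}, v ∈ L ↔ v ∈ B ∧ ¬ Low G I v := by simp [hLdef]
  have hcard' : s + 6 ≤ I.card := by omega
  have : Nonempty V := ⟨u⟩
  let N := ((univ.filter (Low G I)).image (lowClass G I)).filter fun Q => 1 < (B ∩ Q).card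
  have hN : ∀ Q ∈ N, ∃ x, Low G I x ∧ lowClass G I x = Q ∧ 1 < (B ∩ Q).card := by
    intro Q hQ
    obtain ⟨hQ, hc⟩ := mem_filter.1 hQ
    obtain ⟨x, hx, hxQ⟩ := mem_image.1 hQ
    exact ⟨x, (mem_filter.1 hx).2, hxQ, hc⟩
  have hex : ∀ Q ∈ N, ∃ q₁ q₂ : V, ∃ W : Finset V, (q₁ ∈ B ∧ Low G I q₁) ∧ (q₂ ∈ B ∧ Low G I q₂) ∧
      G.Adj q₁ q₂ ∧ q₁ ∈ Q ∧ q₂ ∈ Q ∧ W ⊆ L ∧ W.card ≤ 1 ∧ Anchored G I B W q₁ q₂ := by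
    intro Q hQ
    obtain ⟨x, hx, rfl, hc⟩ := hN Q hQ
    obtain ⟨a, ha, b, hb, hab⟩ := one_lt_card.1 hc
    rw [mem_inter] at ha hb
    have hal := (mem_lowClass.1 ha.2).1
    obtain ⟨q₁, h₁B, q₂, h₂B, W, hWB, hW1, hWh, h₁, h₂, h₁₂, hq₁, hanc⟩ :=
      exists_anchored hG hI hcard.ge hIT hIB hB ha.1 hb.1 hal
      (mem_lowClass.1 hb.2).1 (adj_of_mem_lowClass hG hI hcard' hx ha.2 hb.2 hab)
    have hq₁x : q₁ ∈ lowClass G I x := by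
      rcases hq₁ with rfl | h
      exacts [ha.2, mem_lowClass_of_adj hG hI hcard' hx ha.2 h₁ h]
    exact ⟨q₁, q₂, W, ⟨h₁B, h₁⟩, ⟨h₂B, h₂⟩, h₁₂, hq₁x,
      mem_lowClass_of_adj hG hI hcard' hx hq₁x h₂ h₁₂, fun w hw => hLm.2 ⟨hWB hw, hWh w hw⟩,
      hW1, hanc⟩
  choose! p q W hp hq hpq hpQ hqQ hWL hW1 hanc using hex
  -- The classes contribute one edge each and are mutually anticomplete, so the two high vertices u
  -- and v bound their number.
  have hNcard : N.card ≤ 2 * s := by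
    refine card_low_edges_le hG hI hcard.ge hIT hIB hB hp hq hpq ?_ (hLm.1 hu).1 (hLm.1 hv).1
      (hLm.1 hu).2 (hLm.1 hv).2 huv
    intro Q hQ Q' hQ' hne a ha b hb
    have haQ : a ∈ Q := by
      rcases ha with rfl | rfl
      exacts [hpQ Q hQ, hqQ Q hQ]
    have hbQ : b ∈ Q' := by
      rcases hb with rfl | rfl
      exacts [hpQ Q' hQ', hqQ Q' hQ']
    obtain ⟨x, hx, rfl, -⟩ := hN Q hQ
    obtain ⟨x', hx', rfl, -⟩ := hN Q' hQ'
    have hbl := (mem_lowClass.1 hbQ).1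
    have key : b ∉ lowClass G I x := fun h => hne
      (((lowClass_eq hG hI hcard' hx hbl).2 h).symm.trans ((lowClass_eq hG hI hcard' hx' hbl).2 hbQ))
    exact ⟨fun h => key (h ▸ haQ), fun h => key (mem_lowClass_of_adj hG hI hcard' hx haQ hbl h)⟩
  have hWcard : (N.biUnion W).card ≤ 2 * s :=
    (card_biUnion_le_card_mul N W 1 hW1).trans (by omega)
  have hWsub : N.biUnion W ⊆ L := biUnion_subset.2 hWL
  -- The kernel has at most 4s + 8 vertices from `I`, 2s + 3 from L₀ and 2s for each of the two edge
  -- ends: 10s + 11 in total.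
  have main : ∀ L₀ F : Finset V, N.biUnion W ⊆ L₀ → L₀ ⊆ L → L₀.card ≤ 2 * s + 3 →
      F.card ≤ 4 * s + 8 → ((F = I ∧ L₀ = L) ∨ (F = ∅ ∧ s + 3 ≤ L₀.card)) →
      ∃ K F : Finset V, K.card ≤ 10 * s + 11 ∧ F.card ≤ 4 * s + 8 ∧ K ⊆ B ∧
        ∀ Gr, GreedyExt G T K F Gr → B.card ≤ Gr.card := by
    intro L₀ F hWL₀ hL₀ hL₀card hFcard hF
    refine ⟨I ∪ L₀ ∪ N.image p ∪ N.image q, F, ?_, hFcard, ?_, ?_⟩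
    · have h1 := card_union_le (I ∪ L₀ ∪ N.image p) (N.image q)
      have h2 := card_union_le (I ∪ L₀) (N.image p)
      have h3 := card_union_le I L₀
      have h4 : (N.image p).card ≤ N.card := card_image_le
      have h5 : (N.image q).card ≤ N.card := card_image_le
      omega
    · intro y hy
      simp only [mem_union, mem_image] at hy
      rcases hy with ((hy | hy) | ⟨Q, hQ, rfl⟩) | ⟨Q, hQ, rfl⟩
      exacts [hIB hy, (hLm.1 (hL₀ hy)).1, (hp Q hQ).1, (hq Q hQ).1]
    · intro Gr hGr
      have c : KernelSetting s G I T B Gr (I ∪ L₀ ∪ N.image p ∪ N.image q) F L₀ := by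
        refine ⟨hG, hI, hcard.ge, hIT, fun i hi => by simp [hi], ?_, hB, hGr, ?_,
          fun w hw => by simp [hw], fun w hw => (hLm.1 (hL₀ hw)).2, ?_⟩
        · intro y hy
          simp only [mem_union, mem_image] at hy
          rcases hy with ((hy | hy) | ⟨Q, hQ, rfl⟩) | ⟨Q, hQ, rfl⟩
          exacts [hIB hy, (hLm.1 (hL₀ hy)).1, (hp Q hQ).1, (hq Q hQ).1]
        · rcases hF with ⟨rfl, -⟩ | ⟨rfl, -⟩
          exacts [fun _ h => h, fun v _ => low_empty v]
        · rcases hF with ⟨rfl, -⟩ | ⟨-, h⟩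
          · left
            intro v hv hvh
            by_contra hvL
            refine hvh (hGr.low v hv fun h => ?_)
            simp only [mem_union, mem_image] at h
            rcases h with ((h | h) | ⟨Q, hQ, rfl⟩) | ⟨Q, hQ, rfl⟩
            exacts [hvh (hI.low h), hvL h, hvh (hp Q hQ).2, hvh (hq Q hQ).2]
          · exact Or.inr h
      refine c.card_le_card ?_ ?_
      · intro x hx hc
        have hQ : lowClass G I x ∈ N := mem_filter.2 ⟨mem_image_of_mem _ (by simp [hx]), hc⟩
        refine ⟨p (lowClass G I x), ?_, q (lowClass G I x), ?_, hpQ _ hQ, hqQ _ hQ, hpq _ hQ,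
          (hanc _ hQ).mono ((subset_biUnion_of_mem W hQ).trans hWL₀)⟩
        · exact mem_union_left _ (mem_union_right _ (mem_image_of_mem p hQ))
        · exact mem_union_right _ (mem_image_of_mem q hQ)
      · rcases hF with ⟨-, rfl⟩ | h
        · exact Or.inl fun v hv hvh => hLm.2 ⟨hv, hvh⟩
        · exact Or.inr h
  -- If there are few high vertices, all are recorded and F = `I` bars others. Otherwise 2s + 3 of
  -- them, including the at most 2s anchors, suffice for `adj_of_anti`, and F is empty.
  by_cases hLc : L.card ≤ 2 * s + 3
  · exact main L I hWsub subset_rfl hLc hcard.le (Or.inl ⟨rfl, rfl⟩)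
  · obtain ⟨L₀, h1, h2, h3⟩ := exists_subsuperset_card_eq hWsub (n := 2 * s + 3) (by omega) (by omega)
    exact main L₀ ∅ h1 h2 h3.le (by simp) (Or.inr ⟨rfl, by omega⟩)

end Optimal

/-- For every instance there are a kernel `K` and a set `F` of bounded size all of whose greedy
extensions are maximum sets without odd `T`-cycles. -/
theorem exists_kernel (s : ℕ) : ∃ c, ∀ {V : Type} [Fintype V] [DecidableEq V] (G : SimpleGraph V)
    (T : Finset V), SFree s G → ∃ K F : Finset V, K.card ≤ c ∧ F.card ≤ c ∧ TBip G T K ∧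
      ∀ Gr, GreedyExt G T K F Gr → ∀ B, TBip G T B → B.card ≤ Gr.card := by
  obtain ⟨f, hf⟩ := exists_short_oddTCycle s
  obtain ⟨k, hk⟩ := exists_ramsey 3 (4 * s + 8)
  refine ⟨(k + k * f) + (10 * s + 11), fun {V} _ _ G T hG => ?_⟩
  obtain ⟨B, hBm, hmax⟩ := exists_max_image (univ.filter fun B : Finset V => TBip G T B) card
    ⟨∅, by simpa using tBip_of_disjoint (by simp)⟩
  simp only [mem_filter, mem_univ, true_and] at hBm hmax
  suffices h : ∃ K F : Finset V, K.card ≤ (k + k * f) + (10 * s + 11) ∧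
      F.card ≤ (k + k * f) + (10 * s + 11) ∧ K ⊆ B ∧ ∀ Gr, GreedyExt G T K F Gr → B.card ≤ Gr.card by
    obtain ⟨K, F, hK, hF, hKB, h⟩ := h
    exact ⟨K, F, hK, hF, hBm.mono hKB, fun Gr hGr B' hB' => (hmax B' hB').trans (h Gr hGr)⟩
  by_cases hcard : (B.filter (· ∈ T)).card ≤ k
  · obtain ⟨K, hK, hKB, h⟩ := exists_kernel_of_few (fun B' hB' => hf hG hB') hBm hmax hcard
    exact ⟨K, ∅, by omega, by simp, hKB, fun Gr hGr => card_le_card (h Gr hGr)⟩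
  -- Three pairwise adjacent terminals in B would form an odd T-cycle, so Ramsey's theorem yields
  -- the independent set.
  rcases hk G (B.filter (· ∈ T)) (by omega) with ⟨K, hK, hK3, hcl⟩ | ⟨I, hIs, hI, hind⟩
  · exfalso
    obtain ⟨x, y, z, hxy, hxz, hyz, rfl⟩ := card_eq_three.1 hK3
    have hm : ∀ w ∈ ({x, y, z} : Finset V), w ∈ B ∧ w ∈ T := fun w hw => mem_filter.1 (hK hw)
    obtain ⟨w, hw, hwB⟩ := hBm [x, y, z] (oddTCycle_cons_iff.2 ⟨by simp [hxy, hxz, hyz],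
      by simp [hcl x (by simp) y (by simp) hxy, hcl y (by simp) z (by simp) hyz,
        hcl z (by simp) x (by simp) hxz.symm], by simp; decide, x, (hm x (by simp)).2, by simp⟩)
    exact hwB (hm w (by simpa using hw)).1
  have hIT : I ⊆ T := fun i hi => (mem_filter.1 (hIs hi)).2
  have hIB : I ⊆ B := fun i hi => (mem_filter.1 (hIs hi)).1
  by_cases hL : (B.filter fun v => ¬ Low G I v).card ≤ 1
  · refine ⟨I ∪ B.filter fun v => ¬ Low G I v, I, ?_, by omega, union_subset hIB (filter_subset _ _),
      fun Gr hGr => card_le_of_high_le_one hG hind hI.ge hIT hIB hBm hL hGr⟩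
    have := card_union_le I (B.filter fun v => ¬ Low G I v)
    omega
  · obtain ⟨K, F, hK, hF, hKB, h⟩ :=
      exists_kernel_of_two_high hG hind hI hIT hIB hBm (by omega)
    exact ⟨K, F, by omega, by omega, hKB, h⟩

end SubsetOCT

namespace SubsetOCT

/-! ### Bounded-loop programs and their running time -/

section Structured

/-- Structured programs: the only loops are `for x in [0, n + b)`, where `n` is the content of
register `0`. -/
inductive FProg where
  | skip
  | assign (x : ℕ) (e : Exp)
  | store (a : ℕ) (i e : Exp)
  | seq (P Q : FProg)
  | ite (e : Exp) (P Q : FProg)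
  | loop (x b : ℕ) (P : FProg)

namespace FProg

/-- Translation into programs. -/
def compile : FProg → Prog
  | skip => .skip
  | assign x e => .assign x e
  | store a i e => .store a i e
  | seq P Q => .seq P.compile Q.compile
  | ite e P Q => .cond e P.compile Q.compile
  | loop x b P => .seq (.assign x (.const 0)) (.loop (.sub (.add (.reg 0) (.const b)) (.reg x))
      (.seq P.compile (.assign x (.add (.reg x) (.const 1)))))

/-- The final memory. -/
def eval : FProg → Memory → Memory
  | skip, σ => σ
  | assign x e, σ => σ.setReg x (e.eval σ)
  | store a i e, σ => σ.setCell a (i.eval σ) (e.eval σ)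
  | seq P Q, σ => Q.eval (P.eval σ)
  | ite e P Q, σ => if e.eval σ = 0 then Q.eval σ else P.eval σ
  | loop x b P, σ =>
      (fun τ => (P.eval τ).setReg x ((P.eval τ).reg x + 1))^[σ.reg 0 + b] (σ.setReg x 0)

/-- The registers that a program may change. -/
def regs : FProg → Set ℕ
  | skip => ∅
  | assign x _ => {x}
  | store _ _ _ => ∅
  | seq P Q => P.regs ∪ Q.regs
  | ite _ P Q => P.regs ∪ Q.regs
  | loop x _ P => insert x P.regs

/-- The arrays that a program may change. -/
def arrs : FProg → Set ℕ
  | skip => ∅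
  | assign _ _ => ∅
  | store a _ _ => {a}
  | seq P Q => P.arrs ∪ Q.arrs
  | ite _ P Q => P.arrs ∪ Q.arrs
  | loop _ _ P => P.arrs

/-- Loop bodies change neither their loop counter nor register `0`. -/
def WF : FProg → Prop
  | skip => True
  | assign _ _ => True
  | store _ _ _ => True
  | seq P Q => P.WF ∧ Q.WF
  | ite _ P Q => P.WF ∧ Q.WF
  | loop x _ P => x ≠ 0 ∧ x ∉ P.regs ∧ 0 ∉ P.regs ∧ P.WF

open Polynomial in
/-- A polynomial bound for the running time in terms of register `0`. -/
noncomputable def bound : FProg → Polynomial ℕ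
  | skip => 1
  | assign _ e => C (e.cost + 1)
  | store _ i e => C (i.cost + e.cost + 1)
  | seq P Q => P.bound + Q.bound
  | ite e P Q => C (e.cost + 1) + P.bound + Q.bound
  -- Besides the body, a round costs 6 for the test and 4 for the increment. The initial assignment
  -- costs 2 and the final failing test 6.
  | loop _ b P => (X + C b) * (P.bound + C 10) + C 8

end FProg

lemma Memory.setReg_reg_self (σ : Memory) (x v : ℕ) : (σ.setReg x v).reg x = v := by
  simp [Memory.setReg]

lemma Memory.setReg_reg_of_ne (σ : Memory) {x y : ℕ} (v : ℕ) (h : y ≠ x) :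
    (σ.setReg x v).reg y = σ.reg y := by
  simp [Memory.setReg, h]

lemma Memory.setReg_arr (σ : Memory) (x v : ℕ) : (σ.setReg x v).arr = σ.arr := rfl

lemma Memory.setCell_reg (σ : Memory) (a i v : ℕ) : (σ.setCell a i v).reg = σ.reg := rfl

lemma Memory.setCell_arr_self (σ : Memory) (a i v j : ℕ) :
    (σ.setCell a i v).arr a j = if j = i then v else σ.arr a j := by
  simp [Memory.setCell, Function.update_apply]

lemma Memory.setCell_arr_of_ne (σ : Memory) {a b : ℕ} (i v : ℕ) (h : b ≠ a) :
    (σ.setCell a i v).arr b = σ.arr b := by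
  simp [Memory.setCell, h]

namespace FProg

lemma eval_reg {y : ℕ} : ∀ {P : FProg} (σ : Memory), y ∉ P.regs → (P.eval σ).reg y = σ.reg y
  | skip, _, _ => rfl
  | assign x e, σ, h => Memory.setReg_reg_of_ne _ _ (by simpa [regs] using h)
  | store _ _ _, _, _ => rfl
  | seq P Q, σ, h => by
    simp only [regs, Set.mem_union, not_or] at h
    rw [eval, eval_reg _ h.2, eval_reg _ h.1]
  | ite e P Q, σ, h => by
    simp only [regs, Set.mem_union, not_or] at h
    rw [eval]
    split_ifs
    exacts [eval_reg _ h.2, eval_reg _ h.1]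
  | loop x b P, σ, h => by
    simp only [regs, Set.mem_insert_iff, not_or] at h
    rw [eval]
    generalize σ.reg 0 + b = N
    induction N with
    | zero => exact Memory.setReg_reg_of_ne _ _ h.1
    | succ N ih =>
      rw [Function.iterate_succ_apply', Memory.setReg_reg_of_ne _ _ h.1, eval_reg _ h.2, ih]

lemma eval_arr {a : ℕ} : ∀ {P : FProg} (σ : Memory), a ∉ P.arrs → (P.eval σ).arr a = σ.arr a
  | skip, _, _ => rfl
  | assign x e, σ, h => rfl
  | store _ _ _, _, h => Memory.setCell_arr_of_ne _ _ _ (by simpa [arrs] using h)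
  | seq P Q, σ, h => by
    simp only [arrs, Set.mem_union, not_or] at h
    rw [eval, eval_arr _ h.2, eval_arr _ h.1]
  | ite e P Q, σ, h => by
    simp only [arrs, Set.mem_union, not_or] at h
    rw [eval]
    split_ifs
    exacts [eval_arr _ h.2, eval_arr _ h.1]
  | loop x b P, σ, h => by
    simp only [arrs] at h
    rw [eval]
    generalize σ.reg 0 + b = N
    induction N with
    | zero => rfl
    | succ N ih => rw [Function.iterate_succ_apply', Memory.setReg_arr, eval_arr _ h, ih]

/-- Here j counts the rounds still to run. The body changes neither register `0` nor the counter, so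
the same bound B applies in every round. -/
lemma run_loop {x b : ℕ} {P : FProg} {n B : ℕ} (hx0 : x ≠ 0) (hx : x ∉ P.regs) (h0 : 0 ∉ P.regs)
    (hP : ∀ σ : Memory, σ.reg 0 = n → ∃ t, Run P.compile σ (P.eval σ) t ∧ t ≤ B) (j : ℕ) :
    ∀ τ : Memory, τ.reg 0 = n → τ.reg x + j = n + b →
      ∃ t, Run (.loop (.sub (.add (.reg 0) (.const b)) (.reg x))
        (.seq P.compile (.assign x (.add (.reg x) (.const 1))))) τ
        ((fun τ => (P.eval τ).setReg x ((P.eval τ).reg x + 1))^[j] τ) t ∧ t ≤ j * (B + 10) + 6 := by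
  induction j with
  | zero =>
    intro τ h1 h2
    refine ⟨_, Run.loop_false ?_, ?_⟩
    · simp only [Exp.eval]
      omega
    · simp [Exp.cost]
  | succ j ih =>
    intro τ h1 h2
    obtain ⟨t, ht, htB⟩ := hP τ h1
    have hr0 : (P.eval τ).reg 0 = n := by rw [eval_reg _ h0, h1]
    have hrx : (P.eval τ).reg x = τ.reg x := eval_reg _ hx
    obtain ⟨t', ht', htB'⟩ := ih ((P.eval τ).setReg x ((P.eval τ).reg x + 1))
      (by rw [Memory.setReg_reg_of_ne _ _ hx0.symm, hr0])
      (by rw [Memory.setReg_reg_self, hrx]; omega)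
    refine ⟨_, Run.loop_true (t' := t') ?_ (Run.seq ht (Run.assign _ _ _)) ht', ?_⟩
    · simp only [Exp.eval]
      omega
    · simp only [Exp.cost]
      nlinarith

/-- The time bound depends on the memory only through register `0`, which no subprogram changes, so
bounds of parts compose as polynomials in the same n. -/
lemma exists_run : ∀ {P : FProg} (_ : P.WF) (_ : 0 ∉ P.regs) (σ : Memory),
    ∃ t, Run P.compile σ (P.eval σ) t ∧ t ≤ P.bound.eval (σ.reg 0)
  | skip, _, _, σ => ⟨1, Run.skip σ, by simp [bound]⟩
  | assign x e, _, _, σ => ⟨_, Run.assign σ x e, by simp [bound]⟩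
  | store a i e, _, _, σ => ⟨_, Run.store σ a i e, by simp [bound]⟩
  | seq P Q, h, h0, σ => by
    simp only [regs, Set.mem_union, not_or] at h0
    obtain ⟨t, ht, hb⟩ := exists_run h.1 h0.1 σ
    obtain ⟨t', ht', hb'⟩ := exists_run h.2 h0.2 (P.eval σ)
    rw [eval_reg _ h0.1] at hb'
    refine ⟨_, Run.seq ht ht', ?_⟩
    rw [bound, Polynomial.eval_add]
    omega
  | ite e P Q, h, h0, σ => by
    simp only [regs, Set.mem_union, not_or] at h0
    rw [eval, bound, Polynomial.eval_add, Polynomial.eval_add, Polynomial.eval_C]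
    split_ifs with he
    · obtain ⟨t, ht, hb⟩ := exists_run h.2 h0.2 σ
      exact ⟨_, Run.cond_false he ht, by omega⟩
    · obtain ⟨t, ht, hb⟩ := exists_run h.1 h0.1 σ
      exact ⟨_, Run.cond_true he ht, by omega⟩
  | loop x b P, h, h0, σ => by
    obtain ⟨hx0, hx, h0', hP⟩ := h
    obtain ⟨t, ht, hb⟩ := run_loop (b := b) (n := σ.reg 0) (B := P.bound.eval (σ.reg 0)) hx0 hx h0'
      (fun τ hτ => hτ ▸ exists_run hP h0' τ) (σ.reg 0 + b) (σ.setReg x 0)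
      (Memory.setReg_reg_of_ne _ _ hx0.symm) (by rw [Memory.setReg_reg_self]; omega)
    refine ⟨_, Run.seq (Run.assign _ _ _) ht, ?_⟩
    simp only [Exp.cost, bound, Polynomial.eval_add, Polynomial.eval_mul, Polynomial.eval_C,
      Polynomial.eval_X]
    omega

/-- The invariant rule for loops. -/
lemma loop_inv {x b : ℕ} {P : FProg} (hx : x ∉ P.regs) {σ : Memory}
    (Inv : ℕ → Memory → Prop) (h0 : Inv 0 (σ.setReg x 0))
    (hstep : ∀ k < σ.reg 0 + b, ∀ τ : Memory, τ.reg x = k →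
      (∀ y, y ≠ x → y ∉ P.regs → τ.reg y = σ.reg y) → (∀ a, a ∉ P.arrs → τ.arr a = σ.arr a) →
      Inv k τ → Inv (k + 1) ((P.eval τ).setReg x (k + 1))) :
    Inv (σ.reg 0 + b) ((loop x b P).eval σ) := by
  rw [eval]
  have key : ∀ N ≤ σ.reg 0 + b, ∀ τ : Memory,
      τ = (fun τ => (P.eval τ).setReg x ((P.eval τ).reg x + 1))^[N] (σ.setReg x 0) →
      τ.reg x = N ∧ (∀ y, y ≠ x → y ∉ P.regs → τ.reg y = σ.reg y) ∧
      (∀ a, a ∉ P.arrs → τ.arr a = σ.arr a) ∧ Inv N τ := by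
    intro N
    induction N with
    | zero =>
      rintro - τ rfl
      exact ⟨Memory.setReg_reg_self _ _ _, fun y hy _ => Memory.setReg_reg_of_ne _ _ hy,
        fun a _ => rfl, h0⟩
    | succ N ih =>
      rintro hN τ rfl
      obtain ⟨h1, h2, h3, h4⟩ := ih (by omega) _ rfl
      rw [Function.iterate_succ_apply']
      generalize (fun τ => (P.eval τ).setReg x ((P.eval τ).reg x + 1))^[N] (σ.setReg x 0) = τ at *
      have hrx : (P.eval τ).reg x = N := by rw [eval_reg _ hx, h1]
      rw [hrx]
      refine ⟨Memory.setReg_reg_self _ _ _, fun y hy hyP => ?_, fun a ha => ?_,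
        hstep N (by omega) τ h1 h2 h3 h4⟩
      · rw [Memory.setReg_reg_of_ne _ _ hy, eval_reg _ hyP, h2 y hy hyP]
      · rw [Memory.setReg_arr, eval_arr _ ha, h3 a ha]
  exact (key _ le_rfl _ rfl).2.2.2

/-- Nested loops over all tuples of numbers in `[0, n]`. -/
def nest : List ℕ → FProg → FProg
  | [], P => P
  | x :: ρ, P => .loop x 1 (nest ρ P)

lemma regs_nest {ρ : List ℕ} {P : FProg} : (nest ρ P).regs = {x | x ∈ ρ} ∪ P.regs := by
  induction ρ with
  | nil => simp [nest]
  | cons x ρ ih => ext y; simp [nest, regs, ih, or_assoc]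

lemma arrs_nest {ρ : List ℕ} {P : FProg} : (nest ρ P).arrs = P.arrs := by
  induction ρ with
  | nil => simp [nest]
  | cons x ρ ih => simp [nest, arrs, ih]

lemma wf_nest {ρ : List ℕ} {P : FProg} (hρ : ρ.Nodup) (h0 : 0 ∉ ρ) (hP : P.WF)
    (hdisj : ∀ x ∈ ρ, x ∉ P.regs) (h0P : 0 ∉ P.regs) : (nest ρ P).WF := by
  induction ρ with
  | nil => exact hP
  | cons x ρ ih =>
    simp only [List.mem_cons, not_or, List.nodup_cons, forall_eq_or_imp] at *
    refine ⟨Ne.symm h0.1, ?_, ?_, ih hρ.2 h0.2 hdisj.2⟩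
    · simp [regs_nest, hρ.1, hdisj.1]
    · simp [regs_nest, h0.2, h0P]

/-- The rule for nested loops: `J` is invariant, `R` is never lost, and `R` is achieved when the
body is executed for the tuple `w`. -/
lemma nest_visit {n : ℕ} {P : FProg} (R : Memory → Prop) (ρ : List ℕ) :
    ∀ (J : Memory → Prop), (∀ τ, J τ → τ.reg 0 = n) → (∀ τ, ∀ x ∈ ρ, ∀ v, J τ → J (τ.setReg x v)) →
      (∀ τ, ∀ x ∈ ρ, ∀ v, R τ → R (τ.setReg x v)) → ρ.Nodup → 0 ∉ ρ → (∀ x ∈ ρ, x ∉ P.regs) →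
      0 ∉ P.regs → (∀ τ, J τ → J (P.eval τ) ∧ (R τ → R (P.eval τ))) →
      ∀ σ, J σ → J ((nest ρ P).eval σ) ∧ (R σ → R ((nest ρ P).eval σ)) ∧
        ∀ w : List ℕ, w.length = ρ.length → (∀ v ∈ w, v ≤ n) →
          (∀ τ, J τ → ρ.map τ.reg = w → R (P.eval τ)) → R ((nest ρ P).eval σ) := by
  induction ρ with
  | nil =>
    intro J _ _ _ _ _ _ _ hbody σ hσ
    refine ⟨(hbody σ hσ).1, (hbody σ hσ).2, fun w hw _ h => h σ hσ ?_⟩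
    simpa using (List.length_eq_zero_iff.1 hw).symm
  | cons x ρ ih =>
    intro J hJ0 hJ hR hρ h0 hP h0P hbody σ hσ
    simp only [List.mem_cons, not_or, List.nodup_cons, forall_eq_or_imp] at hJ hR hρ h0 hP
    have hxn : x ∉ (nest ρ P).regs := by simp [regs_nest, hρ.1, hP.1]
    have hn : σ.reg 0 = n := hJ0 σ hσ
    have step : ∀ τ k, J τ → τ.reg x = k → J ((nest ρ P).eval τ) ∧ (R τ → R ((nest ρ P).eval τ)) ∧
        ∀ w : List ℕ, w.length = ρ.length → (∀ v ∈ w, v ≤ n) →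
          (∀ τ, J τ → τ.reg x = k → ρ.map τ.reg = w → R (P.eval τ)) → R ((nest ρ P).eval τ) := by
      intro τ k hτ hτx
      -- The inner loops are handled with the invariant strengthened by the current value k of the
      -- outer counter.
      obtain ⟨h1, h2, h3⟩ := ih (fun τ => J τ ∧ τ.reg x = k) (fun τ h => hJ0 τ h.1)
        (fun τ y hy v h => ⟨(hJ τ).2 y hy v h.1, by
          rw [Memory.setReg_reg_of_ne _ _ (by rintro rfl; exact hρ.1 hy), h.2]⟩)
        (fun τ => (hR τ).2) hρ.2 h0.2 hP.2 h0P
        (fun τ h => ⟨⟨(hbody τ h.1).1, by rw [eval_reg _ hP.1, h.2]⟩, (hbody τ h.1).2⟩)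
        τ ⟨hτ, hτx⟩
      exact ⟨h1.1, h2, fun w hw hwn h => h3 w hw hwn fun τ hτ => h τ hτ.1 hτ.2⟩
    refine ⟨?_, ?_, ?_⟩
    · refine loop_inv hxn (fun _ τ => J τ) ((hJ σ).1 0 hσ) ?_
      intro k hk τ hτx _ _ hτ
      exact (hJ _).1 _ (step τ k hτ hτx).1
    · intro hRσ
      refine (loop_inv hxn (fun _ τ => J τ ∧ R τ) ⟨(hJ σ).1 0 hσ, (hR σ).1 0 hRσ⟩ ?_).2
      intro k hk τ hτx _ _ hτ
      exact ⟨(hJ _).1 _ (step τ k hτ.1 hτx).1, (hR _).1 _ ((step τ k hτ.1 hτx).2.1 hτ.2)⟩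
    · intro w hw hwn hwR
      match w, hw with
      | v :: w, hw =>
        simp only [List.mem_cons, forall_eq_or_imp] at hwn
        -- `R` is achieved in round v and persists; before that round nothing is claimed about it.
        refine (loop_inv (b := 1) hxn (fun k τ => J τ ∧ (v < k → R τ))
          ⟨(hJ σ).1 0 hσ, by simp⟩ ?_).2 (by omega)
        intro k hk τ hτx _ _ hτ
        obtain ⟨h1, h2, h3⟩ := step τ k hτ.1 hτx
        refine ⟨(hJ _).1 _ h1, fun hvk => (hR _).1 _ ?_⟩
        by_cases hv : v < k
        · exact h2 (hτ.2 hv)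
        · obtain rfl : v = k := by omega
          refine h3 w (by simpa using hw) hwn.2 fun τ hτ hτx hτw => hwR τ hτ ?_
          simp [hτx, hτw]

/-- Execute `P` if all tests succeed. -/
def conj : List Exp → FProg → FProg
  | [], P => P
  | e :: es, P => .ite e (conj es P) .skip

lemma eval_conj_pos {es : List Exp} {P : FProg} {σ : Memory} (h : ∀ e ∈ es, e.eval σ ≠ 0) :
    (conj es P).eval σ = P.eval σ := by
  induction es with
  | nil => rfl
  | cons e es ih =>
    simp only [List.mem_cons, forall_eq_or_imp] at h
    rw [conj, eval, if_neg h.1, ih h.2]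

lemma eval_conj_neg {es : List Exp} {P : FProg} {σ : Memory} (h : ¬ ∀ e ∈ es, e.eval σ ≠ 0) :
    (conj es P).eval σ = σ := by
  induction es with
  | nil => simp at h
  | cons e es ih =>
    rw [conj, eval]
    split_ifs with he
    · rfl
    · refine ih fun h' => h ?_
      simpa using ⟨he, h'⟩

lemma regs_conj {es : List Exp} {P : FProg} : (conj es P).regs = P.regs := by
  induction es with
  | nil => rfl
  | cons e es ih => simp [conj, regs, ih]

lemma arrs_conj {es : List Exp} {P : FProg} : (conj es P).arrs = P.arrs := by
  induction es with
  | nil => rfl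
  | cons e es ih => simp [conj, arrs, ih]

lemma wf_conj {es : List Exp} {P : FProg} (h : P.WF) : (conj es P).WF := by
  induction es with
  | nil => exact h
  | cons e es ih => exact ⟨ih, trivial⟩

end FProg

end Structured

end SubsetOCT

namespace SubsetOCT

open FProg

/-! ### Representation of the instance in memory -/

section Memory

variable {n : ℕ} {G : SimpleGraph (Fin n)} {T : Finset (Fin n)} {σ τ : Memory}

/-- The memory contains the graph, the set of terminals, and the offsets of the rows of the
adjacency matrix. -/
structure Env (G : SimpleGraph (Fin n)) (T : Finset (Fin n)) (σ : Memory) : Prop where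
  size : σ.reg 0 = n
  adj : ∀ i j : Fin n, σ.arr 0 (i * n + j) ≠ 0 ↔ G.Adj i j
  terminal : ∀ i : Fin n, σ.arr 1 i ≠ 0 ↔ i ∈ T
  row : ∀ i : Fin n, σ.arr 3 i = i * n

lemma Env.congr (h : Env G T σ) (h0 : τ.reg 0 = σ.reg 0) (ha : ∀ a ∈ [0, 1, 3], τ.arr a = σ.arr a) :
    Env G T τ := by
  simp only [List.mem_cons, List.not_mem_nil, or_false, forall_eq_or_imp, forall_eq] at ha
  exact ⟨by rw [h0, h.size], by rw [ha.1]; exact h.adj, by rw [ha.2.1]; exact h.terminal,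
    by rw [ha.2.2]; exact h.row⟩

lemma Env.setReg (h : Env G T σ) {x : ℕ} (hx : x ≠ 0) (v : ℕ) : Env G T (σ.setReg x v) :=
  h.congr (Memory.setReg_reg_of_ne _ _ hx.symm) fun _ _ => rfl

lemma Env.eval (h : Env G T σ) {P : FProg} (h0 : 0 ∉ P.regs) (ha : ∀ a ∈ [0, 1, 3], a ∉ P.arrs) :
    Env G T (P.eval σ) :=
  h.congr (FProg.eval_reg _ h0) fun a h => FProg.eval_arr _ (ha a h)

/-- The array `A` represents the set `C`. -/
def Holds (A : ℕ → ℕ) (C : Finset (Fin n)) : Prop := ∀ i : Fin n, A i ≠ 0 ↔ i ∈ C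

/-- The test whether the vertices in registers `x` and `y` are adjacent. -/
def adjExp (x y : ℕ) : Exp := .cell 0 (.add (.cell 3 (.reg x)) (.reg y))

lemma Env.adjExp_ne_zero (h : Env G T σ) {x y : ℕ} {i j : Fin n} (hx : σ.reg x = i)
    (hy : σ.reg y = j) : (adjExp x y).eval σ ≠ 0 ↔ G.Adj i j := by
  simp only [adjExp, Exp.eval, hx, hy, h.row]
  exact h.adj i j

end Memory

/-! ### Searching for short odd T-cycles -/

section Check

variable {n : ℕ} {G : SimpleGraph (Fin n)} {T C : Finset (Fin n)} {σ : Memory}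

/-- Tests that consecutive vertices are adjacent. -/
def chainTests : List ℕ → List Exp
  | x :: y :: l => adjExp x y :: chainTests (y :: l)
  | _ => []

/-- Tests that the vertices are pairwise distinct. -/
def nodupTests : List ℕ → List Exp
  | [] => []
  | x :: l => l.map (fun y => .add (.sub (.reg x) (.reg y)) (.sub (.reg y) (.reg x))) ++ nodupTests l

/-- Tests that the registers `x, ρ` contain vertices forming a cycle in the set represented by array
`4`, starting with a terminal. -/
def cycleTests (x : ℕ) (ρ : List ℕ) : List Exp :=
  (x :: ρ).map (fun y => .sub (.reg 0) (.reg y)) ++ .cell 1 (.reg x) :: (x :: ρ).map (fun y => .cell 4 (.reg y)) ++ chainTests (x :: ρ ++ [x]) ++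
    nodupTests (x :: ρ)

lemma chainTests_iff (h : Env G T σ) : ∀ {ρ : List ℕ} {l : List (Fin n)},
    ρ.map σ.reg = l.map Fin.val → ((∀ e ∈ chainTests ρ, e.eval σ ≠ 0) ↔ l.IsChain G.Adj)
  | [], [], _ => by simp [chainTests]
  | [x], [i], _ => by simp [chainTests]
  | [x], _ :: _ :: _, hl => by simp at hl
  | _ :: _ :: _, [i], hl => by simp at hl
  | x :: y :: ρ, i :: j :: l, hl => by
    simp only [List.map_cons, List.cons.injEq] at hl
    rw [List.isChain_cons_cons, ← chainTests_iff (ρ := y :: ρ) h (by simp [hl]), chainTests,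
      List.forall_mem_cons, h.adjExp_ne_zero hl.1 hl.2.1]

lemma nodupTests_iff {ρ : List ℕ} :
    (∀ e ∈ nodupTests ρ, e.eval σ ≠ 0) ↔ (ρ.map σ.reg).Nodup := by
  induction ρ with
  | nil => simp [nodupTests]
  | cons x ρ ih =>
    rw [nodupTests, List.map_cons, List.nodup_cons, ← ih, List.forall_mem_append]
    refine and_congr_left' ?_
    rw [List.forall_mem_map, List.mem_map, not_exists]
    refine forall_congr' fun y => ?_
    rw [not_and]
    refine imp_congr_right fun _ => ?_
    -- The sum of the two truncated differences is the distance of the numbers, which is nonzero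
    -- exactly when they differ.
    simp only [Exp.eval]
    omega

lemma cycleTests_iff (h : Env G T σ) (hC : Holds (σ.arr 4) C) {x : ℕ} {ρ : List ℕ} {u : Fin n}
    {p : List (Fin n)} (hl : (x :: ρ).map σ.reg = (u :: p).map Fin.val) :
    (∀ e ∈ cycleTests x ρ, e.eval σ ≠ 0) ↔ u ∈ T ∧ (∀ v ∈ u :: p, v ∈ C) ∧
      List.IsChain G.Adj (u :: p ++ [u]) ∧ (u :: p).Nodup := by
  have hx : σ.reg x = u := by simp only [List.map_cons, List.cons.injEq] at hl; exact hl.1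
  have h0 : ∀ e ∈ (x :: ρ).map (fun y => Exp.sub (.reg 0) (.reg y)), e.eval σ ≠ 0 := by
    have : ∀ v ∈ (x :: ρ).map σ.reg, v < n := by
      rw [hl, List.forall_mem_map]
      exact fun i _ => i.2
    rw [List.forall_mem_map] at this ⊢
    intro y hy
    have := this y hy
    simp only [Exp.eval, h.size]
    omega
  rw [cycleTests, List.forall_mem_append, List.forall_mem_append, List.forall_mem_append,
    List.forall_mem_cons,
    nodupTests_iff, hl, List.nodup_map_iff Fin.val_injective,
    chainTests_iff (l := u :: p ++ [u]) h (by rw [List.map_append, hl]; simp [hx])]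
  have h1 : (∀ e ∈ (x :: ρ).map fun y => Exp.cell 4 (.reg y), e.eval σ ≠ 0) ↔
      ∀ v ∈ u :: p, v ∈ C := by
    have : (∀ v ∈ (x :: ρ).map σ.reg, σ.arr 4 v ≠ 0) ↔ ∀ v ∈ (u :: p).map Fin.val, σ.arr 4 v ≠ 0 := by
      rw [hl]
    rw [List.forall_mem_map, List.forall_mem_map] at this
    rw [List.forall_mem_map]
    exact this.trans (forall₂_congr fun v _ => hC v)
  have h2 : (Exp.cell 1 (.reg x)).eval σ ≠ 0 ↔ u ∈ T := by
    simp only [Exp.eval, hx]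
    exact h.terminal u
  rw [h1, h2, iff_true_intro h0, true_and, and_assoc, and_assoc]

/-- Look for an odd cycle of length `2 l + 1` through a terminal. -/
def search (l : ℕ) : FProg :=
  nest (List.range' 10 (2 * l + 1))
    (conj (cycleTests 10 (List.range' 11 (2 * l))) (.assign 3 (.const 1)))

/-- Find out whether the set represented by array `4` contains an odd cycle through a terminal of
length less than `2 m`; the answer is stored in register `3`. -/
def check : ℕ → FProg
  | 0 => .assign 3 (.const 0)
  | l + 1 => .seq (check l) (search l)

lemma regs_search {l y : ℕ} : y ∈ (search l).regs ↔ (10 ≤ y ∧ y ≤ 10 + 2 * l) ∨ y = 3 := by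
  simp only [search, regs_nest, regs_conj, regs, Set.mem_union, Set.mem_ofPred_eq, List.mem_range'_1,
    Set.mem_singleton_iff]
  omega

lemma arrs_search {l : ℕ} : (search l).arrs = ∅ := by
  simp [search, arrs_nest, arrs_conj, arrs]

lemma regs_check {m y : ℕ} : y ∈ (check m).regs ↔ y = 3 ∨ (10 ≤ y ∧ y + 1 < 10 + 2 * m) := by
  induction m with
  | zero => simp only [check, regs, Set.mem_singleton_iff]; omega
  | succ l ih => simp only [check, regs, Set.mem_union, ih, regs_search]; omega

lemma arrs_check {m : ℕ} : (check m).arrs = ∅ := by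
  induction m with
  | zero => simp [check, arrs]
  | succ l ih => simp [check, arrs, ih, arrs_search]

lemma wf_check {m : ℕ} : (check m).WF := by
  induction m with
  | zero => trivial
  | succ l ih =>
    refine ⟨ih, wf_nest List.nodup_range' (by simp) (wf_conj trivial) ?_ ?_⟩
    · intro x hx
      rw [List.mem_range'_1] at hx
      simp only [regs_conj, regs, Set.mem_singleton_iff]
      omega
    · simp [regs_conj, regs]

/-- Soundness is carried by the invariant `J`. For completeness a cycle is rotated so that a
terminal comes first, as the tests require, and the nested loops visit the resulting tuple. -/
lemma search_spec (h : Env G T σ) (hC : Holds (σ.arr 4) C) (l : ℕ) :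
    ((search l).eval σ).reg 3 ≠ 0 ↔ σ.reg 3 ≠ 0 ∨
      ∃ q, OddTCycle G T q ∧ (∀ v ∈ q, v ∈ C) ∧ q.length = 2 * l + 1 := by
  let J : Memory → Prop := fun τ => Env G T τ ∧ τ.arr 4 = σ.arr 4 ∧ (τ.reg 3 ≠ 0 → σ.reg 3 ≠ 0 ∨
    ∃ q, OddTCycle G T q ∧ (∀ v ∈ q, v ∈ C) ∧ q.length = 2 * l + 1)
  have hρ : List.range' 10 (2 * l + 1) = 10 :: List.range' 11 (2 * l) := by rw [List.range'_succ]
  have hbody : ∀ {τ : Memory}, J τ → ∀ q : List (Fin n),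
      (List.range' 10 (2 * l + 1)).map τ.reg = q.map Fin.val → q.length = 2 * l + 1 →
      ((∀ e ∈ cycleTests 10 (List.range' 11 (2 * l)), e.eval τ ≠ 0) ↔
        OddTCycle G T q ∧ (∀ v ∈ q, v ∈ C) ∧ ∃ u ∈ T, q.head? = some u) := by
    intro τ hτ q hq hql
    match q, hql with
    | u :: p, hql =>
      rw [cycleTests_iff hτ.1 (hτ.2.1 ▸ hC) (by rw [← hρ]; exact hq), oddTCycle_cons_iff]
      constructor
      · rintro ⟨h1, h2, h3, h4⟩
        exact ⟨⟨h4, h3, by rw [hql]; exact odd_two_mul_add_one l, u, h1, by simp⟩, h2, u, h1, rfl⟩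
      · rintro ⟨⟨h1, h2, -, -⟩, h3, v, hv, hvu⟩
        obtain rfl : u = v := by simpa using hvu
        exact ⟨hv, h3, h2, h1⟩
  obtain ⟨h1, h2, h3⟩ := nest_visit (n := n) (P := conj (cycleTests 10 (List.range' 11 (2 * l)))
    (.assign 3 (.const 1))) (fun τ => τ.reg 3 ≠ 0) (List.range' 10 (2 * l + 1)) J
    (fun τ hτ => hτ.1.size)
    (fun τ x hx v hτ => ⟨hτ.1.setReg (by rw [List.mem_range'_1] at hx; omega) v, hτ.2.1, by
      rw [Memory.setReg_reg_of_ne _ _ (by rw [List.mem_range'_1] at hx; omega)]; exact hτ.2.2⟩)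
    (fun τ x hx v hτ => by
      rwa [Memory.setReg_reg_of_ne _ _ (by rw [List.mem_range'_1] at hx; omega)])
    List.nodup_range' (by simp)
    (fun x hx => by
      rw [List.mem_range'_1] at hx
      simp only [regs_conj, regs, Set.mem_singleton_iff]
      omega)
    (by simp [regs_conj, regs])
    (fun τ hτ => by
      by_cases ht : ∀ e ∈ cycleTests 10 (List.range' 11 (2 * l)), e.eval τ ≠ 0
      · rw [eval_conj_pos ht]
        refine ⟨⟨hτ.1.setReg (by norm_num) _, hτ.2.1, fun _ => Or.inr ?_⟩, fun _ => by
          rw [eval, Memory.setReg_reg_self]; exact one_ne_zero⟩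
        have hlt : ∀ v ∈ (List.range' 10 (2 * l + 1)).map τ.reg, v < n := by
          rw [List.forall_mem_map]
          intro y hy
          have := ht (.sub (.reg 0) (.reg y)) (by
            rw [cycleTests, ← hρ]
            simp only [List.mem_append, List.mem_map]
            exact Or.inl (Or.inl (Or.inl ⟨y, hy, rfl⟩)))
          simp only [Exp.eval, hτ.1.size] at this
          omega
        obtain ⟨q, hq⟩ : ∃ q : List (Fin n),
            q.map Fin.val = (List.range' 10 (2 * l + 1)).map τ.reg := by
          generalize (List.range' 10 (2 * l + 1)).map τ.reg = w at hlt
          lift w to List (Fin n) using hlt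
          exact ⟨w, rfl⟩
        have hql : q.length = 2 * l + 1 := by simpa using congrArg List.length hq
        have := (hbody hτ q hq.symm hql).1 ht
        exact ⟨q, this.1, this.2.1, hql⟩
      · rw [eval_conj_neg ht]
        exact ⟨hτ, id⟩)
    σ ⟨h, rfl, Or.inl⟩
  refine ⟨h1.2.2, ?_⟩
  rintro (h | ⟨q, hq, hqC, hql⟩)
  · exact h2 h
  obtain ⟨-, -, -, t, ht, htq⟩ := id hq
  obtain ⟨q₁, q₂, rfl⟩ := List.append_of_mem htq
  have hr : q₁ ++ t :: q₂ ~r t :: q₂ ++ q₁ := List.isRotated_append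
  have hql' : (t :: q₂ ++ q₁).length = 2 * l + 1 := hr.perm.length_eq ▸ hql
  refine h3 ((t :: q₂ ++ q₁).map Fin.val) (by rw [List.length_map, hql', List.length_range'])
    (by rw [List.forall_mem_map]; exact fun i _ => i.2.le) fun τ hτ hτq => ?_
  rw [eval_conj_pos ((hbody hτ _ hτq hql').2 ⟨hq.rotated hr, fun v hv => hqC v (hr.mem_iff.2 hv),
    t, ht, rfl⟩), eval, Memory.setReg_reg_self]
  exact one_ne_zero

lemma check_spec (h : Env G T σ) (hC : Holds (σ.arr 4) C) {m : ℕ} :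
    ((check m).eval σ).reg 3 ≠ 0 ↔
      ∃ q, OddTCycle G T q ∧ (∀ v ∈ q, v ∈ C) ∧ q.length < 2 * m := by
  induction m with
  | zero => simp [check, eval, Memory.setReg_reg_self, Exp.eval]
  | succ l ih =>
    rw [check, eval, search_spec (h.eval (by simp [regs_check]) (by simp [arrs_check]))
      (by rwa [eval_arr _ (by simp [arrs_check])]), ih]
    constructor
    · rintro (⟨q, h1, h2, h3⟩ | ⟨q, h1, h2, h3⟩)
      exacts [⟨q, h1, h2, by omega⟩, ⟨q, h1, h2, by omega⟩]
    · rintro ⟨q, h1, h2, h3⟩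
      obtain ⟨j, hj⟩ := h1.2.2.1
      by_cases hjl : j < l
      · exact Or.inl ⟨q, h1, h2, by omega⟩
      · exact Or.inr ⟨q, h1, h2, by omega⟩

end Check

end SubsetOCT

namespace SubsetOCT

open FProg

/-! ### The greedy algorithm -/

section Greedy

variable {n : ℕ} {G : SimpleGraph (Fin n)} {T C F : Finset (Fin n)} {σ : Memory} {m : ℕ}

/-- Count the `v` in `[0, n)` that satisfy the test `e`, where register `x` holds `v`, in
register `y`. -/
def count (x y : ℕ) (e : Exp) : FProg :=
  .seq (.assign y (.const 0)) (.loop x 0 (.ite e (.assign y (.add (.reg y) (.const 1))) .skip))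

lemma count_spec {x y : ℕ} {e : Exp} (hn : σ.reg 0 = n) (hy0 : y ≠ 0) (hxy : x ≠ y)
    (he : ∀ (τ : Memory) (i : Fin n), τ.arr = σ.arr → (∀ z, z ≠ x → z ≠ y → τ.reg z = σ.reg z) →
      τ.reg x = i → (e.eval τ ≠ 0 ↔ i ∈ C)) : ((count x y e).eval σ).reg y = C.card := by
  have h0 : ((FProg.assign y (.const 0)).eval σ).reg 0 = n := by
    rw [eval, Memory.setReg_reg_of_ne _ _ hy0.symm, hn]
  have := loop_inv (x := x) (b := 0) (σ := (FProg.assign y (.const 0)).eval σ)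
    (P := .ite e (.assign y (.add (.reg y) (.const 1))) .skip) (by simp [regs, hxy])
    (fun k τ => τ.reg y = (C.filter (·.val < k)).card)
    (by
      rw [Memory.setReg_reg_of_ne _ _ hxy.symm, eval, Memory.setReg_reg_self]
      simp [Exp.eval])
    (by
      intro k hk τ hτx hτr hτa hτ
      rw [h0, add_zero] at hk
      rw [Memory.setReg_reg_of_ne _ _ hxy.symm]
      have hC : C.filter (·.val < k + 1) = C.filter (·.val < k) ∪ C.filter (· = ⟨k, hk⟩) := by
        ext i
        simp only [Finset.mem_filter, Finset.mem_union, Fin.ext_iff, ← and_or_left]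
        exact and_congr_right fun _ => by omega
      have hd : Disjoint (C.filter (·.val < k)) (C.filter (· = ⟨k, hk⟩)) := by
        rw [Finset.disjoint_filter]
        rintro i - h1 rfl
        simp at h1
      have hek := he τ ⟨k, hk⟩ (funext fun a => by rw [hτa a (by simp [arrs])]; rfl)
        (fun z hzx hzy => by
          rw [hτr z hzx (by simp [regs, hzy]), eval, Memory.setReg_reg_of_ne _ _ hzy]) hτx
      rw [hC, Finset.card_union_of_disjoint hd, ← hτ, eval]
      split_ifs with h
      · rw [Finset.filter_eq', if_neg (fun h' => hek.2 h' h)]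
        rfl
      · rw [Finset.filter_eq', if_pos (hek.1 h), eval, Memory.setReg_reg_self]
        rfl)
  rw [h0, add_zero] at this
  rw [count, eval, this, Finset.filter_true_of_mem fun i _ => i.2]

lemma regs_count {x y : ℕ} {e : Exp} : (count x y e).regs = {x, y} := by
  ext z
  simp only [count, regs, Set.mem_union, Set.mem_insert_iff, Set.mem_singleton_iff,
    Set.mem_empty_iff_false]
  tauto

lemma arrs_count {x y : ℕ} {e : Exp} : (count x y e).arrs = ∅ := by simp [count, arrs]

lemma wf_count {x y : ℕ} {e : Exp} (hx : x ≠ 0) (hy : y ≠ 0) (hxy : x ≠ y) : (count x y e).WF := by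
  simp [count, WF, regs, hx, hy.symm, hxy]

/-- Count the neighbours of the vertex in register `6` in the set in array `6`. -/
def countNeighbors : FProg :=
  count 7 8 (.sub (.const 1) (.add (.sub (.const 1) (adjExp 6 7)) (.sub (.const 1) (.cell 6 (.reg 7)))))

open scoped Classical in
lemma countNeighbors_spec (h : Env G T σ) (hF : Holds (σ.arr 6) F) {v : Fin n}
    (hv : σ.reg 6 = v) : (countNeighbors.eval σ).reg 8 = (F.filter (G.Adj v)).card := by
  refine count_spec h.size (by norm_num) (by norm_num) fun τ i hτ hz hi => ?_
  have h1 := (h.congr (τ := τ) (hz 0 (by norm_num) (by norm_num)) fun a _ => by rw [hτ]).adjExp_ne_zero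
    ((hz 6 (by norm_num) (by norm_num)).trans hv) hi
  have h2 : (Exp.cell 6 (.reg 7)).eval τ ≠ 0 ↔ i ∈ F := by
    simp only [Exp.eval, hτ, hi]
    exact hF i
  rw [Finset.mem_filter, ← h1, ← h2]
  -- The conjunction of two tests is expressed as 1 - ((1 - a) + (1 - b)) with truncated
  -- subtraction.
  simp only [Exp.eval]
  omega

/-- Add the vertex of register `6` to the set in array `4` if the test `g` succeeds, it has at most
one neighbour in the set in array `6`, and no odd cycle through a terminal arises. -/
def greedyStep (m : ℕ) (g : Exp) : FProg :=
  .seq countNeighbors (conj [g, .sub (.const 2) (.reg 8), .sub (.const 1) (.cell 4 (.reg 6))]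
    (.seq (.store 4 (.reg 6) (.const 1))
      (.seq (check m) (.ite (.reg 3) (.store 4 (.reg 6) (.const 0)) .skip))))

lemma regs_greedyStep {g : Exp} {y : ℕ} :
    y ∈ (greedyStep m g).regs ↔ y ∈ [3, 7, 8] ∨ (10 ≤ y ∧ y + 1 < 10 + 2 * m) := by
  simp only [greedyStep, countNeighbors, regs_count, regs, regs_conj, Set.mem_union, regs_check,
    Set.mem_insert_iff, Set.mem_singleton_iff, Set.mem_empty_iff_false, List.mem_cons,
    List.not_mem_nil, or_false, false_or]
  omega

lemma arrs_greedyStep {g : Exp} : (greedyStep m g).arrs = {4} := by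
  simp [greedyStep, countNeighbors, arrs_count, arrs, arrs_conj, arrs_check]

lemma wf_greedyStep {g : Exp} : (greedyStep m g).WF :=
  ⟨wf_count (by norm_num) (by norm_num) (by norm_num), wf_conj ⟨trivial, wf_check, trivial, trivial⟩⟩

lemma Holds.insert_vertex {A A' : ℕ → ℕ} {v : Fin n} (hA : Holds A C)
    (h : ∀ i, A' i = if i = v then 1 else A i) : Holds A' (insert v C) := by
  intro i
  rw [h, Finset.mem_insert, ← hA i, Fin.ext_iff]
  split_ifs with hi <;> simp [hi]

lemma Holds.remove {A A' : ℕ → ℕ} {v : Fin n} (hA : Holds A (insert v C)) (hv : v ∉ C)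
    (h : ∀ i, A' i = if i = v then 0 else A i) : Holds A' C := by
  intro i
  rw [h]
  by_cases hi : i = v
  · simp [hi, hv]
  · rw [if_neg (by rwa [← Fin.ext_iff]), hA i, Finset.mem_insert, or_iff_right hi]

-- By `hm`, looking for cycles shorter than 2m decides `TBip` exactly, so a tentative insertion is
-- revoked precisely when it creates an odd T-cycle.
open scoped Classical in
lemma greedyStep_spec (hm : ∀ B, ¬ TBip G T B → ∃ q, OddTCycle G T q ∧ (∀ v ∈ q, v ∈ B) ∧
      q.length < 2 * m) (h : Env G T σ) (hC : Holds (σ.arr 4) C) (hF : Holds (σ.arr 6) F)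
    {v : Fin n} (hv : σ.reg 6 = v) {g : Exp} {p : Prop}
    (hg : ∀ τ, Env G T τ → τ.reg 6 = v → (g.eval τ ≠ 0 ↔ p)) :
    Holds (((greedyStep m g).eval σ).arr 4)
      (if p ∧ Low G F v ∧ v ∉ C ∧ TBip G T (insert v C) then insert v C else C) := by
  rw [greedyStep, eval]
  have h8 := countNeighbors_spec h hF hv
  set τ := countNeighbors.eval σ
  have h' : Env G T τ := h.eval (by simp [countNeighbors, regs_count])
    (by simp [countNeighbors, arrs_count])
  have hC' : Holds (τ.arr 4) C := by rwa [eval_arr _ (by simp [countNeighbors, arrs_count])]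
  have hv' : τ.reg 6 = v := by rwa [eval_reg _ (by simp [countNeighbors, regs_count])]
  have ht : (∀ e ∈ [g, .sub (.const 2) (.reg 8), .sub (.const 1) (.cell 4 (.reg 6))],
      e.eval τ ≠ 0) ↔ p ∧ Low G F v ∧ v ∉ C := by
    simp only [List.mem_cons, List.not_mem_nil, or_false, forall_eq_or_imp, forall_eq]
    rw [hg τ h' hv', ← hC' v]
    refine and_congr_right fun _ => and_congr ?_ ?_
    · have : Low G F v ↔ (F.filter (G.Adj v)).card ≤ 1 := by
        rw [Finset.card_le_one]
        simp only [Low, Finset.mem_filter, and_imp]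
        exact forall₂_congr fun a _ => ⟨fun h h1 b h2 h3 => h b h2 h1 h3, fun h b h2 h1 => h h1 b h2⟩
      rw [this, ← h8]
      simp only [Exp.eval]
      omega
    · simp only [Exp.eval, hv']
      omega
  by_cases hp : p ∧ Low G F v ∧ v ∉ C
  · rw [eval_conj_pos (ht.2 hp), eval, eval, eval, eval]
    set υ := τ.setCell 4 ((Exp.reg 6).eval τ) ((Exp.const 1).eval τ)
    have hυ : Env G T υ := h'.congr rfl fun a ha => Memory.setCell_arr_of_ne _ _ _
      (by rintro rfl; simp at ha)
    have hυC : Holds (υ.arr 4) (insert v C) := hC'.insert_vertex fun i => by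
      rw [Memory.setCell_arr_self, show (Exp.reg 6).eval τ = v from hv']
      rfl
    have hch : ((check m).eval υ).reg 3 ≠ 0 ↔ ¬ TBip G T (insert v C) := by
      rw [check_spec hυ hυC]
      refine ⟨fun ⟨q, h1, h2, _⟩ => not_tBip_iff.2 ⟨q, h1, h2⟩, hm _⟩
    have h4 : ((check m).eval υ).arr 4 = υ.arr 4 := eval_arr _ (by simp [arrs_check])
    rw [Exp.eval]
    split_ifs with h1 h2 h2
    · rw [eval, h4]
      exact hυC
    · exact absurd h1 (hch.2 fun h => h2 ⟨hp.1, hp.2.1, hp.2.2, h⟩)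
    · exact absurd h2.2.2.2 (hch.1 h1)
    · refine hυC.remove hp.2.2 fun i => ?_
      have h6 : ((check m).eval υ).reg 6 = v := (eval_reg _ (by simp [regs_check])).trans hv'
      rw [eval, Memory.setCell_arr_self, h4, show (Exp.reg 6).eval ((check m).eval υ) = v from h6]
      rfl
  · rw [eval_conj_neg (ht.not.2 hp), if_neg fun h => hp ⟨h.1, h.2.1, h.2.2.1⟩]
    exact hC'

/-- One round of the greedy algorithm. -/
def greedyPass (m : ℕ) (g : Exp) : FProg := .loop 6 0 (greedyStep m g)

lemma regs_greedyPass {g : Exp} {y : ℕ} :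
    y ∈ (greedyPass m g).regs ↔ y ∈ [3, 6, 7, 8] ∨ (10 ≤ y ∧ y + 1 < 10 + 2 * m) := by
  simp only [greedyPass, regs, Set.mem_insert_iff, regs_greedyStep, List.mem_cons, List.not_mem_nil,
    or_false]
  omega

lemma arrs_greedyPass {g : Exp} : (greedyPass m g).arrs = {4} := by
  simp [greedyPass, arrs, arrs_greedyStep]

lemma wf_greedyPass {g : Exp} : (greedyPass m g).WF :=
  ⟨by norm_num, by simp [regs_greedyStep], by simp [regs_greedyStep], wf_greedyStep⟩

/-- `C'` is a maximal extension of `C` without odd `T`-cycles by vertices with property `p` that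
have at most one neighbour in `F`. -/
structure PassExt (G : SimpleGraph (Fin n)) (T F : Finset (Fin n)) (p : Fin n → Prop)
    (C C' : Finset (Fin n)) : Prop where
  sub : C ⊆ C'
  new : ∀ v ∈ C', v ∉ C → p v ∧ Low G F v
  tBip : TBip G T C → TBip G T C'
  max : ∀ v, p v → Low G F v → v ∉ C' → ¬ TBip G T (insert v C')

/-- A single round suffices: the set only grows and `TBip` passes to subsets, so a vertex rejected
once can never be added later. -/
lemma greedyPass_spec (hm : ∀ B, ¬ TBip G T B → ∃ q, OddTCycle G T q ∧ (∀ v ∈ q, v ∈ B) ∧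
      q.length < 2 * m) (h : Env G T σ) (hC : Holds (σ.arr 4) C) (hF : Holds (σ.arr 6) F)
    {g : Exp} {p : Fin n → Prop}
    (hg : ∀ τ v, Env G T τ → τ.reg 6 = v.val → (g.eval τ ≠ 0 ↔ p v)) :
    ∃ C', PassExt G T F p C C' ∧ Holds (((greedyPass m g).eval σ).arr 4) C' := by
  classical
  have key := loop_inv (x := 6) (b := 0) (P := greedyStep m g) (σ := σ)
    (by simp [regs_greedyStep])
    (fun k τ => ∃ C', Holds (τ.arr 4) C' ∧ C ⊆ C' ∧ (∀ v ∈ C', v ∉ C → p v ∧ Low G F v) ∧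
      (TBip G T C → TBip G T C') ∧
      ∀ v : Fin n, v.val < k → p v → Low G F v → v ∉ C' → ¬ TBip G T (insert v C'))
    ⟨C, hC, subset_rfl, fun v h h' => absurd h h', id, by simp⟩ (by
      rintro k hk τ hτx hτr hτa ⟨C', h1, h2, h3, h4, h5⟩
      rw [h.size, add_zero] at hk
      have hτ : Env G T τ := h.congr (hτr 0 (by norm_num) (by simp [regs_greedyStep])) fun a ha =>
        hτa a (by rw [arrs_greedyStep]; rintro rfl; simp at ha)
      have hτF : Holds (τ.arr 6) F := by rwa [hτa 6 (by simp [arrs_greedyStep])]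
      have hs := greedyStep_spec hm hτ h1 hτF (v := ⟨k, hk⟩) hτx (hg · ⟨k, hk⟩)
      rw [Memory.setReg_arr]
      refine ⟨_, hs, ?_⟩
      split_ifs with hif
      · refine ⟨h2.trans (Finset.subset_insert _ _), ?_, fun _ => hif.2.2.2, ?_⟩
        · intro v hv hvC
          rw [Finset.mem_insert] at hv
          rcases hv with rfl | hv
          exacts [⟨hif.1, hif.2.1⟩, h3 v hv hvC]
        · intro v hv hp hl hvC hT
          have hvk : v.val ≠ k := fun h => hvC (Finset.mem_insert.2 (Or.inl (Fin.ext h)))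
          refine h5 v (by omega) hp hl (fun h => hvC (Finset.mem_insert_of_mem h)) (hT.mono ?_)
          exact Finset.insert_subset_insert _ (Finset.subset_insert _ _)
      · refine ⟨h2, h3, h4, fun v hv hp hl hvC hT => ?_⟩
        by_cases hvk : v.val = k
        · obtain rfl : v = ⟨k, hk⟩ := Fin.ext hvk
          exact hif ⟨hp, hl, hvC, hT⟩
        · exact h5 v (by omega) hp hl hvC hT)
  obtain ⟨C', h1, h2, h3, h4, h5⟩ := key
  refine ⟨C', ⟨h2, h3, h4, fun v => h5 v ?_⟩, h1⟩
  rw [h.size]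
  exact v.2

/-- The first pass adds only vertices outside `T`, so its result lies in the union of `K` and the
part of `C₂` outside `T`. A vertex outside `T` that could be added to this union could have been
added in the first pass. -/
lemma PassExt.greedyExt {K C₁ C₂ : Finset (Fin n)} (h₁ : PassExt G T F (· ∉ T) K C₁)
    (h₂ : PassExt G T F (fun _ => True) C₁ C₂) (hK : TBip G T K) : GreedyExt G T K F C₂ where
  sub := h₁.sub.trans h₂.sub
  low v hv hvK := by
    by_cases h : v ∈ C₁
    exacts [(h₁.new v h hvK).2, (h₂.new v hv h).2]
  tBip := h₂.tBip (h₁.tBip hK)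
  max v hl hv := h₂.max v trivial hl hv
  max_off v hl hvT hv hT := by
    refine h₁.max v hvT hl (fun h => hv (h₂.sub h)) (hT.mono ?_)
    refine Finset.insert_subset_insert _ fun x hx => ?_
    by_cases hxK : x ∈ K
    · exact Finset.mem_union_left _ hxK
    · exact Finset.mem_union_right _ (Finset.mem_filter.2 ⟨h₂.sub hx, (h₁.new x hx hxK).1⟩)

end Greedy

end SubsetOCT

namespace SubsetOCT

open FProg

/-! ### Processing one candidate pair -/

section Main

variable {n : ℕ} {G : SimpleGraph (Fin n)} {T : Finset (Fin n)} {σ : Memory} {m : ℕ}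

/-- Add the numbers in the registers `ρ` to the set in array `a`. -/
def mark (a : ℕ) : List ℕ → FProg
  | [] => .skip
  | x :: ρ => .seq (.store a (.reg x) (.const 1)) (mark a ρ)

lemma regs_mark {a : ℕ} {ρ : List ℕ} : (mark a ρ).regs = ∅ := by
  induction ρ with
  | nil => rfl
  | cons x ρ ih => simp [mark, regs, ih]

lemma arrs_mark {a b : ℕ} {ρ : List ℕ} (h : b ∈ (mark a ρ).arrs) : b = a := by
  induction ρ with
  | nil => simp [mark, arrs] at h
  | cons x ρ ih =>
    simp only [mark, arrs, Set.mem_union, Set.mem_singleton_iff] at h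
    exact h.elim id ih

lemma wf_mark {a : ℕ} {ρ : List ℕ} : (mark a ρ).WF := by
  induction ρ with
  | nil => trivial
  | cons x ρ ih => exact ⟨trivial, ih⟩

lemma mark_spec {a : ℕ} {ρ : List ℕ} (j : ℕ) : ∀ σ : Memory,
    (((mark a ρ).eval σ).arr a j ≠ 0 ↔ σ.arr a j ≠ 0 ∨ j ∈ ρ.map σ.reg) := by
  induction ρ with
  | nil => simp [mark, eval]
  | cons x ρ ih =>
    intro σ
    rw [mark, eval, ih, eval, Memory.setCell_arr_self, Memory.setCell_reg, List.map_cons,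
      List.mem_cons]
    simp only [Exp.eval]
    split_ifs with h <;> simp [h]

/-- Let array `a` represent the set of the numbers in the registers `ρ`. -/
def load (a : ℕ) (ρ : List ℕ) : FProg :=
  .seq (.loop 6 0 (.store a (.reg 6) (.const 0))) (mark a ρ)

lemma regs_load {a : ℕ} {ρ : List ℕ} : (load a ρ).regs = {6} := by
  simp [load, regs, regs_mark]

lemma arrs_load {a b : ℕ} {ρ : List ℕ} (h : b ∈ (load a ρ).arrs) : b = a := by
  simp only [load, arrs, Set.mem_union, Set.mem_singleton_iff] at h
  exact h.elim id arrs_mark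

lemma wf_load {a : ℕ} {ρ : List ℕ} : (load a ρ).WF :=
  ⟨⟨by norm_num, id, id, trivial⟩, wf_mark⟩

/-- The vertices in the registers `ρ`. -/
def tuple (n : ℕ) (σ : Memory) (ρ : List ℕ) : Finset (Fin n) :=
  Finset.univ.filter (·.val ∈ ρ.map σ.reg)

lemma load_spec {a : ℕ} {ρ : List ℕ} (hn : σ.reg 0 = n) (h6 : 6 ∉ ρ) :
    Holds (((load a ρ).eval σ).arr a) (tuple n σ ρ) := by
  intro i
  rw [load, eval, mark_spec, tuple, Finset.mem_filter]
  have h1 := loop_inv (x := 6) (b := 0) (P := .store a (.reg 6) (.const 0)) (σ := σ)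
    id (fun k τ => ∀ j < k, τ.arr a j = 0) (by simp) (by
      intro k hk τ hτx _ _ hτ j hj
      rw [Memory.setReg_arr, eval, Memory.setCell_arr_self]
      simp only [Exp.eval, hτx]
      split_ifs with hjk
      exacts [rfl, hτ j (by omega)])
  have h2 : ρ.map ((loop 6 0 (.store a (.reg 6) (.const 0))).eval σ).reg = ρ.map σ.reg :=
    List.map_congr_left fun x hx => eval_reg _ (by
      simp only [regs, insert_empty_eq, Set.mem_singleton_iff]
      rintro rfl
      exact h6 hx)
  rw [h1 i (by rw [hn]; exact i.2), h2]
  simp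

/-- Array `5` := array `4`. -/
def copy : FProg := .loop 6 0 (.store 5 (.reg 6) (.cell 4 (.reg 6)))

lemma copy_spec {C : Finset (Fin n)} (hn : σ.reg 0 = n) (hC : Holds (σ.arr 4) C) :
    Holds ((copy.eval σ).arr 5) C := by
  have h1 := loop_inv (x := 6) (b := 0) (P := .store 5 (.reg 6) (.cell 4 (.reg 6))) (σ := σ)
    id (fun k τ => ∀ j < k, τ.arr 5 j = σ.arr 4 j) (by simp) (by
      intro k hk τ hτx _ hτa hτ j hj
      rw [Memory.setReg_arr, eval, Memory.setCell_arr_self]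
      simp only [Exp.eval, hτx]
      split_ifs with hjk
      · rw [hτa 4 (by simp [arrs]), hjk]
      · exact hτ j (by omega))
  intro i
  rw [copy, h1 i (by rw [hn]; exact i.2)]
  exact hC i

/-- Extend the vertices in the registers `ρ` greedily, with respect to those in the registers
`ρ'`. -/
def extend (m : ℕ) (ρ ρ' : List ℕ) : FProg :=
  .seq (load 4 ρ) (.seq (load 6 ρ') (.seq (greedyPass m (.sub (.const 1) (.cell 1 (.reg 6))))
    (.seq (greedyPass m (.const 1)) (.seq (check m) (count 6 5 (.cell 4 (.reg 6)))))))

/-- Store the set in array `4`, of the size in register `5`, if it is larger than the largest set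
found so far and contains no odd cycle through a terminal. -/
def update : FProg :=
  conj [.sub (.const 1) (.reg 3), .sub (.reg 5) (.reg 4)] (.seq copy (.assign 4 (.reg 5)))

lemma regs_extend {ρ ρ' : List ℕ} {y : ℕ} :
    y ∈ (extend m ρ ρ').regs ↔ y ∈ [3, 5, 6, 7, 8] ∨ (10 ≤ y ∧ y + 1 < 10 + 2 * m) := by
  simp only [extend, regs, regs_load, regs_greedyPass, regs_count, regs_check, Set.mem_union,
    Set.mem_insert_iff, Set.mem_singleton_iff, List.mem_cons, List.not_mem_nil, or_false]
  omega

lemma arrs_extend {ρ ρ' : List ℕ} {a : ℕ} (h : a ∈ (extend m ρ ρ').arrs) : a = 4 ∨ a = 6 := by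
  simp only [extend, arrs, arrs_greedyPass, arrs_count, arrs_check, Set.mem_union,
    Set.mem_singleton_iff, Set.mem_empty_iff_false, or_false] at h
  rcases h with h | h | h | h
  exacts [Or.inl (arrs_load h), Or.inr (arrs_load h), Or.inl h, Or.inl h]

lemma wf_extend {ρ ρ' : List ℕ} : (extend m ρ ρ').WF :=
  ⟨wf_load, wf_load, wf_greedyPass, wf_greedyPass, wf_check,
    wf_count (by norm_num) (by norm_num) (by norm_num)⟩

lemma regs_update {y : ℕ} : y ∈ update.regs ↔ y = 4 ∨ y = 6 := by
  simp only [update, copy, regs_conj, regs, insert_empty_eq, Set.mem_union,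
    Set.mem_singleton_iff]
  omega

lemma arrs_update : update.arrs = {5} := by
  simp [update, copy, arrs_conj, arrs]

lemma wf_update : update.WF := wf_conj ⟨⟨by norm_num, id, id, trivial⟩, trivial⟩

/-- The greedy guarantee needs a loaded kernel without odd T-cycles. For all other tuples the final
`check` lets `update` reject the outcome. -/
lemma extend_spec (hm : ∀ B, ¬ TBip G T B → ∃ q, OddTCycle G T q ∧ (∀ v ∈ q, v ∈ B) ∧
      q.length < 2 * m) (h : Env G T σ) {ρ ρ' : List ℕ} (hρ : 6 ∉ ρ) (hρ' : 6 ∉ ρ') :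
    ∃ C, Holds (((extend m ρ ρ').eval σ).arr 4) C ∧ ((extend m ρ ρ').eval σ).reg 5 = C.card ∧
      (((extend m ρ ρ').eval σ).reg 3 ≠ 0 ↔ ¬ TBip G T C) ∧
      (TBip G T (tuple n σ ρ) → GreedyExt G T (tuple n σ ρ) (tuple n σ ρ') C) := by
  have hK := load_spec (a := 4) (ρ := ρ) h.size hρ
  simp only [extend, eval]
  set σ₁ := (load 4 ρ).eval σ
  have h₁ : Env G T σ₁ := h.eval (by simp [regs_load]) fun a ha hl => by
    rw [arrs_load hl] at ha; simp at ha
  have hF := load_spec (a := 6) (ρ := ρ') h₁.size hρ'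
  have ht : tuple n σ₁ ρ' = tuple n σ ρ' := by
    rw [tuple, tuple, List.map_congr_left fun x hx => eval_reg σ (P := load 4 ρ) (y := x) (by
      rw [regs_load, Set.mem_singleton_iff]; rintro rfl; exact hρ' hx)]
  rw [ht] at hF
  have hK' : Holds (((load 6 ρ').eval σ₁).arr 4) (tuple n σ ρ) := by
    rwa [eval_arr _ fun h => by simpa using arrs_load h]
  set σ₂ := (load 6 ρ').eval σ₁
  have h₂ : Env G T σ₂ := h₁.eval (by simp [regs_load]) fun a ha hl => by
    rw [arrs_load hl] at ha; simp at ha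
  obtain ⟨C₁, hC₁, hh₁⟩ := greedyPass_spec hm h₂ hK' hF
    (g := .sub (.const 1) (.cell 1 (.reg 6))) (p := (· ∉ T)) (fun τ v hτ hv => by
      rw [← hτ.terminal v]
      simp only [Exp.eval, hv]
      omega)
  set σ₃ := (greedyPass m (.sub (.const 1) (.cell 1 (.reg 6)))).eval σ₂
  have h₃ : Env G T σ₃ := h₂.eval (by simp [regs_greedyPass]) (by simp [arrs_greedyPass])
  have hF₃ : Holds (σ₃.arr 6) (tuple n σ ρ') := by rwa [eval_arr _ (by simp [arrs_greedyPass])]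
  obtain ⟨C₂, hC₂, hh₂⟩ := greedyPass_spec hm h₃ hh₁ hF₃ (g := .const 1) (p := fun _ => True)
    (fun τ v hτ hv => by simp [Exp.eval])
  set σ₄ := (greedyPass m (.const 1)).eval σ₃
  have h₄ : Env G T σ₄ := h₃.eval (by simp [regs_greedyPass]) (by simp [arrs_greedyPass])
  have h₅ : Env G T ((check m).eval σ₄) := h₄.eval (by simp [regs_check]) (by simp [arrs_check])
  have hh₃ : Holds (((check m).eval σ₄).arr 4) C₂ := by rwa [eval_arr _ (by simp [arrs_check])]
  refine ⟨C₂, ?_, ?_, ?_, hC₁.greedyExt hC₂⟩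
  · rwa [eval_arr _ (by simp [arrs_count])]
  · refine count_spec h₅.size (by norm_num) (by norm_num) fun τ i hτ _ hi => ?_
    simp only [Exp.eval, hτ, hi]
    exact hh₃ i
  · rw [eval_reg _ (by simp [regs_count]), check_spec h₄ hh₂]
    exact ⟨fun ⟨q, h1, h2, _⟩ => not_tBip_iff.2 ⟨q, h1, h2⟩, hm _⟩

/-- Array `5` holds a set without odd `T`-cycles, and register `4` its size. -/
def Best (G : SimpleGraph (Fin n)) (T : Finset (Fin n)) (σ : Memory) : Prop :=
  ∃ B, TBip G T B ∧ Holds (σ.arr 5) B ∧ σ.reg 4 = B.card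

lemma update_spec (hn : σ.reg 0 = n) (hB : Best G T σ) {C : Finset (Fin n)}
    (hC : Holds (σ.arr 4) C) (h5 : σ.reg 5 = C.card) (h3 : σ.reg 3 ≠ 0 ↔ ¬ TBip G T C) :
    Best G T (update.eval σ) ∧ σ.reg 4 ≤ (update.eval σ).reg 4 ∧
      (TBip G T C → C.card ≤ (update.eval σ).reg 4) := by
  have ht : (∀ e ∈ [.sub (.const 1) (.reg 3), .sub (.reg 5) (.reg 4)], Exp.eval σ e ≠ 0) ↔
      TBip G T C ∧ σ.reg 4 < C.card := by
    simp only [List.mem_cons, List.not_mem_nil, or_false, forall_eq_or_imp, forall_eq, Exp.eval]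
    rw [← h5, ← not_not (a := TBip G T C), ← h3]
    omega
  by_cases h : TBip G T C ∧ σ.reg 4 < C.card
  · have h4 : (update.eval σ).reg 4 = C.card := by
      rw [update, eval_conj_pos (ht.2 h), eval, eval, Memory.setReg_reg_self, Exp.eval,
        eval_reg _ (by simp [copy, regs]), h5]
    refine ⟨⟨C, h.1, ?_, h4⟩, by omega, fun _ => h4.ge⟩
    rw [update, eval_conj_pos (ht.2 h), eval, eval, Memory.setReg_arr]
    exact copy_spec hn hC
  · rw [update, eval_conj_neg (ht.not.2 h)]
    exact ⟨hB, le_rfl, fun hT => not_lt.1 fun h' => h ⟨hT, h'⟩⟩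

/-- Compute the row offsets `i * n` of the adjacency matrix. -/
def rows : FProg :=
  .seq (.assign 5 (.const 0)) (.loop 6 0 (.seq (.store 3 (.reg 6) (.reg 5))
    (.assign 5 (.add (.reg 5) (.reg 0)))))

lemma rows_spec (hn : σ.reg 0 = n) : ∀ i : Fin n, (rows.eval σ).arr 3 i = i * n := by
  have h0 : ((FProg.assign 5 (.const 0)).eval σ).reg 0 = n := hn
  have h1 := loop_inv (x := 6) (b := 0) (P := .seq (.store 3 (.reg 6) (.reg 5))
    (.assign 5 (.add (.reg 5) (.reg 0)))) (σ := (FProg.assign 5 (.const 0)).eval σ)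
    (by simp [regs])
    (fun k τ => τ.reg 5 = k * n ∧ ∀ j < k, τ.arr 3 j = j * n)
    (by simp [Memory.setReg, eval, Exp.eval]) (by
      intro k hk τ hτx hτr _ hτ
      have hτ0 : τ.reg 0 = n := by rw [hτr 0 (by norm_num) (by simp [regs]), h0]
      constructor
      · rw [Memory.setReg_reg_of_ne _ _ (by norm_num), eval, eval, eval, Memory.setReg_reg_self]
        simp only [Exp.eval, Memory.setCell_reg, hτ.1, hτ0]
        ring
      · intro j hj
        rw [Memory.setReg_arr, eval, eval, eval, Memory.setReg_arr, Memory.setCell_arr_self]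
        simp only [Exp.eval, hτx, hτ.1]
        split_ifs with hjk
        · rw [hjk]
        · exact hτ.2 j (by omega))
  intro i
  rw [rows, eval]
  exact h1.2 i (by rw [h0]; exact i.2)

end Main

end SubsetOCT

namespace SubsetOCT

open FProg

/-! ### The complete algorithm -/

section Solver

/-- The whole algorithm: try all pairs of sets of at most `c` vertices. -/
def solver (m c : ℕ) : FProg :=
  .seq rows (.seq (nest (List.range' (10 + 2 * m) c ++ List.range' (10 + 2 * m + c) c)
      (.seq (extend m (List.range' (10 + 2 * m) c) (List.range' (10 + 2 * m + c) c)) update))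
    (.seq (.loop 6 0 (.store 2 (.reg 6) (.sub (.const 1) (.cell 5 (.reg 6)))))
      (.assign 2 (.sub (.const 1) (.sub (.sub (.reg 0) (.reg 4)) (.reg 1))))))

lemma nodup_solver_regs (m c : ℕ) :
    (List.range' (10 + 2 * m) c ++ List.range' (10 + 2 * m + c) c).Nodup := by
  refine List.Nodup.append List.nodup_range' List.nodup_range' fun x h1 h2 => ?_
  rw [List.mem_range'_1] at h1 h2
  omega

lemma le_of_mem_solver_regs {m c x : ℕ}
    (hx : x ∈ List.range' (10 + 2 * m) c ++ List.range' (10 + 2 * m + c) c) : 10 + 2 * m ≤ x := by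
  rw [List.mem_append, List.mem_range'_1, List.mem_range'_1] at hx
  omega

/-- The tuples occupy registers from 10 + 2m on, above the registers in which `check m` stores
cycles; registers 0, 1 and 2 hold n, k and the answer. The loop body touches none of them. -/
lemma notMem_regs_of_le {m x : ℕ} {ρ ρ' : List ℕ} (hx : 10 + 2 * m ≤ x ∨ x < 3) :
    x ∉ (FProg.seq (extend m ρ ρ') update).regs := by
  simp only [regs, Set.mem_union, regs_extend, regs_update, List.mem_cons, List.not_mem_nil, or_false]
  omega

lemma zero_notMem_regs_solver (m c : ℕ) : 0 ∉ (solver m c).regs := by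
  have h : 0 ∉ (nest (List.range' (10 + 2 * m) c ++ List.range' (10 + 2 * m + c) c)
      (.seq (extend m (List.range' (10 + 2 * m) c) (List.range' (10 + 2 * m + c) c)) update)).regs := by
    rw [regs_nest, Set.mem_union, not_or]
    exact ⟨fun h => absurd (le_of_mem_solver_regs h) (by omega), notMem_regs_of_le (by omega)⟩
  rw [solver, regs, regs, Set.mem_union, Set.mem_union, not_or, not_or]
  exact ⟨by simp [rows, regs], h, by simp [regs]⟩

lemma wf_solver (m c : ℕ) : (solver m c).WF := by
  refine ⟨⟨trivial, by norm_num, by simp [regs], by simp [regs], trivial, trivial⟩, ?_,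
    ⟨by norm_num, id, id, trivial⟩, trivial⟩
  refine wf_nest (nodup_solver_regs m c) (fun h => absurd (le_of_mem_solver_regs h) (by omega))
    ⟨wf_extend, wf_update⟩ (fun x hx => notMem_regs_of_le (Or.inl (le_of_mem_solver_regs hx)))
    (notMem_regs_of_le (by omega))

/-- Smaller sets are padded with the number n, which is not a vertex; this is why the nested loops
run up to n inclusive. -/
lemma exists_tuple {n c : ℕ} (K : Finset (Fin n)) (hK : K.card ≤ c) :
    ∃ w : List ℕ, w.length = c ∧ (∀ v ∈ w, v ≤ n) ∧
      ∀ (τ : Memory) (ρ : List ℕ), ρ.map τ.reg = w → tuple n τ ρ = K := by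
  refine ⟨K.toList.map Fin.val ++ List.replicate (c - K.card) n, by simp; omega, ?_, ?_⟩
  · intro v hv
    rw [List.mem_append, List.mem_map, List.mem_replicate] at hv
    rcases hv with ⟨i, -, rfl⟩ | ⟨-, rfl⟩
    exacts [i.2.le, le_rfl]
  · intro τ ρ h
    ext i
    have : i.val ≠ n := i.2.ne
    simp [tuple, h, Fin.val_inj, this]

lemma env_rows {n : ℕ} {G : SimpleGraph (Fin n)} {T : Finset (Fin n)} {k : ℕ} :
    Env G T (rows.eval (input G T k)) where
  size := eval_reg _ (by simp [rows, regs])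
  adj i j := by
    rw [eval_arr _ (by simp [rows, arrs])]
    have : (∃ i' j' : Fin n, i.val * n + j.val = i'.val * n + j'.val ∧ G.Adj i' j') ↔ G.Adj i j := by
      refine ⟨fun ⟨i', j', h, hij⟩ => ?_, fun h => ⟨i, j, rfl, h⟩⟩
      have hn : 0 < n := i.pos
      -- Division with remainder by n recovers the row and the column from the cell index.
      have h1 := congrArg (· / n) h
      have h2 := congrArg (· % n) h
      simp only [mul_comm _ n, Nat.mul_add_div hn, Nat.div_eq_of_lt (Fin.is_lt _), add_zero,
        Nat.mul_add_mod, Nat.mod_eq_of_lt (Fin.is_lt _)] at h1 h2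
      rwa [Fin.ext h1, Fin.ext h2]
    simp [input, this]
  terminal i := by
    rw [eval_arr _ (by simp [rows, arrs])]
    have : (∃ i' : Fin n, i.val = i'.val ∧ i' ∈ T) ↔ i ∈ T :=
      ⟨fun ⟨i', h, hi⟩ => by rwa [Fin.ext h], fun h => ⟨i, rfl, h⟩⟩
    simp [input, this]
  row := rows_spec rfl

open scoped Classical in
/-- On `(sP₁ + P₃)`-free graphs, the algorithm finds a largest set without odd `T`-cycles. -/
theorem exists_solver (s : ℕ) : ∃ m c, ∀ (n : ℕ) (G : SimpleGraph (Fin n)) (T : Finset (Fin n))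
    (k : ℕ), SFree s G → ∃ B, TBip G T B ∧ (∀ B', TBip G T B' → B'.card ≤ B.card) ∧
      (∀ i : Fin n, ((solver m c).eval (input G T k)).arr 2 i = if i ∈ B then 0 else 1) ∧
      ((solver m c).eval (input G T k)).reg 2 = if n - B.card ≤ k then 1 else 0 := by
  obtain ⟨f, hf⟩ := exists_short_oddTCycle s
  obtain ⟨c, hc⟩ := exists_kernel s
  -- `check m` sees odd cycles shorter than 2m, and with m = f + 1 this includes all those of length
  -- at most f.
  refine ⟨f + 1, c, fun n G T k hG => ?_⟩
  have hm : ∀ B, ¬ TBip G T B → ∃ q, OddTCycle G T q ∧ (∀ v ∈ q, v ∈ B) ∧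
      q.length < 2 * (f + 1) := fun B hB => by
    obtain ⟨q, h1, h2, h3⟩ := hf hG hB
    exact ⟨q, h1, h2, by omega⟩
  obtain ⟨K, F, hK, hF, hKT, hGr⟩ := hc G T hG
  obtain ⟨w, hwl, hwn, hwK⟩ := exists_tuple K hK
  obtain ⟨w', hwl', hwn', hwF⟩ := exists_tuple F hF
  set ρ := List.range' (10 + 2 * (f + 1)) c with hρ
  set ρ' := List.range' (10 + 2 * (f + 1) + c) c with hρ'
  have hle : ∀ x ∈ ρ ++ ρ', 10 + 2 * (f + 1) ≤ x := fun x => le_of_mem_solver_regs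
  have hle6 : 6 ∉ ρ ++ ρ' := fun h => absurd (hle 6 h) (by omega)
  rw [List.mem_append, not_or] at hle6
  have hbody : ∀ τ, Env G T τ ∧ τ.reg 1 = k ∧ Best G T τ →
      (Env G T ((FProg.seq (extend (f + 1) ρ ρ') update).eval τ) ∧
        ((FProg.seq (extend (f + 1) ρ ρ') update).eval τ).reg 1 = k ∧
        Best G T ((FProg.seq (extend (f + 1) ρ ρ') update).eval τ)) ∧
      τ.reg 4 ≤ ((FProg.seq (extend (f + 1) ρ ρ') update).eval τ).reg 4 ∧
      ∃ C, (TBip G T C → C.card ≤ ((FProg.seq (extend (f + 1) ρ ρ') update).eval τ).reg 4) ∧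
        (TBip G T (tuple n τ ρ) → GreedyExt G T (tuple n τ ρ) (tuple n τ ρ') C) := by
    rintro τ ⟨hE, hk, hB⟩
    obtain ⟨C, h1, h2, h3, h4⟩ := extend_spec hm hE hle6.1 hle6.2
    have hE' : Env G T ((extend (f + 1) ρ ρ').eval τ) := hE.eval (by simp [regs_extend])
      fun a ha h => by rcases arrs_extend h with rfl | rfl <;> simp at ha
    have hB' : Best G T ((extend (f + 1) ρ ρ').eval τ) := by
      rwa [Best, eval_arr _ fun h => by simpa using arrs_extend h,
        eval_reg (y := 4) _ (by simp [regs_extend])]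
    obtain ⟨h5, h6, h7⟩ := update_spec hE'.size hB' h1 h2 h3
    rw [eval_reg (P := extend (f + 1) ρ ρ') (y := 4) _ (by simp [regs_extend])] at h6
    refine ⟨⟨hE'.eval (by simp [regs_update]) (by simp [arrs_update]), ?_, h5⟩, h6, C, h7, h4⟩
    rw [eval_reg _ (notMem_regs_of_le (by omega)), hk]
  have h₁ : Env G T (rows.eval (input G T k)) := env_rows
  -- The invariant says that the instance is intact and array `5` holds a valid candidate. The
  -- property to be achieved is that the candidate is at least as large as some greedy extension of
  -- the good pair K, F.
  obtain ⟨⟨hE, hk, B, hBT, hB, hBc⟩, -, hR⟩ := nest_visit (n := n)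
    (P := .seq (extend (f + 1) ρ ρ') update)
    (fun τ => ∃ C, GreedyExt G T K F C ∧ C.card ≤ τ.reg 4) (ρ ++ ρ')
    (fun τ => Env G T τ ∧ τ.reg 1 = k ∧ Best G T τ) (fun τ h => h.1.size)
    (fun τ x hx v h => by
      have := hle x hx
      refine ⟨h.1.setReg (by omega) v, ?_, ?_⟩
      · rw [Memory.setReg_reg_of_ne _ _ (by omega), h.2.1]
      · rw [Best, Memory.setReg_reg_of_ne _ _ (by omega)]
        exact h.2.2)
    (fun τ x hx v h => by
      have := hle x hx
      rwa [Memory.setReg_reg_of_ne _ _ (by omega)])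
    (nodup_solver_regs _ _) (fun h => absurd (hle 0 h) (by omega))
    (fun x hx => notMem_regs_of_le (Or.inl (hle x hx))) (notMem_regs_of_le (by omega))
    (fun τ hτ => ⟨(hbody τ hτ).1, fun ⟨C, h1, h2⟩ => ⟨C, h1, h2.trans (hbody τ hτ).2.1⟩⟩)
    (rows.eval (input G T k)) ⟨h₁, by rw [eval_reg _ (by simp [rows, regs])]; simp [input],
      ∅, tBip_of_disjoint (by simp), by
        intro i
        rw [eval_arr _ (by simp [rows, arrs])]
        simp [input], by
        rw [eval_reg _ (by simp [rows, regs])]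
        simp [input]⟩
  obtain ⟨C, hC, hCB⟩ := hR (w ++ w') (by simp [hρ, hρ', hwl, hwl'])
    (by
      intro v hv
      rcases List.mem_append.1 hv with hv | hv
      exacts [hwn v hv, hwn' v hv])
    (fun τ hτ hw => by
      rw [List.map_append] at hw
      obtain ⟨hw1, hw2⟩ := List.append_inj hw (by simp [hρ, hwl])
      obtain ⟨-, -, C, h1, h2⟩ := hbody τ hτ
      rw [hwK τ ρ hw1, hwF τ ρ' hw2] at h2
      exact ⟨C, h2 hKT, h1 (h2 hKT).tBip⟩)
  rw [hBc] at hCB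
  refine ⟨B, hBT, fun B' hB' => (hGr C hC B' hB').trans hCB, ?_⟩
  rw [solver, eval, eval, eval, ← hρ, ← hρ']
  set τ := (nest (ρ ++ ρ') (.seq (extend (f + 1) ρ ρ') update)).eval (rows.eval (input G T k))
  constructor
  · intro i
    have h1 := loop_inv (x := 6) (b := 0) (σ := τ)
      (P := .store 2 (.reg 6) (.sub (.const 1) (.cell 5 (.reg 6)))) id
      (fun k τ' => ∀ j < k, τ'.arr 2 j = 1 - τ.arr 5 j) (by simp) (by
        intro k hk τ' hτx _ hτa hτ j hj
        rw [Memory.setReg_arr, eval, Memory.setCell_arr_self]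
        simp only [Exp.eval, hτx]
        split_ifs with hjk
        · rw [hτa 5 (by simp [arrs]), hjk]
        · exact hτ j (by omega))
    rw [eval, Memory.setReg_arr, h1 i (by rw [hE.size]; exact i.2)]
    have := hB i
    split_ifs with hi
    · have := this.2 hi
      omega
    · have := this.not.2 hi
      omega
  · rw [eval, Memory.setReg_reg_self]
    simp only [Exp.eval]
    rw [eval_reg (y := 0) _ (by simp [regs]), eval_reg (y := 1) _ (by simp [regs]),
      eval_reg (y := 4) _ (by simp [regs]), hE.size, hk, hBc]
    split_ifs <;> omega

end Solver

end SubsetOCT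

/-! ### One program, both problems -/

theorem mainTheorem3 (s : ℕ) :
    SubsetOCT.MinimumSolvableInPolyTime (fun _ G => SubsetOCT.InducedFree (SubsetOCT.sP1P3 s) G) ∧
      SubsetOCT.DecidableInPolyTime (fun _ G => SubsetOCT.InducedFree (SubsetOCT.sP1P3 s) G) := by
  obtain ⟨m, c, h⟩ := SubsetOCT.exists_solver s
  have hrun := SubsetOCT.FProg.exists_run (SubsetOCT.wf_solver m c)
    (SubsetOCT.zero_notMem_regs_solver m c)
  refine ⟨⟨(SubsetOCT.solver m c).compile, (SubsetOCT.solver m c).bound, fun n G T hG => ?_⟩,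
    ⟨(SubsetOCT.solver m c).compile, (SubsetOCT.solver m c).bound, fun n G T k _ hG => ?_⟩⟩
  · obtain ⟨t, ht, htb⟩ := hrun (SubsetOCT.input G T 0)
    obtain ⟨B, hB, hmax, hout, -⟩ := h n G T 0 hG.sFree
    refine ⟨_, t, ht, htb, Bᶜ, ⟨?_, fun S hS => ?_⟩, fun i => ?_⟩
    · rwa [SubsetOCT.isOddTCycleTransversal_iff, compl_compl]
    · have h1 := hmax Sᶜ (SubsetOCT.isOddTCycleTransversal_iff.1 hS)
      have h2 := Finset.card_add_card_compl S
      have h3 := Finset.card_add_card_compl B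
      omega
    · rw [hout i]
      by_cases hi : i ∈ B <;> simp [hi]
  · obtain ⟨t, ht, htb⟩ := hrun (SubsetOCT.input G T k)
    obtain ⟨B, hB, hmax, -, hout⟩ := h n G T k hG.sFree
    refine ⟨_, t, ht, htb, ?_⟩
    rw [hout]
    have hiff : n - B.card ≤ k ↔ ∃ S, SubsetOCT.IsOddTCycleTransversal G T S ∧ S.card ≤ k := by
      refine ⟨fun hk => ⟨Bᶜ, ?_, ?_⟩, fun ⟨S, hS, hSk⟩ => ?_⟩
      · rwa [SubsetOCT.isOddTCycleTransversal_iff, compl_compl]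
      · rwa [Finset.card_compl, Fintype.card_fin]
      · have h1 := hmax Sᶜ (SubsetOCT.isOddTCycleTransversal_iff.1 hS)
        rw [Finset.card_compl, Fintype.card_fin] at h1
        omega
    split_ifs with h1 h2 h2
    exacts [rfl, absurd (hiff.1 h1) h2, absurd (hiff.2 h2) h1, rfl]
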